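/- Let $Q\subset\mathbb P^3_{\mathbb C}$ be a smooth quadric surface and let $\varphi\colon Q\xrightarrow{\sim}\mathbb P^1\times\mathbb P^1$ be an isomorphism over $\mathbb C$. Set $\mathcal O_Q(a,b):=\varphi^*(\mathcal O_{\mathbb P^1}(a)\boxtimes\mathcal O_{\mathbb P^1}(b))$. Let $D\subset Q$ be a curve in the linear system $|\mathcal O_Q(2,3)|$, i.e. the scheme of zeros of a nonzero global section of $\mathcal O_Q(2,3)$ (it may be reducible or non-reduced). Then $D$ is $3$-regular in the sense of Castelnuovo–Mumford: its ideal sheaf $\mathcal I_D\subset\mathcal O_{\mathbb P^3}$ satisfies $$H^i(\mathbb P^3,\mathcal I_D(3-i))=0\qquad\text{for all } i>0.$$ -/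

import Mathlib

open CategoryTheory AlgebraicGeometry TopologicalSpace Opposite

attribute [local instance] MvPolynomial.gradedAlgebra

noncomputable section

namespace CastelnuovoMumford

variable {X Y : Scheme.{0}}

/-! ### Sections of sheaves of modules and sheaf cohomology -/

/-- Restriction of sections of an `𝒪_X`-module. -/
def res (M : X.Modules) {U V : X.Opens} (h : V ≤ U) : Γ(M, U) →+ Γ(M, V) :=
  (M.presheaf.map (homOfLE h).op).hom

/-- Restriction of functions. -/
def resO {U V : X.Opens} (h : V ≤ U) : Γ(X, U) →+* Γ(X, V) :=
  (X.presheaf.map (homOfLE h).op).hom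

lemma res_res (M : X.Modules) {U V W : X.Opens} (h : V ≤ U) (h' : W ≤ V) (m : Γ(M, U)) :
    res M h' (res M h m) = res M (h'.trans h) m := by
  have := M.presheaf.map_comp (homOfLE h).op (homOfLE h').op
  exact (ConcreteCategory.congr_hom this m).symm

lemma res_self (M : X.Modules) {U : X.Opens} (h : U ≤ U) (m : Γ(M, U)) :
    res M h m = m := by
  have := M.presheaf.map_id (op U)
  exact ConcreteCategory.congr_hom this m

lemma resO_resO {U V W : X.Opens} (h : V ≤ U) (h' : W ≤ V) (a : Γ(X, U)) :
    resO h' (resO h a) = resO (h'.trans h) a := by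
  have := X.presheaf.map_comp (homOfLE h).op (homOfLE h').op
  exact (ConcreteCategory.congr_hom this a).symm

lemma res_smul (M : X.Modules) {U V : X.Opens} (h : V ≤ U) (a : Γ(X, U)) (m : Γ(M, U)) :
    res M h (a • m) = resO h a • res M h m :=
  M.map_smul (homOfLE h) a m

/-- The cohomology group `Hⁱ(X, M)` of the sheaf of abelian groups underlying an `𝒪_X`-module. -/
abbrev H (M : X.Modules) (i : ℕ) : Type :=
  Sheaf.H (J := Opens.grothendieckTopology X) ⟨M.presheaf, M.isSheaf⟩ i

/-- The structure sheaf as a module over itself. -/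
def structureModule (X : Scheme.{0}) : X.Modules := SheafOfModules.unit X.ringCatSheaf

/-- The ideal sheaf of a closed immersion `f : Z ⟶ X`, as an `𝒪_X`-module: the kernel of
`𝒪_X ⟶ f_* 𝒪_Z`. -/
def idealSheaf (f : X ⟶ Y) : Y.Modules :=
  Limits.kernel (C := Y.Modules) (X := structureModule Y)
    (Y := (Scheme.Modules.pushforward f).obj (structureModule X))
    (SheafOfModules.unitToPushforwardObjUnit f.toRingCatSheafHom)

/-! ### Tensoring with a line bundle given by transition functions -/

section Twist

variable {ι : Type} (M : X.Modules) (U : ι → X.Opens) (g : ∀ i j, Γ(X, U i ⊓ U j)ˣ)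

/-- Sections over `V` of the twist of `M` by `g`: families of sections `m i` of `M` over `V ∩ U i`
with `m i = g i j • m j` over `V ∩ U i ∩ U j`. -/
def twistSections (V : X.Opens) : AddSubgroup (∀ i, Γ(M, V ⊓ U i)) where
  carrier := {m | ∀ i j,
    res M (inf_le_inf_left V (inf_le_left : U i ⊓ U j ≤ U i)) (m i) =
      resO (inf_le_right : V ⊓ (U i ⊓ U j) ≤ U i ⊓ U j) (g i j : Γ(X, U i ⊓ U j)) •
        res M (inf_le_inf_left V (inf_le_right : U i ⊓ U j ≤ U j)) (m j)}
  zero_mem' i j := by simp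
  add_mem' {a b} ha hb i j := by
    simp only [Set.mem_ofPred_eq] at ha hb
    simp [ha i j, hb i j]
  neg_mem' {a} ha i j := by
    simp only [Set.mem_ofPred_eq] at ha
    simp [ha i j]

/-- Functions on `V` act on `twistSections M U g V` componentwise. -/
instance (V : X.Opens) : SMul Γ(X, V) (twistSections M U g V) where
  smul a m := ⟨fun i => resO (inf_le_left : V ⊓ U i ≤ V) a • m.1 i, fun i j => by
    rw [res_smul, res_smul, m.2 i j, resO_resO, resO_resO, smul_comm]⟩

lemma twist_smul_apply {V : X.Opens} (a : Γ(X, V)) (m : twistSections M U g V) (i : ι) :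
    (a • m).1 i = resO (inf_le_left : V ⊓ U i ≤ V) a • m.1 i := rfl

instance (V : X.Opens) : Module Γ(X, V) (twistSections M U g V) where
  one_smul m := Subtype.ext (funext fun i => by simp [twist_smul_apply])
  mul_smul a b m := Subtype.ext (funext fun i => by simp [twist_smul_apply, mul_smul])
  smul_zero a := Subtype.ext (funext fun i => by simp [twist_smul_apply])
  smul_add a m m' := Subtype.ext (funext fun i => by simp [twist_smul_apply])
  add_smul a b m := Subtype.ext (funext fun i => by simp [twist_smul_apply, add_smul])
  zero_smul m := Subtype.ext (funext fun i => by simp [twist_smul_apply])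

/-- Restriction of sections of the twist. -/
def twistRes {V W : X.Opens} (h : W ≤ V) : twistSections M U g V →+ twistSections M U g W where
  toFun m := ⟨fun i => res M (inf_le_inf_right (U i) h) (m.1 i), fun i j => by
    have := congrArg (res M (inf_le_inf_right (U i ⊓ U j) h)) (m.2 i j)
    rw [res_smul, resO_resO, res_res, res_res] at this
    rw [res_res, res_res, this]⟩
  map_zero' := Subtype.ext (funext fun i => by simp)
  map_add' a b := Subtype.ext (funext fun i => by simp)

lemma twistRes_smul {V W : X.Opens} (h : W ≤ V) (a : Γ(X, V)) (m : twistSections M U g V) :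
    twistRes M U g h (a • m) = resO h a • twistRes M U g h m :=
  Subtype.ext (funext fun i => by
    change res M _ (resO _ a • m.1 i) = resO _ (resO h a) • res M _ (m.1 i)
    rw [res_smul, resO_resO, resO_resO])

/-- The presheaf of abelian groups underlying the twist. -/
def twistPresheaf : TopCat.Presheaf Ab X where
  obj V := AddCommGrpCat.of (twistSections M U g V.unop)
  map f := AddCommGrpCat.ofHom (twistRes M U g (leOfHom f.unop))
  map_id V := by
    refine AddCommGrpCat.hom_ext (AddMonoidHom.ext fun m => Subtype.ext (funext fun i => ?_))
    exact res_self M _ (m.1 i)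
  map_comp f f' := by
    refine AddCommGrpCat.hom_ext (AddMonoidHom.ext fun m => Subtype.ext (funext fun i => ?_))
    exact (res_res M _ _ (m.1 i)).symm

lemma twistPresheaf_isSheaf : (twistPresheaf M U g).IsSheaf := by
  rw [TopCat.Presheaf.isSheaf_iff_isSheafUniqueGluing]
  intro κ W sf hsf
  let F : TopCat.Sheaf Ab X := ⟨M.presheaf, M.isSheaf⟩
  let sf' : ∀ k, twistSections M U g (W k) := sf
  have hW (O : X.Opens) : iSup W ⊓ O ≤ ⨆ k, W k ⊓ O := (iSup_inf_eq W O).le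
  have hc (k l : κ) (i : ι) :
      res M (inf_le_inf_right (U i) (inf_le_left : W k ⊓ W l ≤ W k)) ((sf' k).1 i) =
        res M (inf_le_inf_right (U i) (inf_le_right : W k ⊓ W l ≤ W l)) ((sf' l).1 i) :=
    congrFun (congrArg Subtype.val (hsf k l)) i
  have key (i : ι) : ∃! s : Γ(M, iSup W ⊓ U i),
      ∀ k, res M (inf_le_inf_right (U i) (le_iSup W k)) s = (sf' k).1 i := by
    refine TopCat.Sheaf.existsUnique_gluing' F (fun k => W k ⊓ U i) (iSup W ⊓ U i)
      (fun k => homOfLE (inf_le_inf_right (U i) (le_iSup W k))) (hW (U i))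
      (fun k => (sf' k).1 i) ?_
    intro k l
    have h : (W k ⊓ U i) ⊓ (W l ⊓ U i) ≤ (W k ⊓ W l) ⊓ U i :=
      le_inf (inf_le_inf inf_le_left inf_le_left) (inf_le_left.trans inf_le_right)
    have := congrArg (res M h) (hc k l i)
    rwa [res_res, res_res] at this
  choose t ht htu using key
  refine ⟨(⟨t, fun i j => ?_⟩ : twistSections M U g (iSup W)), fun k => ?_, fun t' ht' => ?_⟩
  · refine TopCat.Sheaf.eq_of_locally_eq' F (fun k => W k ⊓ (U i ⊓ U j)) (iSup W ⊓ (U i ⊓ U j))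
      (fun k => homOfLE (inf_le_inf_right _ (le_iSup W k))) (hW _) _ _ fun k => ?_
    change res M _ (res M _ _) = res M _ (_ • res M _ _)
    have h1 := (sf' k).2 i j
    rw [← ht i k, ← ht j k, res_res, res_res] at h1
    rw [res_smul, resO_resO, res_res, res_res]
    exact h1
  · exact Subtype.ext (funext fun i => ht i k)
  · refine Subtype.ext (funext fun i => htu i _ fun k => ?_)
    exact congrFun (congrArg Subtype.val (ht' k)) i

/-- The `𝒪_X`-module `M ⊗ L`, where `L` is the line bundle that is trivial on the members of the
open cover `U` and has transition functions `g`: it is glued from the restrictions of `M` to the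
`U i` by `m i = g i j • m j`. -/
def twistBy : X.Modules where
  val :=
    letI (V : (Opens X)ᵒᵖ) : Module (X.ringCatSheaf.obj.obj V) ((twistPresheaf M U g).obj V) :=
      inferInstanceAs (Module Γ(X, V.unop) (twistSections M U g V.unop))
    PresheafOfModules.ofPresheaf (twistPresheaf M U g) fun _ _ f a m =>
      twistRes_smul M U g (leOfHom f.unop) a m
  isSheaf := twistPresheaf_isSheaf M U g

end Twist

/-! ### Projective space and Serre twists -/

/-- Projective `n`-space over `ℂ`. -/
def PP (n : ℕ) : Scheme.{0} := Proj (MvPolynomial.homogeneousSubmodule (Fin (n + 1)) ℂ)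

/-- The structure morphism of projective space. -/
def PP.toSpec (n : ℕ) : PP n ⟶ Spec (.of ℂ) :=
  Proj.toSpecZero (MvPolynomial.homogeneousSubmodule (Fin (n + 1)) ℂ) ≫
    Spec.map (CommRingCat.ofHom
      (algebraMap ℂ (MvPolynomial.homogeneousSubmodule (Fin (n + 1)) ℂ 0)))

/-- The open set where the `i`-th homogeneous coordinate does not vanish. -/
def PP.chart {n : ℕ} (i : Fin (n + 1)) : (PP n).Opens :=
  Proj.basicOpen (MvPolynomial.homogeneousSubmodule (Fin (n + 1)) ℂ) (MvPolynomial.X i)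

/-- The function `x_j / x_i` on the `i`-th chart. -/
def PP.coord {n : ℕ} (i j : Fin (n + 1)) : Γ(PP n, PP.chart i) :=
  Proj.awayToSection (MvPolynomial.homogeneousSubmodule (Fin (n + 1)) ℂ) (MvPolynomial.X i)
    (HomogeneousLocalization.Away.mk (MvPolynomial.homogeneousSubmodule (Fin (n + 1)) ℂ)
      (MvPolynomial.isHomogeneous_X ℂ i) 1 (MvPolynomial.X j)
      (by simpa using MvPolynomial.isHomogeneous_X ℂ j))

lemma PP.coord_mul_coord {n : ℕ} (i j : Fin (n + 1)) :
    resO (inf_le_left : PP.chart i ⊓ PP.chart j ≤ PP.chart i) (PP.coord i j) *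
      resO (inf_le_right : PP.chart i ⊓ PP.chart j ≤ PP.chart j) (PP.coord j i) = 1 := by
  let 𝒜 := MvPolynomial.homogeneousSubmodule (Fin (n + 1)) ℂ
  have hX (k : Fin (n + 1)) : (MvPolynomial.X k : MvPolynomial (Fin (n + 1)) ℂ) ∈ 𝒜 1 :=
    MvPolynomial.isHomogeneous_X ℂ k
  let x : MvPolynomial (Fin (n + 1)) ℂ := MvPolynomial.X i * MvPolynomial.X j
  have hx : x = MvPolynomial.X i * MvPolynomial.X j := rfl
  have hx' : x = MvPolynomial.X j * MvPolynomial.X i := mul_comm _ _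
  let D : (PP n).Opens := Proj.basicOpen 𝒜 x
  have hD : PP.chart i ⊓ PP.chart j ≤ D := (Proj.basicOpen_mul 𝒜 _ _).ge
  have hi : D ≤ PP.chart i := (Proj.basicOpen_mul 𝒜 _ _).le.trans inf_le_left
  have hj : D ≤ PP.chart j := (Proj.basicOpen_mul 𝒜 _ _).le.trans inf_le_right
  have h1 := ConcreteCategory.congr_hom (Proj.awayMap_awayToSection 𝒜 (hX j) hx)
    (HomogeneousLocalization.Away.mk 𝒜 (hX i) 1 (MvPolynomial.X j) (by simpa using hX j))
  have h2 := ConcreteCategory.congr_hom (Proj.awayMap_awayToSection 𝒜 (hX i) hx')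
    (HomogeneousLocalization.Away.mk 𝒜 (hX j) 1 (MvPolynomial.X i) (by simpa using hX i))
  have key : resO hi (PP.coord i j) * resO hj (PP.coord j i) = 1 := by
    refine (congrArg₂ (· * ·) h1.symm h2.symm).trans ?_
    change Proj.awayToSection 𝒜 x _ * Proj.awayToSection 𝒜 x _ = 1
    rw [← map_mul]
    refine (congrArg (Proj.awayToSection 𝒜 x).hom ?_).trans (map_one _)
    change HomogeneousLocalization.awayMap 𝒜 (hX j) hx _ *
      HomogeneousLocalization.awayMap 𝒜 (hX i) hx' _ = 1
    rw [HomogeneousLocalization.awayMap_mk, HomogeneousLocalization.awayMap_mk]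
    ext
    simp only [HomogeneousLocalization.val_mul, HomogeneousLocalization.val_one,
      HomogeneousLocalization.Away.val_mk, Localization.mk_mul]
    rw [← Localization.mk_one, Localization.mk_eq_mk_iff, Localization.r_iff_exists]
    use 1
    simp only [OneMemClass.coe_one, one_mul, Submonoid.coe_mul, mul_one, pow_one, hx]
    ring
  have := congrArg (resO hD) key
  rwa [map_mul, map_one, resO_resO, resO_resO] at this

/-- The invertible function `x_j / x_i` on the intersection of the `i`-th and the `j`-th chart. -/
def PP.coordUnit {n : ℕ} (i j : Fin (n + 1)) :
    Γ(PP n, (PP.chart i ⊓ PP.chart j : (PP n).Opens))ˣ where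
  val := resO inf_le_left (PP.coord i j)
  inv := resO inf_le_right (PP.coord j i)
  val_inv := PP.coord_mul_coord i j
  inv_val := (mul_comm _ _).trans (PP.coord_mul_coord i j)

/-- For a morphism `f : X ⟶ ℙⁿ` and an `𝒪_X`-module `M`, the module `M ⊗ f^* 𝒪(k)`. Here `𝒪(k)` is
trivialized by `x_i ^ k` on the `i`-th chart, so that its transition functions are
`(x_j / x_i) ^ k`. -/
def twist {n : ℕ} (f : X ⟶ PP n) (k : ℤ) (M : X.Modules) : X.Modules :=
  twistBy M (fun i => f ⁻¹ᵁ PP.chart i)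
    (fun i j => Units.map
      (f.appLE (PP.chart i ⊓ PP.chart j) (f ⁻¹ᵁ PP.chart i ⊓ f ⁻¹ᵁ PP.chart j) le_rfl).hom.toMonoidHom
      (PP.coordUnit i j) ^ k)

/-- The line bundle `𝒪(k)` on projective space. -/
def lineBundle (n : ℕ) (k : ℤ) : (PP n).Modules := twist (𝟙 (PP n)) k (structureModule (PP n))

/-- An `𝒪`-module `F` on `ℙⁿ` is `m`-regular in the sense of Castelnuovo and Mumford if
`Hⁱ(ℙⁿ, F(m - i)) = 0` for all `i > 0`. -/
def IsRegular {n : ℕ} (m : ℤ) (F : (PP n).Modules) : Prop :=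
  ∀ i : ℕ, 0 < i → Subsingleton (H (twist (𝟙 (PP n)) (m - i) F) i)

/-- A closed subscheme `Z` of `ℙⁿ` is `m`-regular if its ideal sheaf is. -/
def IsRegularSubscheme {n : ℕ} {Z : Scheme.{0}} (m : ℤ) (f : Z ⟶ PP n) : Prop :=
  IsRegular m (idealSheaf f)

/-! ### Linear systems -/

/-- A section `e` of `L` over `U` is a frame if it trivializes `L` over `U`. -/
def IsFrame (L : X.Modules) {U : X.Opens} (e : Γ(L, U)) : Prop :=
  ∀ (V : X.Opens) (h : V ≤ U), Function.Bijective fun a : Γ(X, V) => a • res L h e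

/-- `I` is the ideal sheaf of the scheme of zeros of the global section `s` of the line bundle
`L`: if `s = a • e` for a frame `e` of `L` over an affine open `U`, then `I` is generated by `a`
over `U`. -/
def IsZeroScheme (L : X.Modules) (s : Γ(L, ⊤)) (I : X.IdealSheafData) : Prop :=
  ∀ (U : X.affineOpens) (e : Γ(L, U.1)), IsFrame L e →
    ∀ a : Γ(X, U.1), res L le_top s = a • e → I.ideal U = Ideal.span {a}

/-- The subscheme `j : D ⟶ X` of an integral scheme `X` belongs to the linear system `|L|` of the
line bundle `L`: it is the scheme of zeros of a nonzero global section of `L`. -/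
def MemLinearSystem (L : X.Modules) {D : Scheme.{0}} (j : D ⟶ X) : Prop :=
  IsClosedImmersion j ∧ ∃ s : Γ(L, ⊤), s ≠ 0 ∧ IsZeroScheme L s j.ker

/-! ### Smooth quadrics -/

/-- `i : Q ⟶ ℙ³` is a smooth quadric surface: the scheme of zeros of a nonzero section of `𝒪(2)`,
smooth over `ℂ`. -/
def IsSmoothQuadric {Q : Scheme.{0}} (i : Q ⟶ PP 3) : Prop :=
  MemLinearSystem (lineBundle 3 2) i ∧ Smooth (i ≫ PP.toSpec 3)

/-- The scheme `ℙ¹ × ℙ¹` over `ℂ`. -/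
abbrev P1xP1 : Scheme.{0} := Limits.pullback (PP.toSpec 1) (PP.toSpec 1)

/-- The first projection. -/
abbrev P1xP1.fst : P1xP1 ⟶ PP 1 := Limits.pullback.fst (PP.toSpec 1) (PP.toSpec 1)

/-- The second projection. -/
abbrev P1xP1.snd : P1xP1 ⟶ PP 1 := Limits.pullback.snd (PP.toSpec 1) (PP.toSpec 1)

/-- The line bundle `φ^*(𝒪(a) ⊠ 𝒪(b))` on `Q`, for `φ : Q ⟶ ℙ¹ × ℙ¹`. -/
def biLineBundle {Q : Scheme.{0}} (φ : Q ⟶ P1xP1) (a b : ℤ) : Q.Modules :=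
  twist (φ ≫ P1xP1.fst) a (twist (φ ≫ P1xP1.snd) b (structureModule Q))

end CastelnuovoMumford

end

/-! For D ⊂ Q ⊂ ℙ³ and every k there is an exact sequence 0 → I_Q(k) → I_D(k) → i_* I_{D/Q}(k) → 0
(`twistIdeal_shortExact`), so Hᵐ(I_D(3 - m)) vanishes once the two outer terms have no Hᵐ
(`subsingleton_H_idealSheaf_comp`). Here I_Q ≅ 𝒪(-2), and I_{D/Q}(k) ≅ 𝒪_Q(k a₀ - 2, k a₁ - 3),
where 𝒪(1) restricts to 𝒪_Q(a₀, a₁). That a₀ = a₁ = 1 is not needed; a₀, a₁ ≥ 1 suffices. For m = 1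
the outer terms are 𝒪 and a bundle of bidegree at least (0, -1); for m = 2 they are 𝒪(-1) and a
bundle of first degree at least -1; for m = 3 they are 𝒪(-2) on ℙ³ and a sheaf on a surface; beyond
that both vanish by dimension.

Positivity of the aᵢ (`BiP1.exists_coordinates`): the charts of ℙ¹ × ℙ¹ have factorial rings, so a
morphism to ℙⁿ has coprime homogeneous coordinates on each of them, and on overlaps these differ by
units of a ring of Laurent polynomials, that is, by monomials up to constants
(`ToricAtlas.exists_monomial_coordinates`). If some aᵢ were ≤ 0, all coordinates would have a single
degree along one factor, so their ratios could not generate the function field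
(`BiP1.not_isHomQuot`), against the closed immersion.

Vanishing for line bundles: every sheaf in question is realized inside the function field (`Rat`),
with monomial generators on toric charts (`ToricAtlas.MonFrames`). A monomial is a section over an
intersection of charts exactly when it lies in the half spaces common to these charts, suitably
translated. The Čech complex therefore splits into pieces indexed by monomials, and a piece is exact
as soon as one chart serves as the vertex of a cone (`cechExact_of_monomial`,
`ToricAtlas.MonFrames.van`). The remaining vanishing follows from the number of affine sets in a
cover (`van_finset_sup`) and Mayer–Vietoris (`van_succ_sup`).

Cohomology enters through dimension shifting: `Van n F U` says that Hⁿ⁺¹(U, F) = 0, in terms of the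
embedding of F into the product of skyscrapers on injective hulls of its stalks. Affine vanishing is
proved for sheaves isomorphic to the structure sheaf (`AddFrame.van`), and
`subsingleton_pushforward` compares `Van` with Ext groups, including pushforward from a closed
subspace. -/

open CategoryTheory AlgebraicGeometry TopologicalSpace Opposite

attribute [local instance] MvPolynomial.gradedAlgebra

noncomputable section

namespace CastelnuovoMumford

/-! ### Sections of abelian sheaves -/

section Cohomology

variable {X : TopCat.{0}}

/-- The presheaf underlying an abelian sheaf. -/
abbrev psh (F : TopCat.Sheaf Ab.{0} X) : TopCat.Presheaf Ab.{0} X := F.obj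

/-- Sections of an abelian sheaf. -/
abbrev Sec (F : TopCat.Sheaf Ab.{0} X) (U : Opens X) : Type := F.obj.obj (op U)

/-- Restriction of sections. -/
def rs (F : TopCat.Sheaf Ab.{0} X) {U V : Opens X} (h : V ≤ U) : Sec F U →+ Sec F V :=
  (F.obj.map (homOfLE h).op).hom

/-- The action of a morphism of sheaves on sections. -/
def ap {F G : TopCat.Sheaf Ab.{0} X} (f : F ⟶ G) (U : Opens X) : Sec F U →+ Sec G U :=
  (f.hom.app (op U)).hom

lemma rs_rs (F : TopCat.Sheaf Ab.{0} X) {U V W : Opens X} (h : V ≤ U) (h' : W ≤ V) (s : Sec F U) :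
    rs F h' (rs F h s) = rs F (h'.trans h) s := by
  have := F.obj.map_comp (homOfLE h).op (homOfLE h').op
  exact (ConcreteCategory.congr_hom this s).symm

lemma rs_self (F : TopCat.Sheaf Ab.{0} X) {U : Opens X} (h : U ≤ U) (s : Sec F U) : rs F h s = s := by
  have := F.obj.map_id (op U)
  exact ConcreteCategory.congr_hom this s

lemma ap_rs {F G : TopCat.Sheaf Ab.{0} X} (f : F ⟶ G) {U V : Opens X} (h : V ≤ U) (s : Sec F U) :
    ap f V (rs F h s) = rs G h (ap f U s) :=
  ConcreteCategory.congr_hom (f.hom.naturality (homOfLE h).op) s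

lemma sec_ext (F : TopCat.Sheaf Ab.{0} X) {ι : Type} (U : ι → Opens X) {V : Opens X}
    (hU : ∀ i, U i ≤ V) (hV : V ≤ iSup U) {s t : Sec F V}
    (h : ∀ i, rs F (hU i) s = rs F (hU i) t) : s = t :=
  TopCat.Sheaf.eq_of_locally_eq' F U V (fun i => homOfLE (hU i)) hV s t h

lemma sec_ext_two (F : TopCat.Sheaf Ab.{0} X) {U V W : Opens X} (hU : U ≤ W) (hV : V ≤ W)
    (hW : W ≤ U ⊔ V) {s t : Sec F W} (h : rs F hU s = rs F hU t) (h' : rs F hV s = rs F hV t) :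
    s = t :=
  TopCat.Sheaf.eq_of_locally_eq₂ F (homOfLE hU) (homOfLE hV) hW s t h h'

lemma sec_glue (F : TopCat.Sheaf Ab.{0} X) {ι : Type} (U : ι → Opens X) {V : Opens X}
    (hU : ∀ i, U i ≤ V) (hV : V ≤ iSup U) (s : ∀ i, Sec F (U i))
    (h : ∀ i j, rs F (inf_le_left : U i ⊓ U j ≤ U i) (s i) =
      rs F (inf_le_right : U i ⊓ U j ≤ U j) (s j)) :
    ∃ t : Sec F V, ∀ i, rs F (hU i) t = s i :=
  (TopCat.Sheaf.existsUnique_gluing' F U V (fun i => homOfLE (hU i)) hV s h).exists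

lemma sec_glue_two (F : TopCat.Sheaf Ab.{0} X) {U V W : Opens X} (hU : U ≤ W) (hV : V ≤ W)
    (hW : W ≤ U ⊔ V) (s : Sec F U) (t : Sec F V)
    (h : rs F (inf_le_left : U ⊓ V ≤ U) s = rs F (inf_le_right : U ⊓ V ≤ V) t) :
    ∃ w : Sec F W, rs F hU w = s ∧ rs F hV w = t := by
  let P : Bool → Opens X := fun b => bif b then U else V
  let sf : ∀ b, Sec F (P b) := fun b => match b with | true => s | false => t
  obtain ⟨w, hw⟩ := sec_glue F P (V := W) (by rintro (_ | _); exacts [hV, hU])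
    (hW.trans (sup_le (le_iSup P true) (le_iSup P false))) sf (by
      rintro (_ | _) (_ | _)
      · rfl
      · have h1 : (V ⊓ U : Opens X) ≤ U ⊓ V := le_inf inf_le_right inf_le_left
        have := congrArg (rs F h1) h
        rw [rs_rs, rs_rs] at this
        exact this.symm
      · exact h
      · rfl)
  exact ⟨w, hw true, hw false⟩

/-! ### Exactness on sections -/

lemma locally_surjective_of_epi {F G : TopCat.Sheaf Ab.{0} X} (f : F ⟶ G) [Epi f] {U : Opens X}
    (s : Sec G U) {x : X} (hx : x ∈ U) :
    ∃ (V : Opens X) (h : V ≤ U) (t : Sec F V), ap f V t = rs G h s ∧ x ∈ V := by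
  obtain ⟨V, h, ⟨t, ht⟩, hV⟩ := (TopCat.Presheaf.isLocallySurjective_iff f.hom).mp
    ((TopCat.Sheaf.isLocallySurjective_iff_epi f).mpr inferInstance) U s x hx
  exact ⟨V, h, t, ht, hV⟩

lemma epi_of_locally_surjective {F G : TopCat.Sheaf Ab.{0} X} (f : F ⟶ G)
    (h : ∀ (U : Opens X) (s : Sec G U) (x : X), x ∈ U →
      ∃ (V : Opens X) (h : V ≤ U) (t : Sec F V), ap f V t = rs G h s ∧ x ∈ V) : Epi f := by
  refine (TopCat.Sheaf.isLocallySurjective_iff_epi f).mp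
    ((TopCat.Presheaf.isLocallySurjective_iff f.hom).mpr fun U s x hx => ?_)
  obtain ⟨V, h, t, ht, hV⟩ := h U s x hx
  exact ⟨V, h, ⟨t, ht⟩, hV⟩

lemma mono_of_ap_injective {F G : TopCat.Sheaf Ab.{0} X} (f : F ⟶ G)
    (h : ∀ U, Function.Injective (ap f U)) : Mono f := by
  refine ⟨fun {Z} a b hab => ?_⟩
  refine CategoryTheory.Sheaf.hom_ext (NatTrans.ext (funext fun U => ?_))
  ext s
  exact h _ (ConcreteCategory.congr_hom (congrArg (fun g => g.hom.app U) hab) s)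

/-- Exactness in the middle can be tested on stalks: a germ killed by `g` is already killed on a
smaller open set, where `hex` applies. Only surjectivity is asked for locally. -/
lemma shortExact_of_sections {F G K : TopCat.Sheaf Ab.{0} X} (f : F ⟶ G) (g : G ⟶ K) (w : f ≫ g = 0)
    (hf : ∀ U, Function.Injective (ap f U))
    (hex : ∀ U (s : Sec G U), ap g U s = 0 → ∃ t, ap f U t = s)
    (hg : ∀ (U : Opens X) (s : Sec K U) (x : X), x ∈ U →
      ∃ (V : Opens X) (h : V ≤ U) (t : Sec G V), ap g V t = rs K h s ∧ x ∈ V) :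
    (ShortComplex.mk f g w).ShortExact := by
  refine ShortComplex.ShortExact.mk' ?_ (mono_of_ap_injective f hf)
    (epi_of_locally_surjective g hg)
  rw [TopCat.Sheaf.exact_iff_stalkFunctor_map_exact]
  intro x
  rw [ShortComplex.ab_exact_iff]
  intro (t : (psh G).stalk x) (ht : (TopCat.Presheaf.stalkFunctor Ab.{0} x).map g.hom t = 0)
  obtain ⟨U, hxU, s, rfl⟩ := (psh G).exists_germ_eq t
  rw [TopCat.Presheaf.stalkFunctor_map_germ_apply] at ht
  obtain ⟨V, hxV, i, j, hV⟩ := (psh K).germ_eq x hxU hxU (g.hom.app _ s) 0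
    (ht.trans (map_zero _).symm)
  rw [map_zero] at hV
  obtain ⟨t, ht⟩ := hex V (rs G i.le s) ((ap_rs g i.le s).trans hV)
  refine ⟨(psh F).germ V x hxV t, ?_⟩
  change (TopCat.Presheaf.stalkFunctor Ab.{0} x).map f.hom _ = _
  rw [TopCat.Presheaf.stalkFunctor_map_germ_apply]
  exact (congrArg ((psh G).germ V x hxV) ht).trans ((psh G).germ_res_apply i x hxV s)

/-! ### Sheaves of discontinuous sections -/

section Disc

variable {T : Type} (p : T → X) (A : T → Ab.{0})

/-- The presheaf of families of elements of the `A t`, for `t` with `p t` in the given open set. -/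
def discPresheaf : TopCat.Presheaf Ab.{0} X where
  obj O := AddCommGrpCat.of (∀ t : {t // p t ∈ O.unop}, A t.1)
  map f := AddCommGrpCat.ofHom
    { toFun := fun s t => s ⟨t.1, leOfHom f.unop t.2⟩
      map_zero' := rfl
      map_add' := fun _ _ => rfl }

lemma discPresheaf_isSheaf : (discPresheaf p A).IsSheaf := by
  rw [TopCat.Presheaf.isSheaf_iff_isSheafUniqueGluing]
  intro κ W sf hsf
  let sf' : ∀ k, ∀ t : {t // p t ∈ W k}, A t.1 := sf
  have hW (t : {t // p t ∈ iSup W}) : ∃ k, p t.1 ∈ W k := Opens.mem_iSup.mp t.2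
  have hc (k l : κ) (t : T) (hk : p t ∈ W k) (hl : p t ∈ W l) : sf' k ⟨t, hk⟩ = sf' l ⟨t, hl⟩ :=
    congrFun (hsf k l) ⟨t, hk, hl⟩
  refine ⟨fun t : {t // p t ∈ iSup W} => sf' (hW t).choose ⟨t.1, (hW t).choose_spec⟩,
    fun k => funext fun t => hc _ _ _ _ _, fun s hs => funext fun t => ?_⟩
  exact congrFun (hs (hW t).choose) ⟨t.1, (hW t).choose_spec⟩

/-- The sheaf of families of elements of the `A t`, for `t` with `p t` in the given open set. -/
def disc : TopCat.Sheaf Ab.{0} X := ⟨discPresheaf p A, discPresheaf_isSheaf p A⟩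

variable {p A}

/-- The morphism to a sheaf of discontinuous sections given by morphisms on the stalks. -/
def toDisc {G : TopCat.Sheaf Ab.{0} X} (ψ : ∀ t, (psh G).stalk (p t) ⟶ A t) : G ⟶ disc p A where
  hom :=
    { app := fun U => AddCommGrpCat.ofHom
        { toFun := fun s t => ψ t.1 ((psh G).germ U.unop (p t.1) t.2 s)
          map_zero' := funext fun t => by simp
          map_add' := fun a b => funext fun t => by simp }
      naturality := fun U V f => by
        ext s
        refine funext fun t => ?_
        exact congrArg (ψ t.1) ((psh G).germ_res_apply' f (p t.1) t.2 s) }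

/-- The morphisms on stalks given by a morphism to a sheaf of discontinuous sections. -/
def ofDisc {G : TopCat.Sheaf Ab.{0} X} (φ : G ⟶ disc p A) (t : T) : (psh G).stalk (p t) ⟶ A t :=
  Limits.colimit.desc ((OpenNhds.inclusion (p t)).op ⋙ G.obj)
    { pt := A t
      ι :=
        { app := fun U => φ.hom.app (op U.unop.1) ≫ AddCommGrpCat.ofHom
            (Pi.evalAddMonoidHom (fun t : {t // p t ∈ U.unop.1} => (A t.1 : Type)) ⟨t, U.unop.2⟩)
          naturality := fun U V f => by
            ext s
            exact congrFun (ConcreteCategory.congr_hom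
              (φ.hom.naturality ((OpenNhds.inclusion (p t)).op.map f)) s) ⟨t, V.unop.2⟩ } }

lemma ofDisc_germ {G : TopCat.Sheaf Ab.{0} X} (φ : G ⟶ disc p A) (t : T) {U : Opens X} (h : p t ∈ U)
    (s : Sec G U) : ofDisc φ t ((psh G).germ U (p t) h s) =
      (ap φ U s : ∀ t : {t // p t ∈ U}, A t.1) ⟨t, h⟩ := by
  have := Limits.colimit.ι_desc (F := (OpenNhds.inclusion (p t)).op ⋙ G.obj)
    { pt := A t
      ι :=
        { app := fun U => φ.hom.app (op U.unop.1) ≫ AddCommGrpCat.ofHom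
            (Pi.evalAddMonoidHom (fun t : {t // p t ∈ U.unop.1} => (A t.1 : Type)) ⟨t, U.unop.2⟩)
          naturality := fun U V f => by
            ext s
            exact congrFun (ConcreteCategory.congr_hom
              (φ.hom.naturality ((OpenNhds.inclusion (p t)).op.map f)) s) ⟨t, V.unop.2⟩ } }
    (op ⟨U, h⟩)
  exact ConcreteCategory.congr_hom this s

/-- The sheaf is a product of skyscrapers, so a morphism into it is a family of morphisms out of
stalks. Monomorphisms are injective on stalks, where injectivity of `A t` supplies the extension.
Allowing any map `p` makes pushforwards of such sheaves instances of the same construction. -/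
instance [∀ t, Injective (A t)] : Injective (disc p A) where
  factors {G H} φ f _ := by
    let μ (t : T) : (psh G).stalk (p t) ⟶ (psh H).stalk (p t) :=
      (TopCat.Presheaf.stalkFunctor Ab.{0} (p t)).map f.hom
    have hm (t : T) : Mono (μ t) := TopCat.Presheaf.stalk_mono_of_mono f (p t)
    let ψ (t : T) : (psh H).stalk (p t) ⟶ A t := Injective.factorThru (ofDisc φ t) (μ t)
    refine ⟨toDisc ψ, CategoryTheory.Sheaf.hom_ext (NatTrans.ext (funext fun U => ?_))⟩
    ext s
    refine funext fun t => ?_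
    have h1 : ψ t.1 (μ t.1 ((psh G).germ U.unop (p t.1) t.2 s)) = ofDisc φ t.1 ((psh G).germ U.unop (p t.1) t.2 s) :=
      ConcreteCategory.congr_hom (Injective.comp_factorThru (ofDisc φ t.1) (μ t.1)) _
    rw [ofDisc_germ] at h1
    exact (congrArg (ψ t.1) (TopCat.Presheaf.stalkFunctor_map_germ_apply U.unop (p t.1) t.2
      f.hom s)).symm.trans h1

/-- Extension by zero: these sheaves are flasque. -/
lemma disc_restrict_surjective {U V : Opens X} (h : V ≤ U) :
    Function.Surjective (rs (disc p A) h) := by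
  classical
  intro s
  let s' : ∀ t : {t // p t ∈ V}, A t.1 := s
  exact ⟨(fun t => if ht : p t.1 ∈ V then s' ⟨t.1, ht⟩ else 0 : ∀ t : {t // p t ∈ U}, A t.1),
    funext fun t => dif_pos t.2⟩

end Disc

/-! ### Dimension shifting -/

variable (F : TopCat.Sheaf Ab.{0} X)

/-- An injective abelian sheaf containing `F`. -/
def injSheaf : TopCat.Sheaf Ab.{0} X := disc id fun x => Injective.under ((psh F).stalk x)

/-- The embedding of `F` into an injective sheaf. -/
def toInj : F ⟶ injSheaf F := toDisc (p := id) fun x => Injective.ι ((psh F).stalk x)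

lemma toInj_injective (U : Opens X) : Function.Injective (ap (toInj F) U) := by
  intro s t h
  refine TopCat.Presheaf.section_ext F U s t fun x hx => ?_
  exact (AddCommGrpCat.mono_iff_injective (Injective.ι ((psh F).stalk x))).mp inferInstance
    (congrFun h ⟨x, hx⟩)

instance : Mono (toInj F) := mono_of_ap_injective _ (toInj_injective F)

/-- The cokernel of the embedding of `F` into an injective sheaf. -/
def shift : TopCat.Sheaf Ab.{0} X := Limits.cokernel (toInj F)

/-- The projection from the injective sheaf to the quotient. -/
def toShift : injSheaf F ⟶ shift F := Limits.cokernel.π (toInj F)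

instance : Epi (toShift F) := inferInstanceAs (Epi (Limits.cokernel.π (toInj F)))

lemma toInj_toShift : toInj F ≫ toShift F = 0 := Limits.cokernel.condition _

lemma ap_toShift_toInj {U : Opens X} (s : Sec F U) : ap (toShift F) U (ap (toInj F) U s) = 0 :=
  ConcreteCategory.congr_hom (congrArg (fun g => g.hom.app (op U)) (toInj_toShift F)) s

lemma exists_toInj_eq {U : Opens X} (s : Sec (injSheaf F) U) (h : ap (toShift F) U s = 0) :
    ∃ t, ap (toInj F) U t = s :=
  TopCat.Sheaf.sections_exact_of_left_exact
    (S := ShortComplex.mk (toInj F) (toShift F) (toInj_toShift F))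
    (ShortComplex.exact_cokernel (toInj F)) (inferInstanceAs (Mono (toInj F))) s h

lemma injSheaf_restrict_surjective {U V : Opens X} (h : V ≤ U) :
    Function.Surjective (rs (injSheaf F) h) := disc_restrict_surjective h

/-- The vanishing of `Hⁿ⁺¹(U, F)`, expressed by dimension shifting. -/
def Van : ℕ → TopCat.Sheaf Ab.{0} X → Opens X → Prop
  | 0, F, U => Function.Surjective (ap (toShift F) U)
  | n + 1, F, U => Van n (shift F) U

/-- The `n`-fold shift of `F`. -/
def shiftN : ℕ → TopCat.Sheaf Ab.{0} X → TopCat.Sheaf Ab.{0} X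
  | 0, F => F
  | n + 1, F => shiftN n (shift F)

lemma van_iff_shiftN (n : ℕ) (U : Opens X) : Van n F U ↔ Van 0 (shiftN n F) U := by
  induction n generalizing F with
  | zero => rfl
  | succ n ih => exact ih (shift F)

/-- The recursion of `shiftN` shifts innermost first; exposing the outermost shift makes
`surjPair_shift` applicable. -/
lemma shiftN_succ (n : ℕ) : shiftN (n + 1) F = shift (shiftN n F) := by
  induction n generalizing F with
  | zero => rfl
  | succ n ih => exact ih (shift F)

lemma ap_toShift_surjective_bot : Van 0 F ⊥ := by
  intro s
  refine ⟨0, sec_ext (shift F) (fun i : Empty => i.elim) (fun i => i.elim) bot_le fun i => i.elim⟩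

end Cohomology

/-! ### Mayer–Vietoris and the cohomological dimension of a finite acyclic cover -/

section MayerVietoris

variable {X : TopCat.{0}} (F : TopCat.Sheaf Ab.{0} X)

/-- Every section over `U ⊓ V` is a difference of sections over `U` and `V`. -/
def SurjPair (U V : Opens X) : Prop :=
  ∀ s : Sec F (U ⊓ V), ∃ (a : Sec F U) (b : Sec F V),
    s = rs F inf_le_left a - rs F inf_le_right b

variable {F}

/-- Two local lifts of `y` differ over the intersection by a section of `F`. Splitting this
difference corrects the lifts so that they glue. -/
lemma exists_lift_of_surjPair {U V W : Opens X} (hU : U ≤ W) (hV : V ≤ W) (hW : W ≤ U ⊔ V)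
    (h : SurjPair F U V) (y : Sec (shift F) W)
    (ha : ∃ a, ap (toShift F) U a = rs (shift F) hU y)
    (hb : ∃ b, ap (toShift F) V b = rs (shift F) hV y) : ∃ w, ap (toShift F) W w = y := by
  obtain ⟨a, ha⟩ := ha
  obtain ⟨b, hb⟩ := hb
  obtain ⟨c, hc⟩ := exists_toInj_eq F
    (rs (injSheaf F) (inf_le_left : U ⊓ V ≤ U) a - rs (injSheaf F) (inf_le_right : U ⊓ V ≤ V) b)
    (by rw [map_sub, ap_rs, ap_rs, ha, hb, rs_rs, rs_rs, sub_self])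
  obtain ⟨a', b', rfl⟩ := h c
  obtain ⟨w, hw1, hw2⟩ := sec_glue_two (injSheaf F) hU hV hW (a - ap (toInj F) U a')
    (b - ap (toInj F) V b') (by
      rw [map_sub, ap_rs, ap_rs] at hc
      rw [map_sub, map_sub, sub_eq_sub_iff_sub_eq_sub]
      exact hc.symm)
  refine ⟨w, sec_ext_two _ hU hV hW ?_ ?_⟩
  · rw [← ap_rs, hw1, map_sub, ap_toShift_toInj, sub_zero, ha]
  · rw [← ap_rs, hw2, map_sub, ap_toShift_toInj, sub_zero, hb]

/-- A section over the intersection lifts to the injective sheaf, which is flasque; the lift extends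
to all of `U`, so the second component can be zero. -/
lemma surjPair_shift {U V : Opens X} (h : Van 0 F (U ⊓ V)) : SurjPair (shift F) U V := by
  intro s
  obtain ⟨t, rfl⟩ := h s
  obtain ⟨t, rfl⟩ := injSheaf_restrict_surjective F (inf_le_left : U ⊓ V ≤ U) t
  exact ⟨ap (toShift F) U t, 0, by rw [map_zero, sub_zero, ap_rs]⟩

lemma van_zero_sup {U V : Opens X} (h : SurjPair F U V) (hU : Van 0 F U) (hV : Van 0 F V) :
    Van 0 F (U ⊔ V) :=
  fun y => exists_lift_of_surjPair le_sup_left le_sup_right le_rfl h y (hU _) (hV _)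

/-- The Mayer–Vietoris sequence at Hⁿ⁺¹(U ∩ V) → Hⁿ⁺²(U ∪ V) → Hⁿ⁺²(U) ⊕ Hⁿ⁺²(V), shifted down to
the case where the first group measures the failure of `SurjPair`. -/
lemma van_succ_sup {U V : Opens X} {n : ℕ} (hU : Van (n + 1) F U) (hV : Van (n + 1) F V)
    (h : Van n F (U ⊓ V)) : Van (n + 1) F (U ⊔ V) := by
  induction n generalizing F with
  | zero => exact van_zero_sup (F := shift F) (surjPair_shift h) hU hV
  | succ n ih => exact ih (F := shift F) hU hV h

lemma van_bot (n : ℕ) : Van n F ⊥ := by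
  induction n generalizing F with
  | zero => exact ap_toShift_surjective_bot F
  | succ n ih => exact ih (F := shift F)

/-- A union of `r` open sets all of whose intersections are acyclic has cohomological dimension
less than `r`. -/
lemma van_finset_sup {J : Type} [DecidableEq J] (U : J → Opens X) (s : Finset J) (W : Opens X)
    (h : ∀ t : Finset J, t.Nonempty → ∀ n, Van n F (t.inf U ⊓ W)) (n : ℕ) (hn : s.card ≤ n + 1) :
    Van n F (s.sup U ⊓ W) := by
  induction s using Finset.induction_on generalizing W n with
  | empty => rw [Finset.sup_empty, bot_inf_eq]; exact van_bot n
  | insert j s hj ih =>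
    rw [Finset.card_insert_of_notMem hj] at hn
    have hjW (m : ℕ) : Van m F (U j ⊓ W) := by
      simpa using h {j} (Finset.singleton_nonempty j) m
    rw [Finset.sup_insert, inf_sup_right]
    obtain _ | n := n
    · obtain rfl : s = ∅ := Finset.card_eq_zero.mp (by omega)
      simpa using hjW 0
    · refine van_succ_sup (hjW _) (ih W h (n + 1) (by omega)) ?_
      have e : U j ⊓ W ⊓ (s.sup U ⊓ W) = s.sup U ⊓ (U j ⊓ W) := by
        rw [← inf_inf_distrib_right, inf_comm (U j), inf_assoc]
      rw [e]
      -- The remaining members, cut down to `U j ⊓ W`, again have acyclic intersections; there is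
      -- one member fewer, which pays for the degree lost by Mayer–Vietoris.
      refine ih (U j ⊓ W) (fun t ht m => ?_) n (by omega)
      have := h (insert j t) (Finset.insert_nonempty j t) m
      rwa [Finset.inf_insert, inf_comm (U j), inf_assoc] at this

end MayerVietoris

/-! ### Čech cochains -/

section Cech

section Algebra

variable {J A : Type} [AddCommGroup A]

/-- The Čech differential for constant coefficients. -/
def dConst {n : ℕ} (f : (Fin n → J) → A) (τ : Fin (n + 1) → J) : A :=
  ∑ k : Fin (n + 1), (-1 : ℤ) ^ (k : ℕ) • f (τ ∘ k.succAbove)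

lemma cons_comp_succAbove_succ {n : ℕ} (j : J) (τ : Fin (n + 1) → J) (k : Fin (n + 1)) :
    (Fin.cons j τ : Fin (n + 2) → J) ∘ k.succ.succAbove = Fin.cons j (τ ∘ k.succAbove) := by
  funext i
  refine Fin.cases ?_ (fun i => ?_) i
  · simp
  · simp [Fin.succ_succAbove_succ]

lemma cons_comp_succAbove_zero {n : ℕ} (j : J) (τ : Fin n → J) :
    (Fin.cons j τ : Fin (n + 1) → J) ∘ (0 : Fin (n + 1)).succAbove = τ := by
  funext i
  simp

/-- Separating the first face serves twice: it is the cone homotopy, and it drives the induction for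
d² = 0. -/
lemma dConst_cons {n : ℕ} (f : (Fin (n + 1) → J) → A) (j : J) (τ : Fin (n + 1) → J) :
    dConst f (Fin.cons j τ) = f τ - dConst (fun σ => f (Fin.cons j σ)) τ := by
  rw [dConst, Fin.sum_univ_succ, dConst, sub_eq_add_neg, ← Finset.sum_neg_distrib]
  congr 1
  · rw [cons_comp_succAbove_zero]; simp
  · refine Finset.sum_congr rfl fun k _ => ?_
    rw [cons_comp_succAbove_succ, Fin.val_succ, pow_succ]
    simp

lemma dConst_dConst {n : ℕ} (f : (Fin n → J) → A) : dConst (dConst f) = 0 := by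
  induction n with
  | zero =>
    funext τ
    have h (σ σ' : Fin 0 → J) : f σ = f σ' := congrArg f (Subsingleton.elim _ _)
    simp [dConst, Fin.sum_univ_succ, h _ Fin.elim0]
  | succ n ih =>
    funext τ
    rw [← Fin.cons_self_tail τ, dConst_cons]
    have : (fun σ => dConst f (Fin.cons (τ 0) σ)) =
        f - dConst (fun σ => f (Fin.cons (τ 0) σ)) := funext fun σ => dConst_cons f _ σ
    rw [this]
    have hsub (g h : (Fin (n + 1) → J) → A) (σ) : dConst (g - h) σ = dConst g σ - dConst h σ := by
      simp [dConst, smul_sub]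
    rw [hsub, ih]
    simp

end Algebra

variable {X : TopCat.{0}} {J : Type} (U : J → Opens X)

/-- The intersection of a finite sequence of members of a family of open sets. -/
def cap {n : ℕ} (σ : Fin n → J) : Opens X := Finset.univ.inf fun i => U (σ i)

lemma mem_cap {n : ℕ} (σ : Fin n → J) (x : X) : x ∈ cap U σ ↔ ∀ i, x ∈ U (σ i) := by
  have : ((cap U σ : Opens X) : Set X) = ⋂ i, (U (σ i) : Set X) := by
    simp [cap]
  rw [← SetLike.mem_coe, this]
  simp

lemma cap_le {n : ℕ} (σ : Fin n → J) (i : Fin n) : cap U σ ≤ U (σ i) :=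
  Finset.inf_le (Finset.mem_univ i)

lemma cap_le_cap {m n : ℕ} (σ : Fin n → J) (e : Fin m → Fin n) : cap U σ ≤ cap U (σ ∘ e) :=
  Finset.le_inf fun i _ => cap_le U σ (e i)

variable {U}

/-- The Čech differential. -/
def dCech {F : TopCat.Sheaf Ab.{0} X} {n : ℕ} (c : ∀ σ : Fin n → J, Sec F (cap U σ))
    (τ : Fin (n + 1) → J) : Sec F (cap U τ) :=
  ∑ k : Fin (n + 1), (-1 : ℤ) ^ (k : ℕ) • rs F (cap_le_cap U τ k.succAbove) (c (τ ∘ k.succAbove))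

lemma ap_dCech {F G : TopCat.Sheaf Ab.{0} X} (f : F ⟶ G) {n : ℕ}
    (c : ∀ σ : Fin n → J, Sec F (cap U σ)) (τ : Fin (n + 1) → J) :
    ap f _ (dCech c τ) = dCech (fun σ => ap f _ (c σ)) τ := by
  simp [dCech, map_sum, map_zsmul, ap_rs]

lemma dCech_sub {F : TopCat.Sheaf Ab.{0} X} {n : ℕ} (c c' : ∀ σ : Fin n → J, Sec F (cap U σ))
    (τ : Fin (n + 1) → J) : dCech (fun σ => c σ - c' σ) τ = dCech c τ - dCech c' τ := by
  simp [dCech, smul_sub]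

section Disc

variable {T : Type} (p : T → X) (A : T → Ab.{0})

open Classical in
/-- The values at `t` of a Čech cochain of discontinuous sections, extended by zero. -/
def valueAt {n : ℕ} (c : ∀ σ : Fin n → J, Sec (disc p A) (cap U σ)) (t : T) (σ : Fin n → J) : A t :=
  if h : p t ∈ cap U σ then (c σ : ∀ t : {t // p t ∈ cap U σ}, A t.1) ⟨t, h⟩ else 0

lemma valueAt_of_mem {n : ℕ} (c : ∀ σ : Fin n → J, Sec (disc p A) (cap U σ)) (t : T)
    (σ : Fin n → J) (h : p t ∈ cap U σ) :
    valueAt p A c t σ = (c σ : ∀ t : {t // p t ∈ cap U σ}, A t.1) ⟨t, h⟩ := dif_pos h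

/-- Evaluation of discontinuous sections. -/
def evalAt {O : Opens X} (t : {t // p t ∈ O}) : Sec (disc p A) O →+ A t.1 :=
  Pi.evalAddMonoidHom (fun t : {t // p t ∈ O} => (A t.1 : Type)) t

lemma dCech_disc {n : ℕ} (c : ∀ σ : Fin n → J, Sec (disc p A) (cap U σ)) (τ : Fin (n + 1) → J)
    (t : {t // p t ∈ cap U τ}) :
    evalAt p A t (dCech c τ) = dConst (valueAt p A c t.1) τ := by
  rw [dCech, map_sum, dConst]
  refine Finset.sum_congr rfl fun k _ => ?_
  rw [map_zsmul, valueAt_of_mem p A c t.1 _ (cap_le_cap U τ k.succAbove t.2)]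
  rfl

lemma valueAt_dCech {n : ℕ} (c : ∀ σ : Fin n → J, Sec (disc p A) (cap U σ)) (τ : Fin (n + 1) → J)
    (t : T) (ht : p t ∈ cap U τ) :
    valueAt p A (dCech c) t τ = dConst (valueAt p A c t) τ :=
  (valueAt_of_mem _ _ _ _ _ ht).trans (dCech_disc p A c τ ⟨t, ht⟩)

lemma dConst_congr {A : Type} [AddCommGroup A] {n : ℕ} {f g : (Fin n → J) → A}
    (τ : Fin (n + 1) → J) (h : ∀ k : Fin (n + 1), f (τ ∘ k.succAbove) = g (τ ∘ k.succAbove)) :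
    dConst f τ = dConst g τ :=
  Finset.sum_congr rfl fun k _ => by rw [h k]

lemma dCech_dCech_disc {n : ℕ} (c : ∀ σ : Fin n → J, Sec (disc p A) (cap U σ))
    (τ : Fin (n + 2) → J) : dCech (dCech c) τ = 0 := by
  refine funext fun t : {t // p t ∈ cap U τ} => ?_
  refine (dCech_disc p A (dCech c) τ t).trans ?_
  rw [dConst_congr (g := dConst (valueAt p A c t.1)) τ fun k =>
    valueAt_dCech p A c _ t.1 (cap_le_cap U τ k.succAbove t.2), dConst_dConst]
  rfl

end Disc

/-- After embedding `F` into a sheaf of discontinuous sections, the identity is checked at each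
point, with constant coefficients. -/
lemma dCech_dCech {F : TopCat.Sheaf Ab.{0} X} {n : ℕ} (c : ∀ σ : Fin n → J, Sec F (cap U σ))
    (τ : Fin (n + 2) → J) : dCech (dCech c) τ = 0 := by
  apply toInj_injective F
  rw [ap_dCech, map_zero]
  simp only [ap_dCech]
  exact dCech_dCech_disc _ _ _ _

variable (U) in
/-- Exactness of the Čech complex of `F` in degree `p + 1`. -/
def CechExact (F : TopCat.Sheaf Ab.{0} X) (p : ℕ) : Prop :=
  ∀ c : ∀ σ : Fin (p + 2) → J, Sec F (cap U σ), (∀ τ, dCech c τ = 0) →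
    ∃ b : ∀ σ : Fin (p + 1) → J, Sec F (cap U σ), ∀ σ, dCech b σ = c σ

/-- At a fixed point the complex has constant coefficients on the simplex of members containing it,
and any such member is the vertex of a cone. -/
lemma cechExact_disc {T : Type} (q : T → X) (A : T → Ab.{0}) (p : ℕ) :
    CechExact U (disc q A) p := by
  classical
  intro c hc
  let j (t : T) (n : ℕ) (σ : Fin (n + 1) → J) (h : q t ∈ cap U σ) : ∃ j, q t ∈ U j :=
    ⟨_, (mem_cap U σ _).mp h 0⟩
  -- The vertex depends on `t` alone and not on `σ`, as the homotopy requires.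
  let g (t : T) : (Fin (p + 1) → J) → A t := fun σ =>
    if h : ∃ j, q t ∈ U j then valueAt q A c t (Fin.cons h.choose σ) else 0
  let b (σ : Fin (p + 1) → J) : Sec (disc q A) (cap U σ) :=
    (fun t => g t.1 σ : ∀ t : {t // q t ∈ cap U σ}, A t.1)
  refine ⟨b, fun σ => funext fun t : {t // q t ∈ cap U σ} => ?_⟩
  refine (dCech_disc q A b σ t).trans ?_
  have hj : ∃ j, q t.1 ∈ U j := ⟨_, (mem_cap U σ _).mp t.2 0⟩
  have h1 : q t.1 ∈ cap U (Fin.cons hj.choose σ : Fin (p + 3) → J) := by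
    rw [mem_cap]
    intro i
    refine Fin.cases ?_ (fun i => ?_) i
    · exact hj.choose_spec
    · exact (mem_cap U σ _).mp t.2 i
  have h2 := dCech_disc q A c _ ⟨t.1, h1⟩
  rw [hc, map_zero, dConst_cons] at h2
  rw [← valueAt_of_mem q A c t.1 σ t.2, sub_eq_zero.mp h2.symm]
  refine dConst_congr σ fun k => ?_
  rw [valueAt_of_mem q A b t.1 _ (cap_le_cap U σ k.succAbove t.2)]
  exact dif_pos hj

lemma cechExact_injSheaf (F : TopCat.Sheaf Ab.{0} X) (p : ℕ) : CechExact U (injSheaf F) p :=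
  cechExact_disc _ _ p

/-- A diagram chase: lift the cocycle to the injective sheaf, note that the differential of the lift
is a cocycle of `F`, subtract a cochain of `F` bounding it, and bound the corrected lift in the
injective sheaf. -/
lemma cechExact_shift {F : TopCat.Sheaf Ab.{0} X} {p : ℕ}
    (hF : ∀ σ : Fin (p + 2) → J, Van 0 F (cap U σ)) (h : CechExact U F (p + 1)) :
    CechExact U (shift F) p := by
  intro z hz
  choose w hw using fun σ => hF σ (z σ)
  choose c hc using fun τ => exists_toInj_eq F (dCech w τ) (by
    rw [ap_dCech]
    simp only [hw, hz])
  obtain ⟨v, hv⟩ := h c fun τ => toInj_injective F _ (by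
    rw [ap_dCech, map_zero]
    simp only [hc]
    exact dCech_dCech w τ)
  obtain ⟨u, hu⟩ := cechExact_injSheaf (U := U) F p
    (fun σ => w σ - ap (toInj F) _ (v σ)) fun τ => by
      refine (dCech_sub (F := injSheaf F) _ _ τ).trans ?_
      rw [← ap_dCech, hv, hc, sub_self]
  refine ⟨fun σ => ap (toShift F) _ (u σ), fun σ => ?_⟩
  rw [← ap_dCech]
  rw [hu, map_sub, ap_toShift_toInj, sub_zero, hw]

/-- The same chase for the restrictions of one global section: the corrected local lifts form a
cocycle of degree zero, so they glue. -/
lemma van_zero_of_cechExact {F : TopCat.Sheaf Ab.{0} X} {V : Opens X} (hV : V = iSup U)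
    (hF : ∀ σ : Fin 1 → J, Van 0 F (cap U σ)) (h : CechExact U F 0) : Van 0 F V := by
  intro y
  have hle (j : J) : U j ≤ V := hV ▸ le_iSup U j
  have hcap {n : ℕ} (σ : Fin (n + 1) → J) : cap U σ ≤ V := (cap_le U σ 0).trans (hle _)
  choose w hw using fun σ : Fin 1 → J => hF σ (rs (shift F) (hcap σ) y)
  choose c hc using fun τ => exists_toInj_eq F (dCech w τ) (by
    rw [ap_dCech]
    simp only [hw, dCech, rs_rs]
    simp)
  obtain ⟨v, hv⟩ := h c fun τ => toInj_injective F _ (by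
    rw [ap_dCech, map_zero]
    simp only [hc]
    exact dCech_dCech w τ)
  let a (σ : Fin 1 → J) : Sec (injSheaf F) (cap U σ) := w σ - ap (toInj F) _ (v σ)
  have ha (τ) : dCech a τ = 0 := by
    refine (dCech_sub (F := injSheaf F) _ _ τ).trans ?_
    rw [← ap_dCech, hv, hc, sub_self]
  have hVle : V ≤ ⨆ σ : Fin 1 → J, cap U σ := by
    rw [hV]
    refine iSup_le fun j => le_trans ?_ (le_iSup _ fun _ => j)
    exact Finset.le_inf fun i _ => le_rfl
  obtain ⟨t, ht⟩ := sec_glue (injSheaf F) (fun σ : Fin 1 → J => cap U σ) hcap hVle a (by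
    intro σ σ'
    -- The order is reversed because deleting entry 0 must leave `σ` and deleting entry 1 must leave
    -- `σ'`; the cocycle condition then reads a(σ) - a(σ') = 0.
    let τ : Fin 2 → J := ![σ' 0, σ 0]
    have h0 : τ ∘ (0 : Fin 2).succAbove = σ := by
      funext i; rw [Subsingleton.elim i 0]; rfl
    have h1 : τ ∘ (1 : Fin 2).succAbove = σ' := by
      funext i; rw [Subsingleton.elim i 0]; rfl
    have hτ : cap U σ ⊓ cap U σ' ≤ cap U τ := by
      intro x hx
      rw [mem_cap]
      intro i
      refine Fin.cases ?_ (fun i => ?_) i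
      · exact cap_le U σ' 0 hx.2
      · rw [Subsingleton.elim i 0]
        exact cap_le U σ 0 hx.1
    have key := congrArg (rs (injSheaf F) hτ) (ha τ)
    rw [dCech, Fin.sum_univ_two, map_zero, map_add, map_zsmul, map_zsmul, rs_rs, rs_rs] at key
    have e (ρ ρ' : Fin 1 → J) (hρ : ρ = ρ') (g : cap U σ ⊓ cap U σ' ≤ cap U ρ)
        (g' : cap U σ ⊓ cap U σ' ≤ cap U ρ') :
        rs (injSheaf F) g (a ρ) = rs (injSheaf F) g' (a ρ') := by subst hρ; rfl
    rw [e _ _ h0 _ inf_le_left, e _ _ h1 _ inf_le_right] at key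
    simpa [add_neg_eq_zero] using key)
  refine ⟨t, sec_ext _ (fun σ : Fin 1 → J => cap U σ) hcap hVle fun σ => ?_⟩
  rw [← ap_rs, ht, map_sub, ap_toShift_toInj, sub_zero, hw]

/-- Čech cohomology of an acyclic cover computes the vanishing of cohomology. -/
lemma van_of_cechExact {F : TopCat.Sheaf Ab.{0} X} {V : Opens X} (hV : V = iSup U) {p : ℕ}
    (hF : ∀ m n (σ : Fin (n + 1) → J), Van m F (cap U σ)) (h : CechExact U F p) : Van p F V := by
  induction p generalizing F with
  | zero => exact van_zero_of_cechExact hV (fun σ => hF 0 0 σ) h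
  | succ p ih =>
    exact ih (F := shift F) (fun m n σ => hF (m + 1) n σ) (cechExact_shift (fun σ => hF 0 _ σ) h)

/-- The Čech complex is exact if it splits into monomial pieces each of which is a cone. -/
lemma cechExact_of_monomial [Finite J] {F : TopCat.Sheaf Ab.{0} X} {ι R : Type} [AddCommGroup R]
    (χ : ∀ {n : ℕ} (σ : Fin (n + 1) → J), Sec F (cap U σ) →+ (ι →₀ R))
    (hχ : ∀ {n : ℕ} (σ : Fin (n + 1) → J), Function.Injective (χ σ))
    (hres : ∀ {n : ℕ} (τ : Fin (n + 2) → J) (k : Fin (n + 2)) (s : Sec F (cap U (τ ∘ k.succAbove))),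
      χ τ (rs F (cap_le_cap U τ k.succAbove) s) = χ (τ ∘ k.succAbove) s)
    (E : ∀ {n : ℕ}, (Fin (n + 1) → J) → Set ι)
    (hE : ∀ {n : ℕ} (σ : Fin (n + 1) → J) (v : ι →₀ R),
      (∃ s, χ σ s = v) ↔ ∀ a, v a ≠ 0 → a ∈ E σ)
    (hcone : ∀ a, ∃ j, ∀ {n : ℕ} (σ : Fin (n + 1) → J),
      a ∈ E (Fin.cons j σ : Fin (n + 2) → J) → a ∈ E σ) (p : ℕ) : CechExact U F p := by
  classical
  have := Fintype.ofFinite J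
  intro c hc
  choose j hj using hcone
  let f (a : ι) : (Fin (p + 2) → J) → R := fun τ => χ τ (c τ) a
  have hd {n : ℕ} (b : ∀ σ : Fin (n + 1) → J, Sec F (cap U σ)) (τ : Fin (n + 2) → J) (a : ι) :
      χ τ (dCech b τ) a = dConst (fun σ => χ σ (b σ) a) τ := by
    simp [dCech, dConst, map_sum, hres, Finsupp.finsetSum_apply]
  have hf (a : ι) (τ : Fin (p + 3) → J) : dConst (f a) τ = 0 := by
    rw [← hd, hc, map_zero, Finsupp.zero_apply]
  let v (σ : Fin (p + 1) → J) : ι →₀ R :=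
    -- The vertex varies with the monomial, but it lies in the finite set `J`, so the support stays
    -- finite.
    Finsupp.onFinset (Finset.univ.biUnion fun i => (χ _ (c (Fin.cons i σ))).support)
      (fun a => f a (Fin.cons (j a) σ)) fun a ha => by
        rw [Finset.mem_biUnion]
        exact ⟨j a, Finset.mem_univ _, Finsupp.mem_support_iff.mpr ha⟩
  choose b hb using fun σ => (hE σ (v σ)).mpr fun a ha =>
    hj a σ ((hE _ _).mp ⟨c (Fin.cons (j a) σ), rfl⟩ a ha)
  refine ⟨b, fun σ => hχ σ (Finsupp.ext fun a => ?_)⟩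
  rw [hd]
  -- The cocycle identity on the tuple enlarged by the vertex is the contracting homotopy for the
  -- monomial `a`.
  have h1 := hf a (Fin.cons (j a) σ)
  rw [dConst_cons, sub_eq_zero] at h1
  refine Eq.trans ?_ h1.symm
  simp only [hb]
  rfl

end Cech

/-! ### Comparison with sheaf cohomology -/

section Comparison

variable {X Y : TopCat.{0}}

/-- The cohomology groups of an abelian sheaf. -/
abbrev HSheaf (F : TopCat.Sheaf Ab.{0} X) (n : ℕ) : Type :=
  Sheaf.H (J := Opens.grothendieckTopology X) F n

/-! ### Vanishing read off the long exact sequence of Ext groups -/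

section Ext

variable {C : Type*} [Category C] [Abelian C] [HasExt C] (Z : C) {S : ShortComplex C}
  (hS : S.ShortExact)

include hS

lemma ext_subsingleton_of_shortExact {n : ℕ} (h₁ : Subsingleton (Abelian.Ext Z S.X₁ n))
    (h₃ : Subsingleton (Abelian.Ext Z S.X₃ n)) : Subsingleton (Abelian.Ext Z S.X₂ n) := by
  refine subsingleton_of_forall_eq 0 fun x => ?_
  obtain ⟨y, rfl⟩ := Abelian.Ext.covariant_sequence_exact₂ _ hS x (h₃.elim _ _)
  rw [show y = 0 from h₁.elim _ _, Abelian.Ext.zero_comp]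

lemma ext_subsingleton_succ_succ (hI : Injective S.X₂) {n : ℕ}
    (h : Subsingleton (Abelian.Ext Z S.X₃ (n + 1))) :
    Subsingleton (Abelian.Ext Z S.X₁ (n + 1 + 1)) := by
  refine subsingleton_of_forall_eq 0 fun x => ?_
  obtain ⟨y, rfl⟩ := Abelian.Ext.covariant_sequence_exact₁ _ hS x
    (Abelian.Ext.eq_zero_of_injective _) rfl
  rw [show y = 0 from h.elim _ _, Abelian.Ext.zero_comp]

/-- As the middle term is injective, every class of degree one is the image of some g : Z ⟶ X₃ under
the connecting map, and it vanishes when g lifts to X₂. -/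
lemma ext_subsingleton_one (hI : Injective S.X₂)
    (h : ∀ g : Z ⟶ S.X₃, ∃ g' : Z ⟶ S.X₂, g' ≫ S.g = g) :
    Subsingleton (Abelian.Ext Z S.X₁ (0 + 1)) := by
  refine subsingleton_of_forall_eq 0 fun x => ?_
  obtain ⟨y, rfl⟩ := Abelian.Ext.covariant_sequence_exact₁ _ hS x
    (Abelian.Ext.eq_zero_of_injective _) rfl
  obtain ⟨g, rfl⟩ := (Abelian.Ext.mk₀_bijective _ _).surjective y
  obtain ⟨g', rfl⟩ := h g
  rw [← Abelian.Ext.mk₀_comp_mk₀ g' S.g, Abelian.Ext.comp_assoc_of_second_deg_zero,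
    hS.comp_extClass, Abelian.Ext.comp_zero]

end Ext

lemma subsingleton_of_shortExact {F G K : TopCat.Sheaf Ab.{0} X} {f : F ⟶ G} {g : G ⟶ K}
    {w : f ≫ g = 0} (h : (ShortComplex.mk f g w).ShortExact) {n : ℕ}
    (hF : Subsingleton (HSheaf F n)) (hK : Subsingleton (HSheaf K n)) :
    Subsingleton (HSheaf G n) := by
  let S : ShortComplex (CategoryTheory.Sheaf (Opens.grothendieckTopology X) Ab.{0}) :=
    ⟨f, g, w⟩
  have hS : S.ShortExact := h
  exact ext_subsingleton_of_shortExact _ hS hF hK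

/-- Morphisms out of the constant sheaf ℤ are global sections, by the adjunction with evaluation at
⊤; lifting the section named by 1 lifts the morphism. -/
lemma exists_lift_constantSheaf {F G : CategoryTheory.Sheaf (Opens.grothendieckTopology X) Ab.{0}}
    (g : F ⟶ G) (h : Function.Surjective (g.hom.app (op ⊤)).hom)
    (β : (constantSheaf (Opens.grothendieckTopology X) AddCommGrpCat.{0}).obj
      (AddCommGrpCat.of (ULift.{0} ℤ)) ⟶ G) : ∃ α, α ≫ g = β := by
  have hT : Limits.IsTerminal (⊤ : Opens X) := Limits.isTerminalTop
  let adj := constantSheafAdj (Opens.grothendieckTopology X) AddCommGrpCat.{0} hT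
  obtain ⟨s, hs⟩ := h (adj.homEquiv _ _ β ⟨1⟩)
  refine ⟨(adj.homEquiv _ _).symm (AddCommGrpCat.ofHom
    ((zmultiplesHom _ s).comp AddEquiv.ulift.toAddMonoidHom)), ?_⟩
  apply (adj.homEquiv _ _).injective
  rw [Adjunction.homEquiv_naturality_right, Equiv.apply_symm_apply]
  refine AddCommGrpCat.hom_ext (AddMonoidHom.ext fun x => ?_)
  obtain ⟨n⟩ := x
  have h1 : (⟨n⟩ : ULift.{0} ℤ) = n • ⟨1⟩ := by ext; simp
  refine Eq.trans ?_ (congrArg (adj.homEquiv _ _ β).hom h1).symm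
  rw [map_zsmul]
  refine Eq.trans ?_ (congrArg (n • ·) hs)
  exact map_zsmul (g.hom.app (op ⊤)).hom n s

/-- The pushforward is again a sheaf of discontinuous sections, indexed by the points of `Y` placed
in `X` through `f`. -/
instance (f : Y ⟶ X) (F : TopCat.Sheaf Ab.{0} Y) :
    Injective ((TopCat.Sheaf.pushforward Ab.{0} f).obj (injSheaf F)) :=
  inferInstanceAs (Injective (disc f fun x => Injective.under ((psh F).stalk x)))

lemma pushforward_toInj_toShift (f : Y ⟶ X) (F : TopCat.Sheaf Ab.{0} Y) :
    (TopCat.Sheaf.pushforward Ab.{0} f).map (toInj F) ≫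
      (TopCat.Sheaf.pushforward Ab.{0} f).map (toShift F) = 0 := by
  rw [← Functor.map_comp, toInj_toShift, Functor.map_zero]

/-- At a point of the image, a neighbourhood in `Y` is induced from one in `X`; away from the closed
image there is a neighbourhood with empty preimage, where all sections agree. -/
lemma pushforward_shortExact (f : Y ⟶ X) (hf : Topology.IsClosedEmbedding f)
    (F : TopCat.Sheaf Ab.{0} Y) :
    (ShortComplex.mk ((TopCat.Sheaf.pushforward Ab.{0} f).map (toInj F))
      ((TopCat.Sheaf.pushforward Ab.{0} f).map (toShift F))
      (pushforward_toInj_toShift f F)).ShortExact := by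
  refine shortExact_of_sections _ _ _ (fun U => toInj_injective F _)
    (fun U s h => exists_toInj_eq F s h) fun U s x hx => ?_
  by_cases hxf : x ∈ Set.range f
  · obtain ⟨y, rfl⟩ := hxf
    obtain ⟨V, hV, t, ht, hy⟩ := locally_surjective_of_epi (toShift F) (U := (Opens.map f).obj U)
      (s : Sec (shift F) ((Opens.map f).obj U)) (x := y) hx
    obtain ⟨W, hW, hWV⟩ := hf.isInducing.isOpen_iff.mp V.2
    let W' : Opens X := ⟨W, hW⟩ ⊓ U
    have hW' : (Opens.map f).obj W' ≤ V := fun z hz => by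
      have : z ∈ f ⁻¹' W := hz.1
      rwa [hWV] at this
    refine ⟨W', inf_le_right, rs (injSheaf F) hW' t, ?_, ?_, hx⟩
    · refine (ap_rs (toShift F) hW' t).trans ?_
      rw [ht]
      exact rs_rs (shift F) hV hW' s
    · change y ∈ f ⁻¹' W
      rw [hWV]
      exact hy
  · let W : Opens X := ⟨(Set.range f)ᶜ, hf.isClosed_range.isOpen_compl⟩ ⊓ U
    refine ⟨W, inf_le_right, 0, ?_, hxf, hx⟩
    refine sec_ext (shift F) (fun i : Empty => i.elim) (fun i => i.elim) ?_ fun i => i.elim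
    intro z hz
    exact (hz.1 ⟨z, rfl⟩).elim

/-- Elementary vanishing on a closed subspace implies the vanishing of the cohomology of the
pushforward. -/
lemma subsingleton_pushforward (f : Y ⟶ X) (hf : Topology.IsClosedEmbedding f) {n : ℕ}
    (F : TopCat.Sheaf Ab.{0} Y) (h : Van n F ⊤) :
    Subsingleton (HSheaf ((TopCat.Sheaf.pushforward Ab.{0} f).obj F) (n + 1)) := by
  induction n generalizing F with
  | zero =>
    let S : ShortComplex (CategoryTheory.Sheaf (Opens.grothendieckTopology X) Ab.{0}) :=
      ⟨(TopCat.Sheaf.pushforward Ab.{0} f).map (toInj F),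
        (TopCat.Sheaf.pushforward Ab.{0} f).map (toShift F),
        pushforward_toInj_toShift f F⟩
    have hS : S.ShortExact := pushforward_shortExact f hf F
    have hI : Injective S.X₂ :=
      inferInstanceAs (Injective ((TopCat.Sheaf.pushforward Ab.{0} f).obj (injSheaf F)))
    exact ext_subsingleton_one _ hS hI fun g => exists_lift_constantSheaf S.g h g
  | succ n ih =>
    let S : ShortComplex (CategoryTheory.Sheaf (Opens.grothendieckTopology X) Ab.{0}) :=
      ⟨(TopCat.Sheaf.pushforward Ab.{0} f).map (toInj F),
        (TopCat.Sheaf.pushforward Ab.{0} f).map (toShift F),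
        pushforward_toInj_toShift f F⟩
    have hS : S.ShortExact := pushforward_shortExact f hf F
    have hI : Injective S.X₂ :=
      inferInstanceAs (Injective ((TopCat.Sheaf.pushforward Ab.{0} f).obj (injSheaf F)))
    exact ext_subsingleton_succ_succ _ hS hI (ih (shift F) h)

lemma subsingleton_of_van {n : ℕ} (F : TopCat.Sheaf Ab.{0} X) (h : Van n F ⊤) :
    Subsingleton (HSheaf F (n + 1)) :=
  subsingleton_pushforward (𝟙 X) Topology.IsClosedEmbedding.id F h

end Comparison

/-! ### Vanishing of cohomology on affine open sets -/

section Affine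

variable {X : Scheme.{0}}

lemma resO_self {U : X.Opens} (h : U ≤ U) (a : Γ(X, U)) : resO h a = a := by
  have := X.presheaf.map_id (op U)
  exact ConcreteCategory.congr_hom this a

lemma isUnit_resO_of_le {U V : X.Opens} (h : V ≤ U) (f : Γ(X, U)) (hV : V ≤ X.basicOpen f) :
    IsUnit (resO h f) := by
  have := (X.toRingedSpace.isUnit_res_basicOpen f).map (resO hV)
  have e := resO_resO (X.basicOpen_le f) hV f
  exact e ▸ this

lemma exists_pow_mul_eq_resO {U V : X.Opens} (hU : IsAffineOpen U) (f : Γ(X, U)) (h : V ≤ U)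
    (e : V = X.basicOpen f) (b : Γ(X, V)) : ∃ (n : ℕ) (c : Γ(X, U)), resO h f ^ n * b = resO h c := by
  let := (X.presheaf.map (homOfLE h).op).hom.toAlgebra
  have := hU.isLocalization_of_eq_basicOpen f (homOfLE h) e
  obtain ⟨n, c, hc⟩ := IsLocalization.Away.surj f b
  exact ⟨n, c, by rw [mul_comm, ← map_pow]; exact (congrArg (b * ·) (map_pow _ _ _)).trans hc⟩

/-- An additive trivialization over `U` of a sheaf of abelian groups. -/
structure AddFrame (F : TopCat.Sheaf Ab.{0} X) (U : X.Opens) where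
  toFun : ∀ V : X.Opens, V ≤ U → Γ(X, V) →+ Sec F V
  bijective : ∀ V h, Function.Bijective (toFun V h)
  natural : ∀ {V W : X.Opens} (hV : V ≤ U) (h : W ≤ V) (a : Γ(X, V)),
    toFun W (h.trans hV) (resO h a) = rs F h (toFun V hV a)

/-- The vanishing of H¹ for a cover of an affine scheme by two basic open sets, via a partition of
unity. -/
lemma exists_sub_of_isCoprime {W : X.Opens} (hW : IsAffineOpen W) {f g : Γ(X, W)}
    (hfg : IsCoprime f g) {A B : X.Opens} (hA : A = X.basicOpen f) (hB : B = X.basicOpen g)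
    (b : Γ(X, (A ⊓ B : X.Opens))) : ∃ (u : Γ(X, A)) (v : Γ(X, B)),
      b = resO inf_le_left u - resO inf_le_right v := by
  have hAW : A ≤ W := hA.le.trans (X.basicOpen_le f)
  have hBW : B ≤ W := hB.le.trans (X.basicOpen_le g)
  have hi : A ⊓ B ≤ W := inf_le_left.trans hAW
  obtain ⟨n, c, hc⟩ := exists_pow_mul_eq_resO hW (f * g) hi
    (by rw [hA, hB, Scheme.basicOpen_mul]) b
  obtain ⟨p, q, hpq⟩ := hfg.pow (m := n) (n := n)
  obtain ⟨f', hf'⟩ := isUnit_resO_of_le hAW f hA.le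
  obtain ⟨g', hg'⟩ := isUnit_resO_of_le hBW g hB.le
  -- With b = c/(fg)ⁿ and p fⁿ + q gⁿ = 1, one has b = qc/fⁿ + pc/gⁿ; the minus sign turns the sum
  -- into a difference.
  refine ⟨resO hAW (q * c) * (↑f'⁻¹) ^ n, - (resO hBW (p * c) * (↑g'⁻¹) ^ n), ?_⟩
  have hu : IsUnit (resO hi (f * g) ^ n) := by
    refine (isUnit_resO_of_le hi _ ?_).pow n
    rw [hA, hB, Scheme.basicOpen_mul]
  apply hu.mul_left_cancel
  rw [hc]
  have h1 : resO (inf_le_left : A ⊓ B ≤ A) (↑f'⁻¹ : Γ(X, A)) * resO hi f = 1 := by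
    rw [← resO_resO hAW inf_le_left f, ← hf', ← map_mul]; simp
  have h2 : resO (inf_le_right : A ⊓ B ≤ B) (↑g'⁻¹ : Γ(X, B)) * resO hi g = 1 := by
    rw [← resO_resO hBW inf_le_right g, ← hg', ← map_mul]; simp
  have h3 : resO hi p * resO hi f ^ n + resO hi q * resO hi g ^ n = 1 := by
    rw [← map_pow, ← map_pow, ← map_mul, ← map_mul, ← map_add, hpq, map_one]
  simp only [map_neg, sub_neg_eq_add, map_mul, map_pow, resO_resO]
  have h1' := congrArg (· ^ n) h1
  have h2' := congrArg (· ^ n) h2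
  simp only [mul_pow, one_pow] at h1' h2'
  linear_combination (-resO hi c) * h3 - (resO hi c * resO hi q * resO hi g ^ n) * h1' -
    (resO hi c * resO hi p * resO hi f ^ n) * h2'

lemma AddFrame.surjPair {F : TopCat.Sheaf Ab.{0} X} {U : X.Opens} (ε : AddFrame F U)
    {W : X.Opens} (hWU : W ≤ U) (hW : IsAffineOpen W) {f g : Γ(X, W)}
    (hfg : IsCoprime f g) {A B : X.Opens} (hA : A = X.basicOpen f) (hB : B = X.basicOpen g) :
    SurjPair F A B := by
  have hAU : A ≤ U := (hA.le.trans (X.basicOpen_le f)).trans hWU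
  have hBU : B ≤ U := (hB.le.trans (X.basicOpen_le g)).trans hWU
  intro s
  obtain ⟨b, rfl⟩ := (ε.bijective (A ⊓ B) (inf_le_left.trans hAU)).surjective s
  obtain ⟨u, v, rfl⟩ := exists_sub_of_isCoprime hW hfg hA hB b
  exact ⟨ε.toFun A hAU u, ε.toFun B hBU v, by rw [map_sub, ε.natural hAU, ε.natural hBU]⟩

/-- The elements `f` such that a section lifts over `D(f)` form an ideal. -/
lemma van_zero_of_surjPair (G : TopCat.Sheaf Ab.{0} X) {V : X.Opens} (hV : IsAffineOpen V)
    (h : ∀ (W : X.Opens) (_ : W ≤ V) (_ : IsAffineOpen W) (f g : Γ(X, W)), IsCoprime f g →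
      SurjPair G (X.basicOpen f) (X.basicOpen g)) : Van 0 G V := by
  intro y
  let P (W : X.Opens) : Prop :=
    ∃ (hW : W ≤ V) (a : Sec (injSheaf G) W), ap (toShift G) W a = rs (shift G) hW y
  have hP {W W' : X.Opens} (hW : P W) (hW' : W' ≤ W) : P W' := by
    obtain ⟨h1, a, ha⟩ := hW
    exact ⟨hW'.trans h1, rs _ hW' a, by rw [ap_rs, ha, rs_rs]⟩
  let S : Ideal Γ(X, V) :=
    { carrier := {f | P (X.basicOpen f)}
      zero_mem' := by
        change P (X.basicOpen 0)
        rw [Scheme.basicOpen_zero]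
        exact ⟨bot_le, 0, sec_ext _ (fun i : Empty => i.elim) (fun i => i.elim) bot_le
          fun i => i.elim⟩
      add_mem' := by
        intro f g hf hg
        have hW := hV.basicOpen (f + g)
        have hle := X.basicOpen_le (f + g)
        have e (r : Γ(X, V)) : X.basicOpen (resO hle r) = X.basicOpen (f + g) ⊓ X.basicOpen r :=
          Scheme.basicOpen_res _ _ _
        -- On D(f + g) the sum is invertible, so f and g generate the unit ideal there and the lifts
        -- over the two pieces can be joined.
        have hc : IsCoprime (resO hle f) (resO hle g) := by
          obtain ⟨u, hu⟩ := isUnit_resO_of_le hle (f + g) le_rfl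
          refine ⟨↑u⁻¹, ↑u⁻¹, ?_⟩
          rw [← mul_add, ← map_add, ← hu, Units.inv_mul]
        obtain ⟨h1, a, ha⟩ := hP hf ((e f).le.trans inf_le_right)
        obtain ⟨h2, b, hb⟩ := hP hg ((e g).le.trans inf_le_right)
        refine ⟨hle, exists_lift_of_surjPair (X.basicOpen_le _) (X.basicOpen_le _) ?_
          (h _ hle hW _ _ hc) _ ⟨a, ?_⟩ ⟨b, ?_⟩⟩
        · rw [e, e, ← inf_sup_left]
          exact le_inf le_rfl (X.basicOpen_add_le f g)
        · rw [rs_rs, ha]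
        · rw [rs_rs, hb]
      smul_mem' := by
        intro r f hf
        refine hP hf ?_
        rw [smul_eq_mul, Scheme.basicOpen_mul]
        exact inf_le_right }
  -- Local lifts exist around every point because `toShift` is an epimorphism; hence the basic open
  -- sets of members of `S` cover `V`.
  have hS : Ideal.span (S : Set Γ(X, V)) = ⊤ := by
    rw [← hV.self_le_iSup_basicOpen_iff]
    intro x hx
    obtain ⟨W, hW, a, ha, hxW⟩ := locally_surjective_of_epi (toShift G) y hx
    obtain ⟨f, hf, hxf⟩ := hV.exists_basicOpen_le (⟨x, hxW⟩ : W) hx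
    exact Opens.mem_iSup.mpr ⟨⟨f, hP ⟨hW, a, ha⟩ hf⟩, hxf⟩
  rw [Ideal.span_eq] at hS
  have h1 : P (X.basicOpen (1 : Γ(X, V))) := by
    have : (1 : Γ(X, V)) ∈ S := hS ▸ Submodule.mem_top
    exact this
  rw [Scheme.basicOpen_one] at h1
  obtain ⟨_, a, ha⟩ := h1
  exact ⟨a, by rw [ha, rs_self]⟩

/-- Higher cohomology of a trivial rank one sheaf vanishes on affine open sets. -/
theorem AddFrame.van {F : TopCat.Sheaf Ab.{0} X} {U : X.Opens} (ε : AddFrame F U) (n : ℕ)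
    {V : X.Opens} (hVU : V ≤ U) (hV : IsAffineOpen V) : Van n F V := by
  induction n using Nat.strong_induction_on generalizing V with
  | _ n ih =>
    rw [van_iff_shiftN]
    refine van_zero_of_surjPair _ hV fun W hWV hW f g hfg => ?_
    obtain _ | n := n
    · exact ε.surjPair (hWV.trans hVU) hW hfg rfl rfl
    -- In positive degree the splitting over D(f) ∩ D(g) = D(fg) follows from the vanishing on this
    -- smaller affine set, one degree lower.
    · rw [shiftN_succ]
      apply surjPair_shift
      rw [← Scheme.basicOpen_mul, ← van_iff_shiftN]
      exact ih n (Nat.lt_succ_self n) ((X.basicOpen_le _).trans (hWV.trans hVU)) (hW.basicOpen _)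

end Affine

/-! ### Modules of rational functions on integral schemes -/

section Rational

variable {X : Scheme.{0}} [IsIntegral X]

/-- The rational function defined by a function on a nonempty open set. -/
def toK (U : X.Opens) (h : genericPoint X ∈ U) : Γ(X, U) →+* X.functionField :=
  (X.presheaf.germ U (genericPoint X) h).hom

lemma toK_injective (U : X.Opens) (h : genericPoint X ∈ U) : Function.Injective (toK U h) :=
  germ_injective_of_isIntegral X (genericPoint X) h

lemma toK_resO {U V : X.Opens} (h : V ≤ U) (hV : genericPoint X ∈ V) (a : Γ(X, U)) :
    toK V hV (resO h a) = toK U (h hV) a :=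
  X.presheaf.germ_res_apply (homOfLE h) _ hV a

lemma genericPoint_mem_of_mem {U : X.Opens} {x : X} (h : x ∈ U) : genericPoint X ∈ U :=
  ((genericPoint_spec X).mem_open_set_iff U.isOpen).mpr (by simpa using ⟨x, h⟩)

lemma eq_bot_of_genericPoint_notMem {U : X.Opens} (h : genericPoint X ∉ U) : U = ⊥ := by
  rw [eq_bot_iff]
  exact fun x hx => h (genericPoint_mem_of_mem hx)

lemma generic_mem_inf {U V : X.Opens} (h : genericPoint X ∈ U) (h' : genericPoint X ∈ V) :
    genericPoint X ∈ U ⊓ V := ⟨h, h'⟩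

/-- The sheaf of abelian groups underlying a module. -/
def shf {X : Scheme.{0}} (M : X.Modules) : TopCat.Sheaf Ab.{0} X := ⟨M.presheaf, M.isSheaf⟩

lemma mod_ext {X : Scheme.{0}} (M : X.Modules) {J : Type} {U : J → X.Opens} {V : X.Opens}
    (hV : V ≤ iSup U) (hU : ∀ j, U j ≤ V) {s t : Γ(M, V)}
    (h : ∀ j, res M (hU j) s = res M (hU j) t) : s = t :=
  sec_ext (shf M) U hU hV h

lemma subsingleton_of_genericPoint_notMem (M : X.Modules) {U : X.Opens}
    (h : genericPoint X ∉ U) : Subsingleton Γ(M, U) := by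
  refine ⟨fun s t => mod_ext M (U := fun i : Empty => i.elim) ?_ (fun i => i.elim)
    fun i => i.elim⟩
  rw [eq_bot_of_genericPoint_notMem h]
  exact bot_le

lemma subsingleton_functions {U : X.Opens} (h : genericPoint X ∉ U) : Subsingleton Γ(X, U) := by
  rw [eq_bot_of_genericPoint_notMem h]
  infer_instance

/-- A realization of the sections of a module as rational functions. -/
structure Rat (M : X.Modules) where
  val : ∀ V : X.Opens, genericPoint X ∈ V → Γ(M, V) →+ X.functionField
  inj : ∀ V h, Function.Injective (val V h)
  smul : ∀ V h (a : Γ(X, V)) (m : Γ(M, V)), val V h (a • m) = toK V h a * val V h m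
  val_res : ∀ {V W : X.Opens} (h : W ≤ V) (hW : genericPoint X ∈ W) (m : Γ(M, V)),
    val W hW (res M h m) = val V (h hW) m

/-- Over `U`, the sections are the multiples of the rational function `κ`. -/
def Rat.Gen {M : X.Modules} (χ : Rat M) (U : X.Opens) (κ : X.functionField) : Prop :=
  κ ≠ 0 ∧ ∀ V : X.Opens, V ≤ U → ∀ (hV : genericPoint X ∈ V) (x : X.functionField),
    (∃ s, χ.val V hV s = x) ↔ ∃ a, toK V hV a * κ = x

lemma Rat.Gen.mono {M : X.Modules} {χ : Rat M} {U V : X.Opens} {κ : X.functionField}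
    (h : χ.Gen U κ) (hV : V ≤ U) : χ.Gen V κ := ⟨h.1, fun W hW => h.2 W (hW.trans hV)⟩

/-- Rescaling a realization. -/
def Rat.scale {M : X.Modules} (χ : Rat M) (c : X.functionField) (hc : c ≠ 0) : Rat M where
  val V h := (AddMonoidHom.mulLeft c).comp (χ.val V h)
  inj V h := (mul_right_injective₀ hc).comp (χ.inj V h)
  smul V h a m := by simp [χ.smul, mul_left_comm]
  val_res h hW m := by simp [χ.val_res]

lemma Rat.Gen.scale {M : X.Modules} {χ : Rat M} {U : X.Opens} {κ : X.functionField}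
    (h : χ.Gen U κ) (c : X.functionField) (hc : c ≠ 0) : (χ.scale c hc).Gen U (c * κ) := by
  refine ⟨mul_ne_zero hc h.1, fun V hV hη x => ?_⟩
  have := h.2 V hV hη (c⁻¹ * x)
  simp only [eq_inv_mul_iff_mul_eq₀ hc] at this
  refine this.trans ⟨?_, ?_⟩ <;> rintro ⟨a, rfl⟩ <;> exact ⟨a, by ring⟩

/-- Local sections with the same rational value agree on overlaps by injectivity, so membership of a
rational function in the sheaf is a local question. -/
lemma Rat.exists_of_cover {M : X.Modules} (χ : Rat M) {J : Type} (U : J → X.Opens) {V : X.Opens}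
    (hU : ∀ j, U j ≤ V) (hV : V ≤ iSup U) (hη : genericPoint X ∈ V) (x : X.functionField)
    (h : ∀ j (hj : genericPoint X ∈ U j), ∃ s, χ.val (U j) hj s = x) : ∃ s, χ.val V hη s = x := by
  classical
  let s (j : J) : Γ(M, U j) := if hj : genericPoint X ∈ U j then (h j hj).choose else 0
  have hs (j : J) (hj : genericPoint X ∈ U j) : χ.val (U j) hj (s j) = x := by
    simp only [s, dif_pos hj]
    exact (h j hj).choose_spec
  obtain ⟨t, ht⟩ := sec_glue (shf M) U hU hV s (fun i j => by
    by_cases hij : genericPoint X ∈ U i ⊓ U j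
    · refine χ.inj _ hij ?_
      exact ((χ.val_res inf_le_left hij (s i)).trans (hs i hij.1)).trans
        ((χ.val_res inf_le_right hij (s j)).trans (hs j hij.2)).symm
    · have := subsingleton_of_genericPoint_notMem M hij
      exact Subsingleton.elim (α := Γ(M, U i ⊓ U j)) _ _)
  obtain ⟨j, hj⟩ := Opens.mem_iSup.mp (hV hη)
  refine ⟨t, ?_⟩
  rw [← hs j hj, ← ht j]
  exact (χ.val_res (hU j) hj t).symm

/-- The structure sheaf consists of rational functions. -/
def Rat.structureModule (X : Scheme.{0}) [IsIntegral X] : Rat (structureModule X) where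
  val V h := (toK V h).toAddMonoidHom
  inj V h := toK_injective V h
  smul V h a m := (toK V h).map_mul a m
  val_res h hW m := toK_resO h hW m

lemma Rat.structureModule_gen (U : X.Opens) : (Rat.structureModule X).Gen U 1 :=
  ⟨one_ne_zero, fun _ _ _ _ => ⟨fun ⟨s, hs⟩ => ⟨s, (mul_one _).trans hs⟩,
    fun ⟨s, hs⟩ => ⟨s, (mul_one _).symm.trans hs⟩⟩⟩

lemma exists_toK_of_cover {J : Type} (U : J → X.Opens) {V : X.Opens}
    (hU : ∀ j, U j ≤ V) (hV : V ≤ iSup U) (hη : genericPoint X ∈ V) (x : X.functionField)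
    (h : ∀ j (hj : genericPoint X ∈ U j), ∃ s, toK (U j) hj s = x) : ∃ s, toK V hη s = x :=
  (Rat.structureModule X).exists_of_cover U hU hV hη x h

/-- The quotient of a section by κ is regular locally, hence regular, since regularity of a rational
function is itself local. -/
lemma Rat.gen_of_cover {M : X.Modules} (χ : Rat M) {J : Type} (U : J → X.Opens) {V : X.Opens}
    (hV : V ≤ iSup U) {κ : X.functionField} (hκ : κ ≠ 0) (h : ∀ j, χ.Gen (V ⊓ U j) κ) :
    χ.Gen V κ := by
  refine ⟨hκ, fun W hW hη x => ?_⟩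
  have hc : W ≤ ⨆ j, W ⊓ U j := by
    rw [← inf_iSup_eq]
    exact le_inf le_rfl (hW.trans hV)
  have hk (j) (hj) (x) := (h j).2 (W ⊓ U j) (inf_le_inf_right _ hW) hj x
  constructor
  · rintro ⟨s, rfl⟩
    obtain ⟨a, ha⟩ := exists_toK_of_cover (fun j => W ⊓ U j) (fun j => inf_le_left) hc hη
      (χ.val W hη s * κ⁻¹) fun j hj => by
        obtain ⟨a, ha⟩ := (hk j hj _).mp ⟨res M inf_le_left s, rfl⟩
        exact ⟨a, by rw [eq_mul_inv_iff_mul_eq₀ hκ, ha, χ.val_res]⟩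
    exact ⟨a, by rw [ha, inv_mul_cancel_right₀ hκ]⟩
  · rintro ⟨a, rfl⟩
    exact χ.exists_of_cover (fun j => W ⊓ U j) (fun j => inf_le_left) hc hη _ fun j hj =>
      (hk j hj _).mpr ⟨resO inf_le_left a, by rw [toK_resO]⟩

lemma Rat.Gen.unit_mul {M : X.Modules} {χ : Rat M} {U : X.Opens} {κ : X.functionField}
    (h : χ.Gen U κ) {u : X.functionField}
    (hu : ∀ hU : genericPoint X ∈ U, ∃ a : Γ(X, U), IsUnit a ∧ toK U hU a = u) (hu0 : u ≠ 0) :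
    χ.Gen U (u * κ) := by
  refine ⟨mul_ne_zero hu0 h.1, fun V hV hη x => (h.2 V hV hη x).trans ?_⟩
  obtain ⟨_, ⟨b, rfl⟩, hb⟩ := hu (hV hη)
  constructor
  · rintro ⟨a, rfl⟩
    refine ⟨a * resO hV (↑b⁻¹ : Γ(X, U)), ?_⟩
    rw [map_mul, toK_resO, ← hb, mul_assoc, ← mul_assoc (toK U _ _), ← map_mul]
    simp
  · rintro ⟨a, rfl⟩
    exact ⟨a * resO hV b, by rw [map_mul, toK_resO, hb, mul_assoc]⟩

/-- A generator gives a frame. -/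
lemma Rat.Gen.exists_isFrame {M : X.Modules} {χ : Rat M} {U : X.Opens} {κ : X.functionField}
    (h : χ.Gen U κ) (hU : genericPoint X ∈ U) :
    ∃ e : Γ(M, U), χ.val U hU e = κ ∧ IsFrame M e := by
  obtain ⟨e, he⟩ := (h.2 U le_rfl hU κ).mpr ⟨1, by simp⟩
  refine ⟨e, he, fun V hV => ?_⟩
  by_cases hη : genericPoint X ∈ V
  · have key (a : Γ(X, V)) : χ.val V hη (a • res M hV e) = toK V hη a * κ := by
      rw [χ.smul, χ.val_res, he]
    constructor
    · intro a b hab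
      have := congrArg (χ.val V hη) hab
      simp only [key] at this
      exact toK_injective V hη (mul_right_cancel₀ h.1 this)
    · intro s
      obtain ⟨a, ha⟩ := (h.2 V hV hη _).mp ⟨s, rfl⟩
      exact ⟨a, χ.inj V hη (by simp only [key, ha])⟩
  · have := subsingleton_of_genericPoint_notMem M hη
    have := subsingleton_functions hη
    exact ⟨fun a b _ => Subsingleton.elim _ _, fun s => ⟨0, Subsingleton.elim _ _⟩⟩

lemma Rat.Gen.exists_addFrame {M : X.Modules} {χ : Rat M} {U : X.Opens} {κ : X.functionField}
    (h : χ.Gen U κ) : Nonempty (AddFrame (shf M) U) := by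
  by_cases hU : genericPoint X ∈ U
  · obtain ⟨e, -, he⟩ := h.exists_isFrame hU
    let T (V : X.Opens) (hV : V ≤ U) : Γ(X, V) →+ Γ(M, V) :=
      AddMonoidHom.mk' (fun a : Γ(X, V) => a • res M hV e) fun a b => add_smul a b _
    exact ⟨⟨T, fun V hV => he V hV, fun {V W} hV hW a => by
        change resO hW a • _ = res M hW (a • _)
        rw [res_smul, res_res]⟩⟩
  · have h' (V : X.Opens) (hV : V ≤ U) : genericPoint X ∉ V := fun h => hU (hV h)
    refine ⟨⟨fun V hV => 0, fun V hV => ?_, fun {V W} hV hW a => ?_⟩⟩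
    · have := subsingleton_of_genericPoint_notMem M (h' V hV)
      have := subsingleton_functions (h' V hV)
      exact ⟨fun a b _ => Subsingleton.elim _ _, fun s => ⟨0, Subsingleton.elim (α := Γ(M, V)) _ _⟩⟩
    · exact (map_zero (rs (shf M) hW)).symm

end Rational

/-! ### Realizing twists by rational functions -/

section RationalTwist

variable {X : Scheme.{0}} [IsIntegral X]

/-- Rational functions realizing a twist, in terms of the trivialization with index `i₀`. -/
def Rat.twistBy {M : X.Modules} (χ : Rat M) {ι : Type} (U : ι → X.Opens)
    (g : ∀ i j, Γ(X, U i ⊓ U j)ˣ) (i₀ : ι) (h₀ : genericPoint X ∈ U i₀) :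
    Rat (CastelnuovoMumford.twistBy M U g) where
  val V h := AddMonoidHom.mk' (fun m : twistSections M U g V => χ.val (V ⊓ U i₀) (generic_mem_inf h h₀) (m.1 i₀))
    fun m m' => map_add (χ.val _ _) _ _
  inj V h := by
    rw [injective_iff_map_eq_zero]
    intro m hm
    change twistSections M U g V at m
    have hm₀ : m.1 i₀ = 0 := χ.inj _ _ (hm.trans (map_zero _).symm)
    refine Subtype.ext (funext fun i => ?_)
    by_cases hi : genericPoint X ∈ U i
    · have hj : genericPoint X ∈ V ⊓ (U i ⊓ U i₀) := ⟨h, hi, h₀⟩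
      have := m.2 i i₀
      rw [hm₀, map_zero, smul_zero] at this
      have := congrArg (χ.val _ hj) this
      rw [χ.val_res, map_zero] at this
      exact χ.inj _ _ (this.trans (map_zero _).symm)
    · have := subsingleton_of_genericPoint_notMem M (U := V ⊓ U i) fun h => hi h.2
      exact Subsingleton.elim _ _
  smul V h a m := by
    refine (χ.smul (V ⊓ U i₀) (generic_mem_inf h h₀) (resO inf_le_left a) (m.1 i₀)).trans ?_
    rw [toK_resO]
    rfl
  val_res {V W} h hW m := χ.val_res _ _ _

/-- A section is read through its component at `i₀`, whereas over `U l` it is determined by its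
component at `l`. The two differ by the transition function, which therefore multiplies the
generator. -/
lemma Rat.twistBy_gen {M : X.Modules} (χ : Rat M) {ι : Type} (U : ι → X.Opens)
    (g : ∀ i j, Γ(X, U i ⊓ U j)ˣ) (i₀ : ι) (h₀ : genericPoint X ∈ U i₀)
    (γ : ι → ι → X.functionField)
    (hγ : ∀ i j (h : genericPoint X ∈ U i ⊓ U j), toK _ h (g i j : Γ(X, U i ⊓ U j)) = γ i j)
    (hγ' : ∀ i j k, genericPoint X ∈ U i → genericPoint X ∈ U j → genericPoint X ∈ U k →
      γ i j * γ j k = γ i k)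
    {V : X.Opens} {κ : X.functionField} (h : χ.Gen V κ) (l : ι) (hl : V ≤ U l)
    (hU : genericPoint X ∈ U l) :
    (χ.twistBy U g i₀ h₀).Gen V (γ i₀ l * κ) := by
  have hne (i j) (hi : genericPoint X ∈ U i) (hj : genericPoint X ∈ U j) : γ i j ≠ 0 := by
    rw [← hγ i j ⟨hi, hj⟩]
    exact ((g i j).isUnit.map (toK _ _)).ne_zero
  refine ⟨mul_ne_zero (hne _ _ h₀ hU) h.1, fun W hW hη x => ?_⟩
  have hg0 := hne _ _ h₀ hU
  have hWl : W ⊓ U l = W := inf_eq_left.mpr (hW.trans hl)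
  have hηl : genericPoint X ∈ W ⊓ U l := ⟨hη, hU⟩
  have hM : (∃ s, (χ.twistBy U g i₀ h₀).val W hη s = x) ↔
      ∃ s, χ.val (W ⊓ U l) hηl s = (γ i₀ l)⁻¹ * x := by
    constructor
    · rintro ⟨m, rfl⟩
      change twistSections M U g W at m
      refine ⟨m.1 l, ?_⟩
      have hj : genericPoint X ∈ W ⊓ (U i₀ ⊓ U l) := ⟨hη, h₀, hU⟩
      have := congrArg (χ.val _ hj) (m.2 i₀ l)
      rw [χ.smul, χ.val_res, χ.val_res, toK_resO, hγ] at this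
      rw [eq_inv_mul_iff_mul_eq₀ hg0]
      exact this.symm
    · rintro ⟨s, hs⟩
      have hle (i) : W ⊓ U i ≤ W ⊓ U l := by rw [hWl]; exact inf_le_left
      have hle' (i) : W ⊓ U i ≤ U i ⊓ U l :=
        le_inf inf_le_right (inf_le_left.trans (hW.trans hl))
      -- A section in the trivialization `l` determines every component through g i l; compatibility
      -- is the cocycle condition, verified in the function field.
      let m : twistSections M U g W := ⟨fun i =>
        resO (hle' i) (g i l : Γ(X, U i ⊓ U l)) • res M (hle i) s,
        fun i j => by
          by_cases hη' : genericPoint X ∈ W ⊓ (U i ⊓ U j)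
          · apply χ.inj _ hη'
            simp only [χ.smul, χ.val_res, res_smul, toK_resO, resO_resO, hγ]
            rw [← mul_assoc, hγ' _ _ _ hη'.2.1 hη'.2.2 hU]
          · have := subsingleton_of_genericPoint_notMem M hη'
            exact Subsingleton.elim _ _⟩
      refine ⟨m, ?_⟩
      refine (χ.smul (W ⊓ U i₀) (generic_mem_inf hη h₀) _ _).trans ?_
      rw [χ.val_res, hs, toK_resO, hγ, mul_inv_cancel_left₀ hg0]
  rw [hM, h.2 _ (inf_le_left.trans hW) hηl]
  constructor
  · rintro ⟨a, ha⟩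
    refine ⟨resO hWl.ge a, ?_⟩
    rw [toK_resO, mul_left_comm, ha, mul_inv_cancel_left₀ hg0]
  · rintro ⟨a, rfl⟩
    refine ⟨resO hWl.le a, ?_⟩
    rw [toK_resO, mul_left_comm, inv_mul_cancel_left₀ hg0]

end RationalTwist

/-! ### Toric atlases and monomial Čech complexes -/

/-- Laurent polynomials supported in `E`. -/
def SuppIn {ι : Type} (f : AddMonoidAlgebra ℂ ι) (E : Set ι) : Prop := ∀ a, f.coeff a ≠ 0 → a ∈ E

section SuppIn

variable {ι : Type} [AddCommGroup ι]

lemma SuppIn.single_mul {f : AddMonoidAlgebra ℂ ι} {E F : Set ι} (h : SuppIn f E) (m : ι) (c : ℂ)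
    (hF : ∀ a ∈ E, m + a ∈ F) : SuppIn (AddMonoidAlgebra.single m c * f) F := by
  intro a ha
  rw [AddMonoidAlgebra.coeff_single_mul_apply] at ha
  simpa using hF _ (h _ (right_ne_zero_of_mul ha))

lemma SuppIn.add {f g : AddMonoidAlgebra ℂ ι} {E : Set ι} (h : SuppIn f E) (h' : SuppIn g E) :
    SuppIn (f + g) E := by
  intro a ha
  by_contra haE
  apply ha
  simp [by_contra fun H => haE (h a H), by_contra fun H => haE (h' a H)]

open scoped Pointwise in
lemma SuppIn.mul {f g : AddMonoidAlgebra ℂ ι} {E F G : Set ι} (h : SuppIn f E) (h' : SuppIn g F)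
    (hG : ∀ a ∈ E, ∀ b ∈ F, a + b ∈ G) : SuppIn (f * g) G := by
  classical
  intro a ha
  obtain ⟨b, hb, c, hc, rfl⟩ := Finset.mem_add.mp
    (AddMonoidAlgebra.support_coeff_mul_subset f g (Finsupp.mem_support_iff.mpr ha))
  exact hG b (h b (Finsupp.mem_support_iff.mp hb)) c (h' c (Finsupp.mem_support_iff.mp hc))

lemma suppIn_single {ι : Type} {m : ι} {c : ℂ} {E : Set ι} (h : m ∈ E) :
    SuppIn (AddMonoidAlgebra.single m c) E := by
  intro a ha
  rw [AddMonoidAlgebra.coeff_single] at ha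
  by_cases hm : m = a
  · exact hm ▸ h
  · exact absurd (Finsupp.single_eq_of_ne (Ne.symm hm)) ha

end SuppIn

/-- A finite affine open cover of an integral scheme, with rings of functions spanned by monomials.
The half spaces that cut out the cones of monomials are indexed by `R`. -/
structure ToricAtlas (X : Scheme.{0}) [IsIntegral X] (J R ι : Type) [AddCommGroup ι] where
  chart : J → X.Opens
  isAffineOpen : ∀ j, IsAffineOpen (chart j)
  mem_chart : ∀ j, genericPoint X ∈ chart j
  θ : AddMonoidAlgebra ℂ ι →+* X.functionField
  θ_injective : Function.Injective θ
  rho : R → ι →+ ℤ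
  rays : J → Set R
  range_chart : ∀ j x, (∃ s, toK (chart j) (mem_chart j) s = x) ↔
    ∃ f, SuppIn f {a | ∀ r ∈ rays j, 0 ≤ rho r a} ∧ θ f = x
  exists_inf_eq_basicOpen : ∀ i j, ∃ (m : ι) (f : Γ(X, chart i)),
    toK _ (mem_chart i) f = θ (AddMonoidAlgebra.single m 1) ∧
    chart i ⊓ chart j = X.basicOpen f ∧
    (∀ r ∈ rays i, r ∈ rays j → rho r m = 0) ∧ ∀ r ∈ rays i, r ∉ rays j → 0 < rho r m

lemma mem_finset_inf {X : Type} [TopologicalSpace X] {J : Type} (U : J → Opens X) (T : Finset J)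
    (x : X) : x ∈ T.inf U ↔ ∀ j ∈ T, x ∈ U j := by
  classical
  induction T using Finset.induction_on with
  | empty => simp
  | insert j T _ ih =>
    rw [Finset.inf_insert, Finset.forall_mem_insert, ← ih]
    exact Iff.rfl

/-! ### Laurent monomials on intersections of toric charts -/

namespace ToricAtlas

variable {X : Scheme.{0}} [IsIntegral X] {J R ι : Type} [AddCommGroup ι]
  (A : ToricAtlas X J R ι)

/-- The monomial with exponent `m`. -/
def mon (m : ι) : X.functionField := A.θ (AddMonoidAlgebra.single m 1)

lemma mon_add (m n : ι) : A.mon (m + n) = A.mon m * A.mon n := by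
  rw [mon, mon, mon, ← map_mul, AddMonoidAlgebra.single_mul_single, one_mul]

lemma mon_zero : A.mon 0 = 1 := map_one A.θ

lemma mon_ne_zero (m : ι) : A.mon m ≠ 0 := by
  intro h
  have := A.mon_add m (-m)
  rw [h, zero_mul, add_neg_cancel, mon_zero] at this
  exact one_ne_zero this

lemma mon_neg (m : ι) : A.mon (-m) = (A.mon m)⁻¹ := by
  rw [← mul_eq_one_iff_eq_inv₀ (A.mon_ne_zero m), ← mon_add, neg_add_cancel, mon_zero]

lemma mon_nsmul (N : ℕ) (m : ι) : A.mon (N • m) = A.mon m ^ N := by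
  induction N with
  | zero => simp [mon_zero]
  | succ N ih => rw [succ_nsmul, mon_add, ih, pow_succ]

lemma mon_sum {T : Finset J} (m : J → ι) : A.mon (∑ j ∈ T, m j) = ∏ j ∈ T, A.mon (m j) := by
  classical
  induction T using Finset.induction_on with
  | empty => simp [mon_zero]
  | insert j T h ih => rw [Finset.sum_insert h, Finset.prod_insert h, mon_add, ih]

/-- The half spaces common to the charts in `T`. -/
def common (T : Finset J) : Set R := {r | ∀ j ∈ T, r ∈ A.rays j}

lemma mem_inf_chart (T : Finset J) : genericPoint X ∈ T.inf A.chart :=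
  (mem_finset_inf _ _ _).mpr fun j _ => A.mem_chart j

/-- The product of the monomials that cut out the pairwise intersections works: each pairing with a
half space of chart i is nonnegative, and it is strictly positive for some member of `T` that lacks
this half space. -/
lemma exists_inf_chart_eq_basicOpen {T : Finset J} {i : J} (hi : i ∈ T) :
    ∃ (m : ι) (f : Γ(X, A.chart i)), toK _ (A.mem_chart i) f = A.mon m ∧
    T.inf A.chart = X.basicOpen f ∧ (∀ r ∈ A.common T, A.rho r m = 0) ∧
    ∀ r ∈ A.rays i, r ∉ A.common T → 0 < A.rho r m := by
  classical
  choose m f h1 h2 h3 h4 using A.exists_inf_eq_basicOpen i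
  have hpos (r) (hr : r ∈ A.rays i) (j) : 0 ≤ A.rho r (m j) := by
    by_cases hj : r ∈ A.rays j
    · exact (h3 j r hr hj).ge
    · exact (h4 j r hr hj).le
  refine ⟨∑ j ∈ T, m j, ∏ j ∈ T, f j, ?_, ?_, fun r hr => ?_, fun r hr hrT => ?_⟩
  · rw [map_prod, mon_sum]
    exact Finset.prod_congr rfl fun j _ => h1 j
  · ext x
    have key (S : Finset J) : x ∈ X.basicOpen (∏ j ∈ S, f j) ↔
        x ∈ A.chart i ∧ ∀ j ∈ S, x ∈ X.basicOpen (f j) := by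
      induction S using Finset.induction_on with
      | empty => simp [Scheme.basicOpen_one]
      | insert j S hj ih =>
        rw [Finset.prod_insert hj, Scheme.basicOpen_mul, Finset.forall_mem_insert]
        refine Iff.trans (Iff.and Iff.rfl ih) ?_
        tauto
    change x ∈ T.inf A.chart ↔ x ∈ X.basicOpen (∏ j ∈ T, f j)
    rw [key, mem_finset_inf]
    simp only [← h2]
    exact ⟨fun h => ⟨h i hi, fun j hj => ⟨h i hi, h j hj⟩⟩, fun h j hj => (h.2 j hj).2⟩
  · rw [map_sum]
    exact Finset.sum_eq_zero fun j hj => h3 j r (hr i hi) (hr j hj)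
  · rw [map_sum]
    simp only [common, Set.mem_ofPred_eq, not_forall] at hrT
    obtain ⟨j, hj, hrj⟩ := hrT
    exact Finset.sum_pos' (fun j _ => hpos r hr j) ⟨j, hj, h4 j r hr hrj⟩

lemma isAffineOpen_inf {T : Finset J} (hT : T.Nonempty) : IsAffineOpen (T.inf A.chart) := by
  obtain ⟨i, hi⟩ := hT
  obtain ⟨m, f, -, h, -, -⟩ := A.exists_inf_chart_eq_basicOpen hi
  rw [h]
  exact (A.isAffineOpen i).basicOpen f

/-- Inverting the monomial m that defines the intersection removes exactly the half spaces on which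
m is positive and keeps those on which it vanishes, namely the common ones. -/
lemma range_inf [Finite R] {T : Finset J} (hT : T.Nonempty) (x : X.functionField) :
    (∃ s, toK (T.inf A.chart) (A.mem_inf_chart T) s = x) ↔
      ∃ f, SuppIn f {a | ∀ r ∈ A.common T, 0 ≤ A.rho r a} ∧ A.θ f = x := by
  obtain ⟨i, hi⟩ := hT
  obtain ⟨m, g, hg, hV, h0, hp⟩ := A.exists_inf_chart_eq_basicOpen hi
  have hVi : T.inf A.chart ≤ A.chart i := Finset.inf_le hi
  constructor
  · rintro ⟨s, rfl⟩
    obtain ⟨N, c, hc⟩ := exists_pow_mul_eq_resO (A.isAffineOpen i) g hVi hV s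
    have := congrArg (toK _ (A.mem_inf_chart T)) hc
    rw [map_mul, map_pow, toK_resO, toK_resO, hg, ← mon_nsmul] at this
    obtain ⟨f, hf, hfc⟩ := (A.range_chart i _).mp ⟨c, this.symm⟩
    refine ⟨AddMonoidAlgebra.single (-(N • m)) 1 * f, hf.single_mul _ _ ?_, ?_⟩
    · intro a ha r hr
      simp [h0 r hr, ha r (hr i hi)]
    · rw [map_mul, hfc, ← mul_assoc]
      change A.mon _ * A.mon _ * _ = _
      rw [← mon_add, neg_add_cancel, mon_zero, one_mul]
  · rintro ⟨f, hf, rfl⟩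
    have := Fintype.ofFinite R
    -- N bounds all pairings on the support, so multiplication by the N-th power of m moves every
    -- exponent into the cone of chart i.
    let N : ℕ := ∑ a ∈ f.coeff.support, ∑ r, (A.rho r a).natAbs
    have hN (a) (ha : f.coeff a ≠ 0) (r : R) : -(N : ℤ) ≤ A.rho r a := by
      have h1 : (A.rho r a).natAbs ≤ N :=
        (Finset.single_le_sum (f := fun r => (A.rho r a).natAbs) (fun _ _ => Nat.zero_le _)
          (Finset.mem_univ r)).trans
        (Finset.single_le_sum (f := fun a => ∑ r, (A.rho r a).natAbs) (fun _ _ => Nat.zero_le _)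
          (Finsupp.mem_support_iff.mpr ha))
      omega
    obtain ⟨s, hs⟩ := (A.range_chart i (A.θ (AddMonoidAlgebra.single (N • m) 1 * f))).mpr
      ⟨_, SuppIn.single_mul (E := {a | f.coeff a ≠ 0}) (fun a ha => ha) _ _ (by
        intro a ha r hr
        rw [map_add, map_nsmul, nsmul_eq_mul]
        by_cases hrT : r ∈ A.common T
        · rw [h0 r hrT, mul_zero, zero_add]
          exact hf a ha r hrT
        · have h1 := hp r hr hrT
          have h2 := hN a ha r
          nlinarith), rfl⟩
    obtain ⟨u, hu⟩ := isUnit_resO_of_le hVi g hV.le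
    refine ⟨resO hVi s * ((u⁻¹ ^ N : (Γ(X, T.inf A.chart))ˣ) : Γ(X, T.inf A.chart)), ?_⟩
    have hu' : toK _ (A.mem_inf_chart T) (u : Γ(X, T.inf A.chart)) = A.mon m := by
      rw [hu, toK_resO, hg]
    have hu2 : toK _ (A.mem_inf_chart T) ((u⁻¹ : (Γ(X, T.inf A.chart))ˣ) : Γ(X, T.inf A.chart)) =
        A.mon (-m) := by
      rw [mon_neg, ← hu', ← mul_eq_one_iff_eq_inv₀ (by rw [hu']; exact A.mon_ne_zero m), ← map_mul]
      simp
    rw [map_mul, toK_resO, hs, Units.val_pow_eq_pow_val, map_pow, hu2, ← mon_nsmul, map_mul]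
    change A.mon _ * _ * A.mon _ = _
    rw [mul_right_comm, ← mon_add, smul_neg, add_neg_cancel, mon_zero, one_mul]

/-- A realization of a line bundle that is generated by monomials; the half spaces are translated
by `d`. -/
structure MonFrames {M : X.Modules} (χ : Rat M) where
  δ : J → ι
  d : R → ℤ
  rho_eq : ∀ j, ∀ r ∈ A.rays j, A.rho r (δ j) = d r
  gen : ∀ j, χ.Gen (A.chart j) (A.mon (δ j))

variable {A} {M : X.Modules} {χ : Rat M}

/-- Multiplication by the monomial generator translates the cone of functions; `rho_eq` ensures that
the translated half spaces do not depend on the chart. -/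
lemma MonFrames.range_inf [Finite R] (B : A.MonFrames χ) {T : Finset J} (hT : T.Nonempty)
    (x : X.functionField) :
    (∃ s, χ.val (T.inf A.chart) (A.mem_inf_chart T) s = x) ↔
      ∃ f, SuppIn f {a | ∀ r ∈ A.common T, B.d r ≤ A.rho r a} ∧ A.θ f = x := by
  obtain ⟨i, hi⟩ := id hT
  rw [(B.gen i).2 _ (Finset.inf_le hi) (A.mem_inf_chart T)]
  constructor
  · rintro ⟨a, rfl⟩
    obtain ⟨f, hf, hfa⟩ := (A.range_inf hT _).mp ⟨a, rfl⟩
    refine ⟨AddMonoidAlgebra.single (B.δ i) 1 * f, hf.single_mul _ _ ?_, ?_⟩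
    · intro a ha r hr
      rw [map_add, B.rho_eq i r (hr i hi)]
      have := ha r hr
      omega
    · rw [map_mul, hfa, mul_comm]
      rfl
  · rintro ⟨f, hf, rfl⟩
    obtain ⟨a, ha⟩ := (A.range_inf hT (A.θ (AddMonoidAlgebra.single (-B.δ i) 1 * f))).mpr
      ⟨_, hf.single_mul _ _ (by
        intro a ha r hr
        have := ha r hr
        rw [map_add, map_neg, B.rho_eq i r (hr i hi)]
        omega), rfl⟩
    refine ⟨a, ?_⟩
    rw [ha, map_mul]
    change A.mon _ * _ * A.mon _ = _
    rw [mul_right_comm, ← mon_add, neg_add_cancel, mon_zero, one_mul]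

lemma MonFrames.van_inf (B : A.MonFrames χ) {T : Finset J} (hT : T.Nonempty) (n : ℕ) :
    Van n (shf M) (T.inf A.chart) := by
  obtain ⟨i, hi⟩ := id hT
  obtain ⟨ε⟩ := (B.gen i).exists_addFrame
  exact ε.van n (Finset.inf_le hi) (A.isAffineOpen_inf hT)

lemma cap_inf_chart [DecidableEq J] {J' : Type} (T : J' → Finset J) {n : ℕ} (σ : Fin n → J') :
    cap (fun j => (T j).inf A.chart) σ = (Finset.univ.biUnion fun k => T (σ k)).inf A.chart := by
  ext x
  change x ∈ cap (fun j => (T j).inf A.chart) σ ↔ x ∈ Finset.inf _ A.chart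
  rw [mem_cap, mem_finset_inf]
  simp only [mem_finset_inf, Finset.mem_biUnion, Finset.mem_univ, true_and]
  exact ⟨fun h j ⟨k, hk⟩ => h k j hk, fun h k j hk => h j ⟨k, hk⟩⟩

/-- The exponents of a Laurent polynomial in the field of rational functions. -/
def toLaurent (A : ToricAtlas X J R ι) {G : Type} [AddCommGroup G] (φ : G →+ X.functionField)
    (h : ∀ s, ∃ f, A.θ f = φ s) : G →+ (ι →₀ ℂ) where
  toFun s := (h s).choose.coeff
  map_zero' := by
    have : (h 0).choose = 0 := A.θ_injective (by rw [(h 0).choose_spec, map_zero, map_zero])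
    rw [this, AddMonoidAlgebra.coeff_zero]
  map_add' s t := by
    rw [← AddMonoidAlgebra.coeff_add]
    congr 1
    apply A.θ_injective
    exact (h (s + t)).choose_spec.trans ((map_add φ s t).trans ((congrArg₂ (· + ·)
      (h s).choose_spec (h t).choose_spec).symm.trans (map_add A.θ _ _).symm))

lemma toLaurent_eq_iff (A : ToricAtlas X J R ι) {G : Type} [AddCommGroup G]
    (φ : G →+ X.functionField) (h : ∀ s, ∃ f, A.θ f = φ s) (s : G) (v : AddMonoidAlgebra ℂ ι) :
    A.toLaurent φ h s = v.coeff ↔ φ s = A.θ v := by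
  have := (h s).choose_spec
  constructor
  · intro H
    rw [← this]
    exact congrArg A.θ (AddMonoidAlgebra.coeff_injective H)
  · intro H
    exact congrArg AddMonoidAlgebra.coeff (A.θ_injective (this.trans H))

/-- If all monomials see a cone, then higher cohomology vanishes. -/
theorem MonFrames.van [Finite R] (B : A.MonFrames χ) {J' : Type} [Finite J'] (T : J' → Finset J)
    (hT : ∀ j, (T j).Nonempty) {V : X.Opens} (hV : V = ⨆ j, (T j).inf A.chart)
    (hcone : ∀ a, ∃ j, ∀ i, ∀ r ∈ A.common (T i), A.rho r a < B.d r → r ∈ A.common (T j))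
    (p : ℕ) : Van p (shf M) V := by
  classical
  let S {n : ℕ} (σ : Fin n → J') : Finset J := Finset.univ.biUnion fun k => T (σ k)
  have hcap {n : ℕ} (σ : Fin n → J') := cap_inf_chart (A := A) T σ
  have hS {n : ℕ} (σ : Fin (n + 1) → J') : (S σ).Nonempty := by
    obtain ⟨j, hj⟩ := hT (σ 0)
    exact ⟨j, Finset.mem_biUnion.mpr ⟨0, Finset.mem_univ _, hj⟩⟩
  have hmem {n : ℕ} (σ : Fin n → J') :
      genericPoint X ∈ cap (fun j => (T j).inf A.chart) σ := by
    rw [hcap]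
    exact A.mem_inf_chart _
  have hval {U V : X.Opens} (e : U = V) (hU : genericPoint X ∈ U) (hV : genericPoint X ∈ V) (x) :
      (∃ s, χ.val U hU s = x) ↔ ∃ s, χ.val V hV s = x := by
    subst e
    rfl
  have hran {n : ℕ} (σ : Fin (n + 1) → J') (x) :
      (∃ s, χ.val _ (hmem σ) s = x) ↔
        ∃ f, SuppIn f {a | ∀ r ∈ A.common (S σ), B.d r ≤ A.rho r a} ∧ A.θ f = x :=
    (hval (hcap σ) _ _ x).trans (B.range_inf (hS σ) x)
  have hex {n : ℕ} (σ : Fin (n + 1) → J') (s) : ∃ f, A.θ f = χ.val _ (hmem σ) s := by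
    obtain ⟨f, -, hf⟩ := (hran σ _).mp ⟨s, rfl⟩
    exact ⟨f, hf⟩
  have hsurj (v : ι →₀ ℂ) : ∃ f : AddMonoidAlgebra ℂ ι, f.coeff = v :=
    ⟨AddMonoidAlgebra.ofCoeff v, rfl⟩
  refine van_of_cechExact hV (fun m n σ => ?_) (cechExact_of_monomial
    (χ := fun {n} σ => A.toLaurent (χ.val _ (hmem σ)) (hex σ)) ?_ ?_
    (fun {n} σ => {a | ∀ r ∈ A.common (S σ), B.d r ≤ A.rho r a}) ?_ ?_ p)
  · rw [hcap]
    exact B.van_inf (hS σ) m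
  · intro n σ s t hst
    obtain ⟨f, hf⟩ := hsurj (A.toLaurent (χ.val _ (hmem σ)) (hex σ) t)
    have h1 := (A.toLaurent_eq_iff _ (hex σ) s f).mp (hst.trans hf.symm)
    have h2 := (A.toLaurent_eq_iff _ (hex σ) t f).mp hf.symm
    exact χ.inj _ (hmem σ) (h1.trans h2.symm)
  · intro n τ k s
    obtain ⟨f, hf⟩ := hsurj (A.toLaurent (χ.val _ (hmem _)) (hex (τ ∘ k.succAbove)) s)
    refine Eq.trans ?_ hf
    have h2 := (A.toLaurent_eq_iff _ (hex (τ ∘ k.succAbove)) s f).mp hf.symm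
    refine (A.toLaurent_eq_iff _ (hex τ) _ f).mpr ?_
    rw [← h2]
    exact χ.val_res (cap_le_cap _ τ k.succAbove) (hmem τ) s
  · intro n σ v
    obtain ⟨f, rfl⟩ := hsurj v
    refine (exists_congr fun s => A.toLaurent_eq_iff _ (hex σ) s f).trans ((hran σ _).trans ?_)
    constructor
    · rintro ⟨g, hg, hfg⟩
      rw [A.θ_injective hfg] at hg
      exact hg
    · exact fun h => ⟨f, h, rfl⟩
  · intro a
    obtain ⟨j, hj⟩ := hcone a
    refine ⟨j, fun {n} σ ha r hr => ?_⟩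
    -- A violated half space common to all of `σ` is, by the choice of `j`, also common to T j; it
    -- would then exclude `a` from the intersection enlarged by `j`.
    by_contra hlt
    refine hlt (ha r ?_)
    have hr' (k) : r ∈ A.common (T (σ k)) := fun i hi =>
      hr i (Finset.mem_biUnion.mpr ⟨k, Finset.mem_univ _, hi⟩)
    intro i hi
    obtain ⟨k, -, hk⟩ := Finset.mem_biUnion.mp hi
    induction k using Fin.cases with
    | zero => exact hj (σ 0) r (hr' 0) (not_le.mp hlt) i (by simpa using hk)
    | succ k => exact hr' k i (by simpa using hk)

end ToricAtlas

/-! ### The standard charts of projective space -/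

lemma eval₂_mul_of_isHomogeneous {σ R S : Type} [Fintype σ] [CommSemiring R] [CommSemiring S]
    {f : MvPolynomial σ R} {N : ℕ} (hf : f.IsHomogeneous N) (φ : R →+* S) (g : σ → S) (u : S) :
    f.eval₂ φ (fun i => g i * u) = f.eval₂ φ g * u ^ N := by
  rw [MvPolynomial.eval₂_eq', MvPolynomial.eval₂_eq', Finset.sum_mul]
  refine Finset.sum_congr rfl fun d hd => ?_
  have h1 : ∑ i, d i = N := by
    rw [← hf (MvPolynomial.mem_support_iff.mp hd), ← Finsupp.degree_eq_sum,
      Finsupp.degree_eq_weight_one]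
    rfl
  simp only [mul_pow, Finset.prod_mul_distrib]
  rw [Finset.prod_pow_eq_pow_sum, h1, mul_assoc]

section Away

open HomogeneousLocalization

variable {n : ℕ} (k : Fin (n + 1))

local notation "𝒜" => MvPolynomial.homogeneousSubmodule (Fin (n + 1)) ℂ

lemma X_mem_homogeneousSubmodule (i : Fin (n + 1)) :
    (MvPolynomial.X i : MvPolynomial (Fin (n + 1)) ℂ) ∈ 𝒜 1 := MvPolynomial.isHomogeneous_X ℂ i

/-- The fraction `x_i / x_k`. -/
def awayCoord (i : Fin (n + 1)) : Away 𝒜 (MvPolynomial.X k) :=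
  Away.mk 𝒜 (X_mem_homogeneousSubmodule k) 1 (MvPolynomial.X i)
    (by simpa using MvPolynomial.isHomogeneous_X ℂ i)

/-- Constants in the ring of fractions of degree zero. -/
def awayConst : ℂ →+* Away 𝒜 (MvPolynomial.X k) :=
  (fromZeroRingHom 𝒜 _).comp (algebraMap ℂ (𝒜 0))

/-- The ring of fractions of degree zero as a polynomial ring in the coordinates. -/
def awayEval : MvPolynomial (Fin n) ℂ →+* Away 𝒜 (MvPolynomial.X k) :=
  MvPolynomial.eval₂Hom (awayConst k) fun i => awayCoord k (k.succAbove i)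

/-- The fraction `1 / x_k`. -/
def awayInv : Localization.Away (MvPolynomial.X k : MvPolynomial (Fin (n + 1)) ℂ) :=
  Localization.mk 1 ⟨MvPolynomial.X k, Submonoid.mem_powers _⟩

/-- The localization map. -/
def awayIncl : MvPolynomial (Fin (n + 1)) ℂ →+*
    Localization.Away (MvPolynomial.X k : MvPolynomial (Fin (n + 1)) ℂ) := algebraMap _ _

lemma awayConst_val (c : ℂ) : (awayConst k c).val = awayIncl k (MvPolynomial.C c) := by
  rw [awayIncl, ← Localization.mk_one_eq_algebraMap]
  rfl

lemma awayCoord_val (i : Fin (n + 1)) :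
    (awayCoord k i).val = awayIncl k (MvPolynomial.X i) * awayInv k := by
  rw [awayCoord, awayInv, awayIncl, Away.val_mk, ← Localization.mk_one_eq_algebraMap,
    Localization.mk_mul]
  simp

lemma awayCoord_self : awayCoord k k = 1 := by
  apply val_injective
  rw [awayCoord_val, awayIncl, awayInv, ← Localization.mk_one_eq_algebraMap, Localization.mk_mul]
  simp only [mul_one, one_mul, val_one]
  exact Localization.mk_self ⟨MvPolynomial.X k, _⟩

/-- A preimage of f / x_kᴺ is the dehomogenization of f at x_k = 1; homogeneity accounts for the
power of 1/x_k (`eval₂_mul_of_isHomogeneous`). -/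
lemma awayEval_surjective : Function.Surjective (awayEval k) := by
  intro z
  obtain ⟨N, f, hf, rfl⟩ := Away.mk_surjective 𝒜 (X_mem_homogeneousSubmodule k) z
  let g : MvPolynomial (Fin (n + 1)) ℂ →+* MvPolynomial (Fin n) ℂ :=
    MvPolynomial.eval₂Hom MvPolynomial.C (k.insertNth 1 MvPolynomial.X)
  have hg : (awayEval k).comp g = MvPolynomial.eval₂Hom (awayConst k) (awayCoord k) := by
    refine MvPolynomial.ringHom_ext (fun c => by simp [g, awayEval]) fun i => ?_
    induction i using Fin.succAboveCases k with
    | x => simp [g, awayCoord_self]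
    | p i => simp [g, awayEval]
  refine ⟨g f, (RingHom.congr_fun hg f).trans (val_injective _ ?_)⟩
  let v : Away 𝒜 (MvPolynomial.X k) →+* Localization.Away (MvPolynomial.X k) :=
    algebraMap _ (Localization.Away (MvPolynomial.X k : MvPolynomial (Fin (n + 1)) ℂ))
  have hv : v.comp (MvPolynomial.eval₂Hom (awayConst k) (awayCoord k)) =
      MvPolynomial.eval₂Hom ((awayIncl k).comp MvPolynomial.C)
        (fun i => awayIncl k (MvPolynomial.X i) * awayInv k) := by
    refine MvPolynomial.ringHom_ext (fun c => ?_) fun i => ?_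
    · rw [RingHom.comp_apply, MvPolynomial.eval₂Hom_C, MvPolynomial.eval₂Hom_C]
      exact awayConst_val k c
    · rw [RingHom.comp_apply, MvPolynomial.eval₂Hom_X', MvPolynomial.eval₂Hom_X']
      exact awayCoord_val k i
  refine (RingHom.congr_fun hv f).trans ?_
  have hf' : f.IsHomogeneous N := by simpa using hf
  rw [MvPolynomial.coe_eval₂Hom, eval₂_mul_of_isHomogeneous hf', Away.val_mk]
  have h1 : MvPolynomial.eval₂Hom ((awayIncl k).comp MvPolynomial.C)
        (fun i => awayIncl k (MvPolynomial.X i)) = awayIncl k :=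
    MvPolynomial.ringHom_ext (fun c => by simp) fun i => by simp
  have h2 := RingHom.congr_fun h1 f
  rw [MvPolynomial.coe_eval₂Hom] at h2
  rw [h2, awayInv, awayIncl, Localization.mk_pow, ← Localization.mk_one_eq_algebraMap, Localization.mk_mul]
  congr 1
  · simp
  · ext
    simp

/-- Setting x_k = 1 extends to the localization and gives a left inverse. -/
lemma awayEval_injective : Function.Injective (awayEval k) := by
  let δ : Localization.Away (MvPolynomial.X k : MvPolynomial (Fin (n + 1)) ℂ) →+*
      MvPolynomial (Fin n) ℂ :=
    Localization.awayLift (MvPolynomial.eval₂Hom MvPolynomial.C (k.insertNth 1 MvPolynomial.X)) _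
      (by simp)
  let v : Away 𝒜 (MvPolynomial.X k) →+* Localization.Away (MvPolynomial.X k) :=
    algebraMap _ (Localization.Away (MvPolynomial.X k : MvPolynomial (Fin (n + 1)) ℂ))
  have h : (δ.comp v).comp (awayEval k) = RingHom.id _ := by
    have h0 (f : MvPolynomial (Fin (n + 1)) ℂ) : δ (awayIncl k f) =
        MvPolynomial.eval₂Hom MvPolynomial.C (k.insertNth 1 MvPolynomial.X) f :=
      IsLocalization.Away.lift_eq _ _ _
    have h1 : δ (awayInv k) = 1 := by
      have h2 : awayIncl k (MvPolynomial.X k) * awayInv k = 1 := by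
        rw [← awayCoord_val, awayCoord_self, val_one]
      have h3 := congrArg δ h2
      rw [map_mul, h0, map_one] at h3
      simpa using h3
    refine MvPolynomial.ringHom_ext (fun c => ?_) fun i => ?_
    · simp only [RingHom.comp_apply, awayEval, MvPolynomial.eval₂Hom_C, RingHom.id_apply]
      refine (congrArg δ (awayConst_val k c)).trans ?_
      rw [h0]
      simp
    · simp only [RingHom.comp_apply, awayEval, MvPolynomial.eval₂Hom_X', RingHom.id_apply]
      refine (congrArg δ (awayCoord_val k _)).trans ?_
      rw [map_mul, h0, h1]
      simp
  exact Function.LeftInverse.injective (g := δ.comp v) fun f => RingHom.congr_fun h f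

end Away

namespace PP

variable {n : ℕ}

lemma isAffineOpen_chart (k : Fin (n + 1)) : IsAffineOpen (chart k) :=
  Proj.isAffineOpen_basicOpen (MvPolynomial.homogeneousSubmodule (Fin (n + 1)) ℂ) _
    (MvPolynomial.isHomogeneous_X ℂ k) one_pos

lemma awayToSection_bijective (k : Fin (n + 1)) : Function.Bijective
    (Proj.awayToSection (MvPolynomial.homogeneousSubmodule (Fin (n + 1)) ℂ)
      (MvPolynomial.X k)).hom :=
  ConcreteCategory.bijective_of_isIso (Proj.basicOpenIsoAway
    (MvPolynomial.homogeneousSubmodule (Fin (n + 1)) ℂ) (MvPolynomial.X k)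
    (MvPolynomial.isHomogeneous_X ℂ k) one_pos).hom

lemma iSup_chart : ⨆ k : Fin (n + 1), chart k = ⊤ := by
  refine Proj.iSup_basicOpen_eq_top' _ _ (fun k => ⟨1, MvPolynomial.isHomogeneous_X ℂ k⟩) ?_
  rw [eq_top_iff]
  intro f _
  induction f using MvPolynomial.induction_on with
  | C c =>
    exact Subalgebra.algebraMap_mem (Algebra.adjoin
      (MvPolynomial.homogeneousSubmodule (Fin (n + 1)) ℂ 0) (Set.range MvPolynomial.X))
      ⟨MvPolynomial.C c, MvPolynomial.isHomogeneous_C _ c⟩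
  | add f g hf hg => exact add_mem (hf trivial) (hg trivial)
  | mul_X f i hf => exact mul_mem (hf trivial) (Algebra.subset_adjoin ⟨i, rfl⟩)

/-- The point of projective space given by the zero ideal. -/
def zeroPoint (n : ℕ) : PP n := by
  refine (⟨⊥, Ideal.isPrime_bot, fun h => ?_⟩ :
    ProjectiveSpectrum (MvPolynomial.homogeneousSubmodule (Fin (n + 1)) ℂ))
  have : (MvPolynomial.X 0 : MvPolynomial (Fin (n + 1)) ℂ) ∈
      (⊥ : HomogeneousIdeal (MvPolynomial.homogeneousSubmodule (Fin (n + 1)) ℂ)) := by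
    apply h
    rw [HomogeneousIdeal.mem_irrelevant_iff, GradedRing.proj_apply,
      DirectSum.decompose_of_mem_ne _ (MvPolynomial.isHomogeneous_X ℂ 0) one_ne_zero]
  exact MvPolynomial.X_ne_zero 0 (Ideal.mem_bot.mp this)

lemma zeroPoint_mem_chart (k : Fin (n + 1)) : zeroPoint n ∈ chart k :=
  fun h => MvPolynomial.X_ne_zero k (Ideal.mem_bot.mp h)

lemma coord_self (i : Fin (n + 1)) : coord i i = 1 := by
  refine (congrArg (Proj.awayToSection _ _).hom ?_).trans (map_one _)
  exact awayCoord_self i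

lemma coord_cocycle (i j k : Fin (n + 1)) :
    resO (inf_le_left : chart i ⊓ chart j ≤ chart i) (coord i j) *
      resO (inf_le_right : chart i ⊓ chart j ≤ chart j) (coord j k) =
    resO inf_le_left (coord i k) := by
  let 𝒜 := MvPolynomial.homogeneousSubmodule (Fin (n + 1)) ℂ
  have hX (k : Fin (n + 1)) : (MvPolynomial.X k : MvPolynomial (Fin (n + 1)) ℂ) ∈ 𝒜 1 :=
    MvPolynomial.isHomogeneous_X ℂ k
  let x : MvPolynomial (Fin (n + 1)) ℂ := MvPolynomial.X i * MvPolynomial.X j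
  have hx : x = MvPolynomial.X i * MvPolynomial.X j := rfl
  have hx' : x = MvPolynomial.X j * MvPolynomial.X i := mul_comm _ _
  let D : (PP n).Opens := Proj.basicOpen 𝒜 x
  have hD : chart i ⊓ chart j ≤ D := (Proj.basicOpen_mul 𝒜 _ _).ge
  have hi : D ≤ chart i := (Proj.basicOpen_mul 𝒜 _ _).le.trans inf_le_left
  have hj : D ≤ chart j := (Proj.basicOpen_mul 𝒜 _ _).le.trans inf_le_right
  have h1 (l) := ConcreteCategory.congr_hom (Proj.awayMap_awayToSection 𝒜 (hX j) hx)
    (HomogeneousLocalization.Away.mk 𝒜 (hX i) 1 (MvPolynomial.X l) (by simpa using hX l))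
  have h2 := ConcreteCategory.congr_hom (Proj.awayMap_awayToSection 𝒜 (hX i) hx')
    (HomogeneousLocalization.Away.mk 𝒜 (hX j) 1 (MvPolynomial.X k) (by simpa using hX k))
  have key : resO hi (coord i j) * resO hj (coord j k) = resO hi (coord i k) := by
    refine (congrArg₂ (· * ·) (h1 j).symm h2.symm).trans (Eq.trans ?_ (h1 k))
    change Proj.awayToSection 𝒜 x _ * Proj.awayToSection 𝒜 x _ = Proj.awayToSection 𝒜 x _
    rw [← map_mul]
    refine congrArg (Proj.awayToSection 𝒜 x).hom ?_
    change HomogeneousLocalization.awayMap 𝒜 (hX j) hx _ *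
      HomogeneousLocalization.awayMap 𝒜 (hX i) hx' _ = HomogeneousLocalization.awayMap 𝒜 (hX j) hx _
    rw [HomogeneousLocalization.awayMap_mk, HomogeneousLocalization.awayMap_mk,
      HomogeneousLocalization.awayMap_mk]
    ext
    simp only [HomogeneousLocalization.val_mul,
      HomogeneousLocalization.Away.val_mk, Localization.mk_mul]
    rw [Localization.mk_eq_mk_iff, Localization.r_iff_exists]
    use 1
    simp only [OneMemClass.coe_one, one_mul, Submonoid.coe_mul, pow_one, hx]
    ring
  have := congrArg (resO hD) key
  rwa [map_mul, resO_resO, resO_resO, resO_resO] at this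

lemma chart_inf_chart (i j : Fin (n + 1)) :
    chart i ⊓ chart j = (PP n).basicOpen (coord i j) := by
  apply le_antisymm
  · have h : IsUnit (resO (inf_le_left : chart i ⊓ chart j ≤ chart i) (coord i j)) :=
      (coordUnit i j).isUnit
    have h1 := (PP n).basicOpen_of_isUnit h
    have h2 : (PP n).basicOpen (resO (inf_le_left : chart i ⊓ chart j ≤ chart i) (coord i j)) =
      (chart i ⊓ chart j) ⊓ (PP n).basicOpen (coord i j) := Scheme.basicOpen_res _ _ _
    rw [h1] at h2
    exact h2.le.trans inf_le_right
  · intro x hx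
    have hxi : x ∈ chart i := (PP n).basicOpen_le _ hx
    refine ⟨hxi, fun hxj => ?_⟩
    -- For the remaining inclusion, x_j/x_i is a unit in the local ring at the homogeneous prime of
    -- x, so its numerator x_j lies outside that prime.
    have hu := isUnit_resO_of_le ((PP n).basicOpen_le (coord i j)) (coord i j) le_rfl
    let 𝒜 := MvPolynomial.homogeneousSubmodule (Fin (n + 1)) ℂ
    let y : ProjectiveSpectrum 𝒜 := x
    have := y.isPrime
    have h2 := (hu.map (openToLocalization 𝒜
      ((PP n).basicOpen (coord i j)) x hx).hom).map
      (algebraMap _ (Localization.AtPrime y.asHomogeneousIdeal.toIdeal))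
    have h3 := ProjectiveSpectrum.Proj.awayToSection_apply 𝒜 (MvPolynomial.X i) (awayCoord i j)
      ⟨x, hxi⟩
    have h4 := (congrArg IsUnit h3).mp h2
    rw [awayCoord_val, map_mul] at h4
    have h5 := isUnit_of_mul_isUnit_left h4
    rw [awayIncl, IsLocalization.map_eq] at h5
    exact (IsLocalization.AtPrime.isUnit_to_map_iff _ y.asHomogeneousIdeal.toIdeal _).mp h5 hxj

end PP

/-! ### Integrality and constants -/

/-- Reducedness is local. The common point `x` makes the irreducible patches meet pairwise, so
nonempty open sets can be compared through two patches. -/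
lemma isIntegral_of_cover {X : Scheme.{0}} {J : Type} (U : J → X.Opens) (hU : iSup U = ⊤)
    (hA : ∀ j, IsAffineOpen (U j)) (hD : ∀ j, IsDomain Γ(X, U j)) (x : X) (hx : ∀ j, x ∈ U j) :
    AlgebraicGeometry.IsIntegral X := by
  have hint (j) : AlgebraicGeometry.IsIntegral (U j : Scheme) := by
    have : IsAffine (U j) := hA j
    have : Nonempty (U j : Scheme) := ⟨⟨x, hx j⟩⟩
    have : IsDomain Γ(U j, ⊤) := (U j).topIso.commRingCatIsoToRingEquiv.toMulEquiv.isDomain _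
    exact isIntegral_of_isAffine_of_isDomain _
  have hirr (j) : IsPreirreducible (U j : Set X) := by
    have h1 : IrreducibleSpace (U j : Scheme) := inferInstance
    exact isPreirreducible_iff_preirreducibleSpace.mpr h1.toPreirreducibleSpace
  have hred : IsReduced X := by
    have (y : X) : _root_.IsReduced (X.presheaf.stalk y) := by
      obtain ⟨j, hj⟩ := Opens.mem_iSup.mp (hU ▸ Opens.mem_top y : y ∈ iSup U)
      have : IsReduced (U j : Scheme) := inferInstance
      have : _root_.IsReduced ((U j : Scheme).presheaf.stalk ⟨y, hj⟩) :=
        isReduced_stalk_of_isReduced (U j : Scheme) _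
      exact isReduced_of_injective _ ((U j).stalkIso ⟨y, hj⟩).symm.commRingCatIsoToRingEquiv.injective
    exact isReduced_of_isReduced_stalk X
  have : PreirreducibleSpace X := by
    refine ⟨?_⟩
    rintro A B hA hB ⟨a, -, ha⟩ ⟨b, -, hb⟩
    obtain ⟨j, hj⟩ := Opens.mem_iSup.mp (hU ▸ Opens.mem_top a : a ∈ iSup U)
    obtain ⟨k, hk⟩ := Opens.mem_iSup.mp (hU ▸ Opens.mem_top b : b ∈ iSup U)
    obtain ⟨c, -, hcA, hck⟩ := hirr j A (U k) hA (U k).isOpen ⟨a, hj, ha⟩ ⟨x, hx j, hx k⟩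
    obtain ⟨d, -, hd⟩ := hirr k A B hA hB ⟨c, hck, hcA⟩ ⟨b, hk, hb⟩
    exact ⟨d, trivial, hd⟩
  have : IrreducibleSpace X := { toNonempty := ⟨x⟩ }
  exact isIntegral_of_irreducibleSpace_of_isReduced X

/-- Constant functions on a scheme over `ℂ`. -/
def cst {X : Scheme.{0}} (p : X ⟶ Spec (.of ℂ)) (U : X.Opens) : ℂ →+* Γ(X, U) :=
  ((Scheme.ΓSpecIso (.of ℂ)).inv ≫ p.appLE ⊤ U le_top).hom

lemma resO_cst {X : Scheme.{0}} (p : X ⟶ Spec (.of ℂ)) {U V : X.Opens} (h : V ≤ U) (c : ℂ) :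
    resO h (cst p U c) = cst p V c := by
  have := Scheme.Hom.appLE_map p (U := ⊤) le_top (homOfLE h).op
  exact ConcreteCategory.congr_hom this _

lemma appLE_cst {X Y : Scheme.{0}} (f : Y ⟶ X) (p : X ⟶ Spec (.of ℂ)) {U : X.Opens} {V : Y.Opens}
    (h : V ≤ f ⁻¹ᵁ U) (c : ℂ) : (f.appLE U V h).hom (cst p U c) = cst (f ≫ p) V c := by
  have := Scheme.Hom.appLE_comp_appLE f p ⊤ U V le_top h
  exact ConcreteCategory.congr_hom this _

lemma appLE_of_ι_comp_eq {X : Scheme.{0}} (U : X.Opens) {R : CommRingCat.{0}} (p : X ⟶ Spec R)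
    (ψ : R ⟶ Γ(X, U)) (h : U.ι ≫ p = U.toSpecΓ ≫ Spec.map ψ) :
    (Scheme.ΓSpecIso R).inv ≫ p.appLE ⊤ U le_top = ψ := by
  have h1 := congrArg Scheme.Hom.appTop h
  rw [Scheme.Hom.comp_appTop, Scheme.Hom.comp_appTop, Scheme.Opens.toSpecΓ_appTop,
    reassoc_of% (Scheme.ΓSpecIso_naturality ψ)] at h1
  rw [Iso.inv_comp_eq, ← cancel_mono U.topIso.inv, Category.assoc, ← h1]
  change (p.app ⊤ ≫ X.presheaf.map _) ≫ _ = _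
  rw [Category.assoc, Scheme.Opens.topIso_inv, Scheme.Opens.ι_appTop]
  exact congrArg (p.app ⊤ ≫ ·) (X.presheaf.map_comp _ _).symm

/-- On D(f) the structure morphism is Spec of A₀ → A_(f). This identifies the scheme-theoretic
constants with the constant fractions. -/
lemma appLE_toSpecZero {A : Type} [CommRing A] {σ : Type} [SetLike σ A]
    [AddSubgroupClass σ A] (𝒜 : ℕ → σ) [GradedRing 𝒜] {f : A} {m : ℕ} (hf : f ∈ 𝒜 m) (hm : 0 < m)
    {R : Type} [CommRing R] (ρ : R →+* 𝒜 0) (c : R) :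
    ((Scheme.ΓSpecIso (.of R)).inv ≫ (Proj.toSpecZero 𝒜 ≫ Spec.map (CommRingCat.ofHom ρ)).appLE ⊤
      (Proj.basicOpen 𝒜 f) le_top).hom c =
    (Proj.awayToSection 𝒜 f).hom (HomogeneousLocalization.fromZeroRingHom 𝒜 _ (ρ c)) := by
  have h : (Proj.basicOpen 𝒜 f).ι ≫ (Proj.toSpecZero 𝒜 ≫ Spec.map (CommRingCat.ofHom ρ)) =
      (Proj.basicOpen 𝒜 f).toSpecΓ ≫ Spec.map (CommRingCat.ofHom ρ ≫
        CommRingCat.ofHom (HomogeneousLocalization.fromZeroRingHom 𝒜 _) ≫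
        Proj.awayToSection 𝒜 f) := by
    have h : (Proj.basicOpen 𝒜 f).toSpecΓ ≫ Spec.map (Proj.awayToSection 𝒜 f) =
      (Proj.basicOpenIsoSpec 𝒜 f hf hm).hom := rfl
    rw [Spec.map_comp, Spec.map_comp, ← Proj.awayι_toSpecZero 𝒜 f hf hm,
      ← Proj.basicOpenIsoSpec_inv_ι 𝒜 f hf hm]
    simp only [Category.assoc]
    rw [reassoc_of% h, Iso.hom_inv_id_assoc]
  rw [appLE_of_ι_comp_eq _ _ _ h]
  rfl

namespace PP

variable {n : ℕ}

/-- The identification of functions on a chart with fractions of degree zero. -/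
def secHom (k : Fin (n + 1)) : HomogeneousLocalization.Away
    (MvPolynomial.homogeneousSubmodule (Fin (n + 1)) ℂ) (MvPolynomial.X k) →+* Γ(PP n, chart k) :=
  (Proj.awayToSection (MvPolynomial.homogeneousSubmodule (Fin (n + 1)) ℂ) (MvPolynomial.X k)).hom

lemma cst_chart (k : Fin (n + 1)) (c : ℂ) :
    cst (toSpec n) (chart k) c = secHom k (awayConst k c) :=
  appLE_toSpecZero _ (X_mem_homogeneousSubmodule k) one_pos _ c

/-- The ring of functions on a chart is a polynomial ring. -/
def chartEval (k : Fin (n + 1)) : MvPolynomial (Fin n) ℂ →+* Γ(PP n, chart k) :=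
  MvPolynomial.eval₂Hom (cst (toSpec n) _) fun i => coord k (k.succAbove i)

lemma chartEval_bijective (k : Fin (n + 1)) : Function.Bijective (chartEval k) := by
  have h : chartEval k = (secHom k).comp (awayEval k) := by
    refine MvPolynomial.ringHom_ext (fun c => ?_) fun i => ?_
    · rw [RingHom.comp_apply, chartEval, awayEval, MvPolynomial.eval₂Hom_C,
        MvPolynomial.eval₂Hom_C, cst_chart]
    · rw [RingHom.comp_apply, chartEval, awayEval, MvPolynomial.eval₂Hom_X',
        MvPolynomial.eval₂Hom_X']
      rfl
  rw [h]
  exact (awayToSection_bijective k).comp ⟨awayEval_injective k, awayEval_surjective k⟩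

instance : AlgebraicGeometry.IsIntegral (PP n) :=
  isIntegral_of_cover chart iSup_chart isAffineOpen_chart
    (fun k => (RingEquiv.ofBijective _ (chartEval_bijective k)).symm.toMulEquiv.isDomain _) (zeroPoint n)
    zeroPoint_mem_chart

lemma genericPoint_mem_chart (k : Fin (n + 1)) : genericPoint (PP n) ∈ chart k :=
  genericPoint_mem_of_mem (zeroPoint_mem_chart k)

end PP

/-! ### Laurent polynomials and the toric atlas of projective space -/

section Laurent

variable {n : ℕ} {K : Type} [Field K]

/-- Evaluation of Laurent polynomials. -/
def laurentEval (φ : ℂ →+* K) (t : Fin n → K) (ht : ∀ i, t i ≠ 0) :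
    AddMonoidAlgebra ℂ (Fin n → ℤ) →+* K :=
  AddMonoidAlgebra.liftNCRingHom φ
    { toFun := fun a => ∏ i, t i ^ (Multiplicative.toAdd a) i
      map_one' := by simp
      map_mul' := fun a b => by
        simp [← Finset.prod_mul_distrib, zpow_add₀ (ht _)] } fun _ _ => Commute.all _ _

lemma laurentEval_single (φ : ℂ →+* K) (t : Fin n → K) (ht : ∀ i, t i ≠ 0) (a : Fin n → ℤ)
    (c : ℂ) : laurentEval φ t ht (AddMonoidAlgebra.single a c) = φ c * ∏ i, t i ^ a i :=
  AddMonoidAlgebra.liftNC_single _ _ _ _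

lemma sum_single {ι : Type} [AddCommGroup ι] (f : AddMonoidAlgebra ℂ ι) :
    f = ∑ a ∈ f.coeff.support, AddMonoidAlgebra.single a (f.coeff a) := by
  apply AddMonoidAlgebra.coeff_injective
  rw [AddMonoidAlgebra.coeff_sum]
  exact (Finsupp.sum_single f.coeff).symm

/-- A Laurent polynomial becomes a polynomial after multiplication by a large monomial, and
monomials are invertible; the claim thus reduces to algebraic independence of the tᵢ. -/
lemma laurentEval_injective (φ : ℂ →+* K) (t : Fin n → K) (ht : ∀ i, t i ≠ 0)
    (h : Function.Injective (MvPolynomial.eval₂Hom φ t)) :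
    Function.Injective (laurentEval φ t ht) := by
  let ι : MvPolynomial (Fin n) ℂ →+* AddMonoidAlgebra ℂ (Fin n → ℤ) :=
    MvPolynomial.eval₂Hom AddMonoidAlgebra.singleZeroRingHom
      fun i => AddMonoidAlgebra.single (Pi.single i 1) 1
  have hι : (laurentEval φ t ht).comp ι = MvPolynomial.eval₂Hom φ t := by
    refine MvPolynomial.ringHom_ext (fun c => ?_) fun i => ?_
    · rw [RingHom.comp_apply, MvPolynomial.eval₂Hom_C, MvPolynomial.eval₂Hom_C]
      refine (laurentEval_single φ t ht 0 c).trans ?_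
      simp
    · rw [RingHom.comp_apply, MvPolynomial.eval₂Hom_X', MvPolynomial.eval₂Hom_X',
        laurentEval_single, Finset.prod_eq_single i]
      · simp
      · intro j _ hj
        simp [hj]
      · simp
  have hmon (d : Fin n →₀ ℕ) (c : ℂ) : ι (MvPolynomial.monomial d c) =
      AddMonoidAlgebra.single (fun i => (d i : ℤ)) c := by
    rw [MvPolynomial.coe_eval₂Hom, MvPolynomial.eval₂_monomial, Finsupp.prod_fintype _ _ (by simp)]
    have h1 : ∏ i, (AddMonoidAlgebra.single (Pi.single i 1) 1 : AddMonoidAlgebra ℂ (Fin n → ℤ)) ^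
        d i = AddMonoidAlgebra.single (fun i => (d i : ℤ)) 1 := by
      simp only [AddMonoidAlgebra.single_pow, one_pow]
      have key (s : Finset (Fin n)) : ∏ i ∈ s, (AddMonoidAlgebra.single (d i • Pi.single i 1) 1 :
          AddMonoidAlgebra ℂ (Fin n → ℤ)) =
            AddMonoidAlgebra.single (∑ i ∈ s, d i • Pi.single i 1) 1 := by
        induction s using Finset.induction_on with
        | empty => rfl
        | insert i s hi ih =>
          rw [Finset.prod_insert hi, Finset.sum_insert hi, ih,
            AddMonoidAlgebra.single_mul_single, one_mul]
      rw [key]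
      congr 1
      ext j
      simp [Finset.sum_apply, Pi.single_apply]
    rw [h1]
    change AddMonoidAlgebra.single 0 c * _ = _
    rw [AddMonoidAlgebra.single_mul_single, zero_add, mul_one]
  have hsurj (f : AddMonoidAlgebra ℂ (Fin n → ℤ)) (hf : SuppIn f {a | ∀ i, 0 ≤ a i}) :
      ∃ p, ι p = f := by
    refine ⟨∑ a ∈ f.coeff.support, MvPolynomial.monomial
      (Finsupp.equivFunOnFinite.symm fun i => (a i).toNat) (f.coeff a), ?_⟩
    rw [map_sum]
    conv_rhs => rw [sum_single f]
    refine Finset.sum_congr rfl fun a ha => ?_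
    rw [hmon]
    congr 1
    ext i
    simpa using hf a (Finsupp.mem_support_iff.mp ha) i
  rw [injective_iff_map_eq_zero]
  intro f hf
  let N : ℕ := ∑ a ∈ f.coeff.support, ∑ i, (a i).natAbs
  have hN (a) (ha : f.coeff a ≠ 0) (i : Fin n) : -(N : ℤ) ≤ a i := by
    have h1 : (a i).natAbs ≤ N :=
      (Finset.single_le_sum (f := fun i => (a i).natAbs) (fun _ _ => Nat.zero_le _)
        (Finset.mem_univ i)).trans
      (Finset.single_le_sum (f := fun a : Fin n → ℤ => ∑ i, (a i).natAbs)
        (fun _ _ => Nat.zero_le _) (Finsupp.mem_support_iff.mpr ha))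
    omega
  obtain ⟨p, hp⟩ := hsurj (AddMonoidAlgebra.single (fun _ => (N : ℤ)) 1 * f)
    (SuppIn.single_mul (E := {a | f.coeff a ≠ 0}) (fun a ha => ha) _ _ (by
      intro a ha i
      have := hN a ha i
      simp only [Pi.add_apply]
      omega))
  have hp0 : p = 0 := by
    apply h
    rw [← hι, RingHom.comp_apply, hp, map_mul, hf, mul_zero, map_zero]
  rw [hp0, map_zero] at hp
  have h2 := congrArg (AddMonoidAlgebra.single (fun _ => -(N : ℤ)) 1 * ·) hp
  simp only [mul_zero, ← mul_assoc, AddMonoidAlgebra.single_mul_single, one_mul] at h2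
  have h3 : ((fun _ => -(N : ℤ)) + (fun _ => (N : ℤ)) : Fin n → ℤ) = 0 := by
    ext
    simp
  rw [h3] at h2
  exact ((one_mul f).symm.trans h2.symm)

/-- The set C is the monoid generated by the m s, so polynomials in the corresponding monomials are
exactly the Laurent polynomials supported in C. The generators need not be independent here. -/
lemma exists_iff_suppIn {ι σ R' : Type} [AddCommGroup ι] [Fintype σ] [CommRing R']
    (θ : AddMonoidAlgebra ℂ ι →+* K) (Φ : MvPolynomial σ ℂ →+* R')
    (hΦ : Function.Surjective Φ) (τ : R' →+* K) (m : σ → ι)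
    (hX : ∀ s, τ (Φ (MvPolynomial.X s)) = θ (AddMonoidAlgebra.single (m s) 1))
    (hC : ∀ c, τ (Φ (MvPolynomial.C c)) = θ (AddMonoidAlgebra.single 0 c)) (C : Set ι)
    (h0 : 0 ∈ C) (hadd : ∀ a ∈ C, ∀ s, a + m s ∈ C)
    (hgen : ∀ a ∈ C, ∃ N : σ → ℕ, a = ∑ s, N s • m s) (x : K) :
    (∃ s, τ s = x) ↔ ∃ f, SuppIn f C ∧ θ f = x := by
  classical
  constructor
  · rintro ⟨s, rfl⟩
    obtain ⟨p, rfl⟩ := hΦ s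
    induction p using MvPolynomial.induction_on with
    | C c => exact ⟨_, suppIn_single h0, (hC c).symm⟩
    | add p q hp hq =>
      obtain ⟨f, hf, hf'⟩ := hp
      obtain ⟨g, hg, hg'⟩ := hq
      exact ⟨f + g, hf.add hg, by simp [hf', hg']⟩
    | mul_X p s hp =>
      obtain ⟨f, hf, hf'⟩ := hp
      refine ⟨AddMonoidAlgebra.single (m s) 1 * f, hf.single_mul _ _ fun a ha => ?_, ?_⟩
      · rw [add_comm]
        exact hadd a ha s
      · rw [map_mul, map_mul, map_mul, hX, hf', mul_comm]
  · rintro ⟨f, hf, rfl⟩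
    rw [sum_single f, map_sum]
    suffices h : ∀ a ∈ f.coeff.support,
        θ (AddMonoidAlgebra.single a (f.coeff a)) ∈ τ.range from sum_mem h
    intro a ha
    obtain ⟨N, rfl⟩ := hgen a (hf a (Finsupp.mem_support_iff.mp ha))
    generalize f.coeff _ = c
    refine ⟨Φ (MvPolynomial.C c * ∏ s, MvPolynomial.X s ^ N s), ?_⟩
    have h1 (S : Finset σ) : τ (Φ (MvPolynomial.C c * ∏ s ∈ S, MvPolynomial.X s ^ N s)) =
        θ (AddMonoidAlgebra.single (∑ s ∈ S, N s • m s) c) := by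
      induction S using Finset.induction_on with
      | empty => simp [hC]
      | insert s S hs ih =>
        rw [Finset.prod_insert hs, Finset.sum_insert hs, mul_left_comm, map_mul, map_mul, ih,
          map_pow, map_pow, hX, ← map_pow, ← map_mul, AddMonoidAlgebra.single_pow,
          AddMonoidAlgebra.single_mul_single, one_pow, one_mul]
    exact h1 Finset.univ

end Laurent

namespace PP

variable {n : ℕ}

/-- The homogeneous coordinates of an exponent of degree zero. -/
def rho (r : Fin (n + 1)) : (Fin n → ℤ) →+ ℤ :=
  Fin.cases (-∑ i, Pi.evalAddMonoidHom _ i) (fun i => Pi.evalAddMonoidHom _ i) r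

lemma rho_zero (a : Fin n → ℤ) : rho 0 a = -∑ i, a i := by
  simp [rho]

lemma rho_succ (i : Fin n) (a : Fin n → ℤ) : rho i.succ a = a i := rfl

lemma sum_rho (a : Fin n → ℤ) : ∑ r, rho r a = 0 := by
  rw [Fin.sum_univ_succ, rho_zero]
  simp [rho_succ]

/-- The exponent of `x_i / x_0`. -/
def expo (i : Fin (n + 1)) : Fin n → ℤ := Fin.cases 0 (fun i => Pi.single i 1) i

lemma rho_expo (r i : Fin (n + 1)) :
    rho r (expo i) = (if r = i then 1 else 0) - if r = 0 then 1 else 0 := by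
  induction i using Fin.cases with
  | zero => simp [expo]
  | succ i =>
    induction r using Fin.cases with
    | zero => simp [expo, rho_zero, (Fin.succ_ne_zero i).symm]
    | succ r => simp [expo, rho_succ, Pi.single_apply]

/-- The homogeneous coordinates of an exponent sum to zero, so any one of them may be omitted. -/
lemma rho_ext {a b : Fin n → ℤ} (k : Fin (n + 1))
    (h : ∀ i : Fin n, rho (k.succAbove i) a = rho (k.succAbove i) b) : a = b := by
  have hk : rho k a = rho k b := by
    have h1 := sum_rho a
    have h2 := sum_rho b
    rw [Fin.sum_univ_succAbove _ k] at h1 h2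
    have h3 : ∑ i, rho (k.succAbove i) a = ∑ i, rho (k.succAbove i) b :=
      Finset.sum_congr rfl fun i _ => h i
    omega
  have h' (r) : rho r a = rho r b := by
    induction r using Fin.succAboveCases k with
    | x => exact hk
    | p i => exact h i
  exact funext fun i => h' i.succ

lemma eq_sum_rho (k : Fin (n + 1)) (a : Fin n → ℤ) :
    a = ∑ i, rho (k.succAbove i) a • (expo (k.succAbove i) - expo k) := by
  refine rho_ext k fun j => ?_
  rw [map_sum]
  simp only [map_zsmul, map_sub, rho_expo, Fin.succAbove_ne, Fin.succAbove_right_inj, if_false,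
    smul_eq_mul]
  simp

/-- The rational function `x_i / x_0`. -/
def ratCoord (i : Fin (n + 1)) : (PP n).functionField :=
  toK (chart 0) (genericPoint_mem_chart 0) (coord 0 i)

lemma ratCoord_zero : ratCoord (0 : Fin (n + 1)) = 1 := by
  rw [ratCoord, coord_self, map_one]

lemma ratCoord_mul (k i : Fin (n + 1)) :
    ratCoord k * toK (chart k) (genericPoint_mem_chart k) (coord k i) = ratCoord i := by
  have h := congrArg (toK _ (generic_mem_inf (genericPoint_mem_chart 0) (genericPoint_mem_chart k)))
    (coord_cocycle 0 k i)
  rwa [map_mul, toK_resO, toK_resO, toK_resO] at h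

lemma ratCoord_ne_zero (k : Fin (n + 1)) : ratCoord k ≠ 0 := by
  intro h
  have := ratCoord_mul k 0
  rw [h, zero_mul, ratCoord_zero] at this
  exact zero_ne_one this

lemma toK_coord (k i : Fin (n + 1)) :
    toK (chart k) (genericPoint_mem_chart k) (coord k i) = (ratCoord k)⁻¹ * ratCoord i := by
  rw [← ratCoord_mul k i, inv_mul_cancel_left₀ (ratCoord_ne_zero k)]

/-- The rational function given by a Laurent polynomial. -/
def theta (n : ℕ) : AddMonoidAlgebra ℂ (Fin n → ℤ) →+* (PP n).functionField :=
  laurentEval ((toK (chart 0) (genericPoint_mem_chart 0)).comp (cst (toSpec n) _))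
    (fun i => ratCoord i.succ) fun _ => ratCoord_ne_zero _

lemma theta_single_zero (c : ℂ) (k : Fin (n + 1)) : theta n (AddMonoidAlgebra.single 0 c) =
    toK (chart k) (genericPoint_mem_chart k) (cst (toSpec n) _ c) := by
  have h := generic_mem_inf (genericPoint_mem_chart 0) (genericPoint_mem_chart k)
  rw [theta, laurentEval_single]
  simp only [RingHom.comp_apply, Pi.zero_apply, zpow_zero, Finset.prod_const_one, mul_one]
  rw [← toK_resO inf_le_left h, ← toK_resO inf_le_right h, resO_cst, resO_cst]

lemma theta_expo (i : Fin (n + 1)) : theta n (AddMonoidAlgebra.single (expo i) 1) = ratCoord i := by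
  rw [theta, laurentEval_single, map_one, one_mul]
  induction i using Fin.cases with
  | zero => simp [expo, ratCoord_zero]
  | succ i =>
    rw [Finset.prod_eq_single i]
    · simp [expo]
    · intro j _ hj
      simp [expo, hj]
    · simp

lemma theta_expo_sub (k i : Fin (n + 1)) : theta n (AddMonoidAlgebra.single (expo i - expo k) 1) =
    toK (chart k) (genericPoint_mem_chart k) (coord k i) := by
  rw [toK_coord, eq_inv_mul_iff_mul_eq₀ (ratCoord_ne_zero k), ← theta_expo, ← theta_expo,
    ← map_mul, AddMonoidAlgebra.single_mul_single, one_mul, add_sub_cancel]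

lemma theta_injective : Function.Injective (theta n) := by
  refine laurentEval_injective _ _ _ ?_
  have h : MvPolynomial.eval₂Hom ((toK (chart 0) (genericPoint_mem_chart 0)).comp
      (cst (toSpec n) _)) (fun i : Fin n => ratCoord i.succ) =
      (toK (chart 0) (genericPoint_mem_chart 0)).comp (chartEval 0) := by
    refine MvPolynomial.ringHom_ext (fun c => ?_) fun i => ?_
    · simp [chartEval]
    · simp [chartEval, ratCoord]
  rw [h]
  exact (toK_injective _ _).comp (chartEval_bijective 0).injective

/-- The toric atlas of projective space. -/
def atlas (n : ℕ) : ToricAtlas (PP n) (Fin (n + 1)) (Fin (n + 1)) (Fin n → ℤ) where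
  chart := chart
  isAffineOpen := isAffineOpen_chart
  mem_chart := genericPoint_mem_chart
  θ := theta n
  θ_injective := theta_injective
  rho := rho
  rays k := {r | r ≠ k}
  range_chart k x := by
    -- The cone of chart k is generated by the exponents of x_i / x_k for i ≠ k, with the remaining
    -- homogeneous coordinates as multiplicities.
    refine exists_iff_suppIn (theta n) (chartEval k) (chartEval_bijective k).surjective _
      (fun i => expo (k.succAbove i) - expo k) (fun i => ?_) (fun c => ?_) _ ?_ ?_ ?_ x
    · simp [chartEval, theta_expo_sub]
    · simp [chartEval, theta_single_zero c k]
    · simp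
    · intro a ha i r hr
      have := ha r hr
      rw [map_add, map_sub, rho_expo, rho_expo]
      have hr' : r ≠ k := hr
      simp only [hr', if_false]
      split_ifs <;> omega
    · intro a ha
      refine ⟨fun i => (rho (k.succAbove i) a).toNat, (eq_sum_rho k a).trans ?_⟩
      refine Finset.sum_congr rfl fun i _ => ?_
      rw [← natCast_zsmul, Int.toNat_of_nonneg (ha _ (Fin.succAbove_ne k i))]
  exists_inf_eq_basicOpen i j := by
    refine ⟨expo j - expo i, coord i j, (theta_expo_sub i j).symm, chart_inf_chart i j, ?_, ?_⟩
    · intro r hi hj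
      have hi' : r ≠ i := hi
      have hj' : r ≠ j := hj
      simp [rho_expo, hi', hj']
    · intro r hi hj
      have hi' : r ≠ i := hi
      have hj' : r = j := not_not.mp hj
      subst hj'
      simp [rho_expo, hi']

end PP

/-! ### Rational functions and twists defined by a morphism to projective space -/

section Coordinates

variable {X : Scheme.{0}} [IsIntegral X] {n : ℕ} (g : X ⟶ PP n)

lemma resO_appLE {X Y : Scheme.{0}} (f : X ⟶ Y) {U : Y.Opens} {V W : X.Opens} (h : V ≤ f ⁻¹ᵁ U)
    (h' : W ≤ V) (a : Γ(Y, U)) :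
    resO h' ((f.appLE U V h).hom a) = (f.appLE U W (h'.trans h)).hom a :=
  ConcreteCategory.congr_hom (f.appLE_map h (homOfLE h').op) a

lemma appLE_resO {X Y : Scheme.{0}} (f : X ⟶ Y) {U U' : Y.Opens} {V : X.Opens} (h : V ≤ f ⁻¹ᵁ U')
    (h' : U' ≤ U) (a : Γ(Y, U)) : (f.appLE U' V h).hom (resO h' a) =
      (f.appLE U V (h.trans (f.preimage_mono h'))).hom a :=
  ConcreteCategory.congr_hom (f.map_appLE h (homOfLE h').op) a

/-- The rational function `x_j / x_i` (zero if `x_i` vanishes on `X`). -/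
def rat (i j : Fin (n + 1)) : X.functionField :=
  open Classical in
  if h : genericPoint X ∈ g ⁻¹ᵁ PP.chart i then
    toK _ h ((g.appLE (PP.chart i) _ le_rfl).hom (PP.coord i j)) else 0

lemma toK_appLE_coord {V : X.Opens} (hV : genericPoint X ∈ V) (i j : Fin (n + 1))
    (h : V ≤ g ⁻¹ᵁ PP.chart i) :
    toK V hV ((g.appLE (PP.chart i) V h).hom (PP.coord i j)) = rat g i j := by
  rw [rat, dif_pos (h hV), ← resO_appLE g le_rfl h, toK_resO]

variable {g}

lemma rat_self {i : Fin (n + 1)} (hi : genericPoint X ∈ g ⁻¹ᵁ PP.chart i) : rat g i i = 1 := by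
  rw [rat, dif_pos hi, PP.coord_self, map_one, map_one]

lemma rat_mul_rat {i j : Fin (n + 1)} (hi : genericPoint X ∈ g ⁻¹ᵁ PP.chart i)
    (hj : genericPoint X ∈ g ⁻¹ᵁ PP.chart j) (k : Fin (n + 1)) :
    rat g i j * rat g j k = rat g i k := by
  have hle : g ⁻¹ᵁ PP.chart i ⊓ g ⁻¹ᵁ PP.chart j ≤ g ⁻¹ᵁ (PP.chart i ⊓ PP.chart j) := le_rfl
  have h := congrArg ((g.appLE _ _ hle).hom) (PP.coord_cocycle i j k)
  rw [map_mul, appLE_resO, appLE_resO, appLE_resO] at h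
  have h' := congrArg (toK _ (generic_mem_inf hi hj)) h
  rwa [map_mul, toK_appLE_coord, toK_appLE_coord, toK_appLE_coord] at h'

lemma rat_ne_zero {i j : Fin (n + 1)} (hi : genericPoint X ∈ g ⁻¹ᵁ PP.chart i)
    (hj : genericPoint X ∈ g ⁻¹ᵁ PP.chart j) : rat g i j ≠ 0 := by
  intro h
  have := rat_mul_rat hi hj i
  rw [h, zero_mul, rat_self hi] at this
  exact zero_ne_one this

lemma exists_genericPoint_mem_chart (g : X ⟶ PP n) :
    ∃ i, genericPoint X ∈ g ⁻¹ᵁ PP.chart i := by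
  have : g (genericPoint X) ∈ ⨆ k : Fin (n + 1), PP.chart k := PP.iSup_chart ▸ Opens.mem_top _
  obtain ⟨i, hi⟩ := Opens.mem_iSup.mp this
  exact ⟨i, hi⟩

/-- Rational functions realizing a Serre twist, in terms of the trivialization with index `i₀`. -/
def Rat.twist {M : X.Modules} (χ : Rat M) (g : X ⟶ PP n) (k : ℤ) (i₀ : Fin (n + 1))
    (h₀ : genericPoint X ∈ g ⁻¹ᵁ PP.chart i₀) : Rat (CastelnuovoMumford.twist g k M) :=
  χ.twistBy _ _ i₀ h₀

lemma iSup_preimage_chart {X : Scheme.{0}} (g : X ⟶ PP n) : ⨆ i, g ⁻¹ᵁ PP.chart i = ⊤ := by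
  rw [← Scheme.Hom.preimage_iSup, PP.iSup_chart]
  rfl

lemma Rat.gen_of_notMem {M : X.Modules} (χ : Rat M) {V : X.Opens} {κ : X.functionField}
    (hκ : κ ≠ 0) (hV : genericPoint X ∉ V) : χ.Gen V κ :=
  ⟨hκ, fun _ hW hη => absurd (hW hη) hV⟩

/-- If `q` are homogeneous coordinates of `g` over `V`, then the twist is generated over `V` by
the power of the scaling factor. -/
lemma Rat.Gen.twist {M : X.Modules} {χ : Rat M} {V : X.Opens} {κ : X.functionField}
    (h : χ.Gen V κ) (k : ℤ) {i₀ : Fin (n + 1)} (h₀ : genericPoint X ∈ g ⁻¹ᵁ PP.chart i₀)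
    (hV : genericPoint X ∈ V) (q : Fin (n + 1) → Γ(X, V)) (hspan : Ideal.span (Set.range q) = ⊤)
    {ν : X.functionField} (hν : ν ≠ 0) (hq : ∀ l, toK V hV (q l) = rat g i₀ l * ν) :
    (χ.twist g k i₀ h₀).Gen V (ν ^ (-k) * κ) := by
  have hκ := mul_ne_zero (zpow_ne_zero (-k) hν) h.1
  refine Rat.gen_of_cover _ (fun j => g ⁻¹ᵁ PP.chart j)
    (le_top.trans (iSup_preimage_chart g).ge) hκ fun j => ?_
  by_cases hj : genericPoint X ∈ g ⁻¹ᵁ PP.chart j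
  swap
  · exact Rat.gen_of_notMem _ hκ fun h => hj h.2
  have hVj := generic_mem_inf hV hj
  have h1 : (χ.twist g k i₀ h₀).Gen (V ⊓ g ⁻¹ᵁ PP.chart j) (rat g i₀ j ^ k * κ) := by
    refine χ.twistBy_gen _ _ i₀ h₀ (fun i j => rat g i j ^ k) (fun i j hij => ?_)
      (fun i j k hi hj hk => ?_) (h.mono inf_le_left) j inf_le_right hj
    · have e (u : Γ(X, g ⁻¹ᵁ PP.chart i ⊓ g ⁻¹ᵁ PP.chart j)ˣ) (k : ℤ) :
          toK _ hij ((u ^ k : Γ(X, g ⁻¹ᵁ PP.chart i ⊓ g ⁻¹ᵁ PP.chart j)ˣ) :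
            Γ(X, g ⁻¹ᵁ PP.chart i ⊓ g ⁻¹ᵁ PP.chart j)) = toK _ hij (u : Γ(X, _)) ^ k := by
        have := congrArg Units.val (map_zpow (Units.map (toK _ hij).toMonoidHom) u k)
        rwa [Units.val_zpow_eq_zpow_val] at this
      have hle : g ⁻¹ᵁ PP.chart i ⊓ g ⁻¹ᵁ PP.chart j ≤ g ⁻¹ᵁ (PP.chart i ⊓ PP.chart j) := le_rfl
      refine (e _ k).trans (congrArg (· ^ k) ?_)
      change toK _ hij ((g.appLE _ _ hle).hom (resO inf_le_left (PP.coord i j))) = _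
      rw [appLE_resO, toK_appLE_coord]
    · rw [← mul_zpow, rat_mul_rat hi hj]
  have hdvd (l) : resO (inf_le_left : V ⊓ g ⁻¹ᵁ PP.chart j ≤ V) (q l) =
      resO inf_le_left (q j) * (g.appLE (PP.chart j) _ inf_le_right).hom (PP.coord j l) := by
    apply toK_injective _ hVj
    rw [map_mul, toK_resO, toK_resO, hq, hq, toK_appLE_coord, ← rat_mul_rat h₀ hj l]
    ring
  -- Where x_j is invertible, every q l is a multiple of q j, so the unit ideal is generated by q j
  -- alone.
  have hunit : IsUnit (resO (inf_le_left : V ⊓ g ⁻¹ᵁ PP.chart j ≤ V) (q j)) := by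
    have h2 := congrArg (Ideal.map (resO (inf_le_left : V ⊓ g ⁻¹ᵁ PP.chart j ≤ V))) hspan
    rw [Ideal.map_top, Ideal.map_span] at h2
    rw [← Ideal.span_singleton_eq_top, eq_top_iff, ← h2, Ideal.span_le]
    rintro _ ⟨_, ⟨l, rfl⟩, rfl⟩
    exact Ideal.mem_span_singleton.mpr ⟨_, hdvd l⟩
  -- q j is a unit equal to x_j ν in the chosen normalization; its power -k trades the generator
  -- with x_jᵏ for the one with ν⁻ᵏ.
  have h3 := h1.unit_mul (u := (rat g i₀ j * ν) ^ (-k)) (fun hη => ?_)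
    (zpow_ne_zero _ (mul_ne_zero (rat_ne_zero h₀ hj) hν))
  · have e : (rat g i₀ j * ν) ^ (-k) * (rat g i₀ j ^ k * κ) = ν ^ (-k) * κ := by
      rw [mul_zpow, mul_mul_mul_comm, ← zpow_add₀ (rat_ne_zero h₀ hj), neg_add_cancel, zpow_zero,
        one_mul]
    rwa [e] at h3
  · obtain ⟨u, hu⟩ := hunit
    refine ⟨((u ^ (-k) : Γ(X, V ⊓ g ⁻¹ᵁ PP.chart j)ˣ) : Γ(X, V ⊓ g ⁻¹ᵁ PP.chart j)),
      Units.isUnit _, ?_⟩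
    have := congrArg Units.val (map_zpow (Units.map (toK _ hη).toMonoidHom) u (-k))
    rw [Units.val_zpow_eq_zpow_val] at this
    refine this.trans (congrArg (· ^ (-k)) ?_)
    change toK _ hη u = _
    rw [hu, toK_resO, hq]

end Coordinates

/-! ### The product of two projective lines -/

namespace BiP1

variable {Q : Scheme.{0}} (f : Fin 2 → (Q ⟶ PP 1))

/-- The standard charts of the product. -/
def chart (v : Fin 2 → Fin 2) : Q.Opens := f 0 ⁻¹ᵁ PP.chart (v 0) ⊓ f 1 ⁻¹ᵁ PP.chart (v 1)

lemma chart_le (v : Fin 2 → Fin 2) (i : Fin 2) : chart f v ≤ f i ⁻¹ᵁ PP.chart (v i) := by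
  fin_cases i
  exacts [inf_le_left, inf_le_right]

lemma mem_chart {v : Fin 2 → Fin 2} {x : Q} :
    x ∈ chart f v ↔ ∀ i, x ∈ f i ⁻¹ᵁ PP.chart (v i) :=
  (Fin.forall_fin_two (p := fun i => x ∈ f i ⁻¹ᵁ PP.chart (v i))).symm

/-- The structure morphism. -/
def str : Q ⟶ Spec (.of ℂ) := f 0 ≫ PP.toSpec 1

/-- The coordinate of the `i`-th factor. -/
def coord (v : Fin 2 → Fin 2) (i l : Fin 2) : Γ(Q, chart f v) :=
  ((f i).appLE (PP.chart (v i)) (chart f v) (chart_le f v i)).hom (PP.coord (v i) l)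

/-- Polynomials in the coordinates of a chart. -/
def chartEval (v : Fin 2 → Fin 2) : MvPolynomial (Fin 2) ℂ →+* Γ(Q, chart f v) :=
  MvPolynomial.eval₂Hom (cst (str f) _) fun i => coord f v i ((v i).succAbove 0)

variable {f} (H : IsPullback (f 0) (f 1) (PP.toSpec 1) (PP.toSpec 1))
include H

lemma comp_toSpec (i : Fin 2) : f i ≫ PP.toSpec 1 = str f := by
  fin_cases i
  exacts [rfl, H.w.symm]

/-- Functions on a fibre product of affine schemes form the tensor product. -/
lemma isPushout (v : Fin 2 → Fin 2) : IsPushout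
    ((PP.toSpec 1).appLE ⊤ (PP.chart (v 0)) le_top) ((PP.toSpec 1).appLE ⊤ (PP.chart (v 1)) le_top)
    ((f 0).appLE (PP.chart (v 0)) (chart f v) (chart_le f v 0))
    ((f 1).appLE (PP.chart (v 1)) (chart f v) (chart_le f v 1)) :=
  (isIso_pushoutSection_iff H le_top le_top rfl).mp
    (isIso_pushoutSection_of_isAffineOpen H le_top le_top rfl (isAffineOpen_top _)
      (PP.isAffineOpen_chart _) (PP.isAffineOpen_chart _))

lemma isAffineOpen_chart (v : Fin 2 → Fin 2) : IsAffineOpen (chart f v) := by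
  have h0 : IsAffine (PP.chart (v 0)) := PP.isAffineOpen_chart _
  have h1 : IsAffine (PP.chart (v 1)) := PP.isAffineOpen_chart _
  have h2 : IsAffine (⊤ : (Spec (.of ℂ)).Opens) := isAffineOpen_top _
  exact .of_isIso (Scheme.Hom.isPullback_resLE H (US := ⊤) (UX := PP.chart (v 0))
    (UT := PP.chart (v 1)) le_top le_top (UY := chart f v) rfl).isoPullback.hom

lemma appLE_comp_chartEval (v : Fin 2 → Fin 2) (i : Fin 2) :
    ((f i).appLE (PP.chart (v i)) (chart f v) (chart_le f v i)).hom.comp (PP.chartEval (v i)) =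
      (chartEval f v).comp (MvPolynomial.rename fun _ => i).toRingHom := by
  refine MvPolynomial.ringHom_ext (fun c => ?_) fun j => ?_
  · simp [PP.chartEval, chartEval, appLE_cst, comp_toSpec H]
  · fin_cases j
    simp [PP.chartEval, chartEval, coord]

/-- The inverse comes from the universal property of the tensor product, applied to the polynomial
rings in one variable of the two factors. -/
lemma chartEval_bijective (v : Fin 2 → Fin 2) : Function.Bijective (chartEval f v) := by
  let e (i : Fin 2) := RingEquiv.ofBijective _ (PP.chartEval_bijective (v i))
  let G (i : Fin 2) : Γ(PP 1, PP.chart (v i)) →+* MvPolynomial (Fin 2) ℂ :=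
    (MvPolynomial.rename fun _ => i).toRingHom.comp (e i).symm.toRingHom
  let g (i : Fin 2) : Γ(PP 1, PP.chart (v i)) ⟶ CommRingCat.of (MvPolynomial (Fin 2) ℂ) :=
    CommRingCat.ofHom (R := Γ(PP 1, PP.chart (v i))) (G i)
  have hg (i) (p) : (g i).hom (PP.chartEval (v i) p) = MvPolynomial.rename (fun _ => i) p := by
    change MvPolynomial.rename _ ((e i).symm (e i p)) = _
    rw [RingEquiv.symm_apply_apply]
  have hcst (i) (c) : (g i).hom (cst (PP.toSpec 1) _ c) = MvPolynomial.C c := by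
    have := hg i (MvPolynomial.C c)
    simpa [PP.chartEval] using this
  have hw : (PP.toSpec 1).appLE ⊤ (PP.chart (v 0)) le_top ≫ g 0 =
      (PP.toSpec 1).appLE ⊤ (PP.chart (v 1)) le_top ≫ g 1 := by
    rw [← cancel_epi (Scheme.ΓSpecIso (.of ℂ)).inv]
    refine CommRingCat.hom_ext (RingHom.ext fun c => ?_)
    exact (hcst 0 c).trans (hcst 1 c).symm
  let d := (isPushout H v).desc (g 0) (g 1) hw
  have hd (i) (a) : d.hom (((f i).appLE (PP.chart (v i)) (chart f v) (chart_le f v i)).hom a) =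
      (g i).hom a := by
    fin_cases i
    · exact ConcreteCategory.congr_hom ((isPushout H v).inl_desc (g 0) (g 1) hw) a
    · exact ConcreteCategory.congr_hom ((isPushout H v).inr_desc (g 0) (g 1) hw) a
  have h1 : d.hom.comp (chartEval f v) = RingHom.id _ := by
    refine MvPolynomial.ringHom_ext (fun c => ?_) fun i => ?_
    · rw [RingHom.comp_apply, chartEval, MvPolynomial.eval₂Hom_C, str, ← appLE_cst (f 0)
        (PP.toSpec 1) (chart_le f v 0), hd, hcst]
      rfl
    · rw [RingHom.comp_apply, chartEval, MvPolynomial.eval₂Hom_X', coord, hd]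
      have := hg i (MvPolynomial.X 0)
      simpa [PP.chartEval] using this
  have h2 : d ≫ CommRingCat.ofHom (chartEval f v) = 𝟙 _ := by
    have key (i : Fin 2) : (f i).appLE (PP.chart (v i)) (chart f v) (chart_le f v i) ≫ d ≫
        CommRingCat.ofHom (chartEval f v) =
        (f i).appLE (PP.chart (v i)) (chart f v) (chart_le f v i) := by
      ext a
      obtain ⟨p, rfl⟩ := (PP.chartEval_bijective (v i)).surjective a
      refine (congrArg (chartEval f v) ((hd i _).trans (hg i p))).trans ?_
      exact (RingHom.congr_fun (appLE_comp_chartEval H v i) p).symm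
    refine (isPushout H v).hom_ext ?_ ?_
    · rw [key 0, Category.comp_id]
    · rw [key 1, Category.comp_id]
  exact ⟨Function.LeftInverse.injective (g := d.hom) fun p => RingHom.congr_fun h1 p,
    Function.RightInverse.surjective (g := d.hom) fun p => ConcreteCategory.congr_hom h2 p⟩

omit H in
lemma iSup_chart : ⨆ v, chart f v = ⊤ := by
  rw [eq_top_iff]
  intro x _
  have h (i : Fin 2) : ∃ k, x ∈ f i ⁻¹ᵁ PP.chart k := by
    have : x ∈ ⨆ k, f i ⁻¹ᵁ PP.chart k := iSup_preimage_chart (f i) ▸ Opens.mem_top x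
    exact Opens.mem_iSup.mp this
  choose v hv using h
  exact Opens.mem_iSup.mpr ⟨v, (mem_chart f).mpr hv⟩

/-- A point over the pair of zero points of the two lines lies in every chart, since a zero point
lies in every chart of its line. -/
lemma exists_mem_chart : ∃ x, ∀ v, x ∈ chart f v := by
  obtain ⟨z, hz0, hz1⟩ := Scheme.Pullback.exists_preimage_pullback (f := PP.toSpec 1)
    (g := PP.toSpec 1) (PP.zeroPoint 1) (PP.zeroPoint 1) rfl
  refine ⟨H.isoPullback.inv z, fun v => (mem_chart f).mpr fun i => ?_⟩
  have h : f i (H.isoPullback.inv z) = PP.zeroPoint 1 := by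
    fin_cases i
    · rw [← hz0, ← H.isoPullback_inv_fst]; rfl
    · rw [← hz1, ← H.isoPullback_inv_snd]; rfl
  change f i (H.isoPullback.inv z) ∈ PP.chart (v i)
  rw [h]
  exact PP.zeroPoint_mem_chart _

lemma isIntegral : AlgebraicGeometry.IsIntegral Q := by
  obtain ⟨x, hx⟩ := exists_mem_chart H
  exact isIntegral_of_cover (chart f) iSup_chart (isAffineOpen_chart H)
    (fun v => (RingEquiv.ofBijective _ (chartEval_bijective H v)).symm.toMulEquiv.isDomain _) x hx

variable [AlgebraicGeometry.IsIntegral Q]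

lemma genericPoint_mem_chart (v : Fin 2 → Fin 2) : genericPoint Q ∈ chart f v := by
  obtain ⟨x, hx⟩ := exists_mem_chart H
  exact genericPoint_mem_of_mem (hx v)

lemma genericPoint_mem_preimage (i k : Fin 2) : genericPoint Q ∈ f i ⁻¹ᵁ PP.chart k :=
  chart_le f (fun _ => k) i (genericPoint_mem_chart H _)

/-- The exponent of the rational function `x_l / x_0` of the `i`-th factor. -/
def expo (i l : Fin 2) : Fin 2 → ℤ := fun j => if j = i then PP.expo (n := 1) l 0 else 0

/-- Homogeneous coordinates of an exponent. -/
def rho (r : Fin 2 × Fin 2) : (Fin 2 → ℤ) →+ ℤ :=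
  AddMonoidHom.mk' (fun a => PP.rho (n := 1) r.2 fun _ => a r.1) fun _ _ => map_add (PP.rho r.2) _ _

omit H [AlgebraicGeometry.IsIntegral Q] in
lemma rho_expo (r : Fin 2 × Fin 2) (i l : Fin 2) : rho r (expo i l) =
    if r.1 = i then (if r.2 = l then 1 else 0) - (if r.2 = 0 then 1 else 0) else 0 := by
  by_cases h : r.1 = i
  · rw [if_pos h, ← PP.rho_expo]
    refine congrArg (PP.rho (n := 1) r.2) (funext fun j => ?_)
    fin_cases j
    simp [expo, h]
  · rw [if_neg h]
    refine Eq.trans ?_ (map_zero (PP.rho (n := 1) r.2))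
    refine congrArg (PP.rho (n := 1) r.2) (funext fun j => ?_)
    simp [expo, h]

/-- The rational function given by a Laurent polynomial. -/
def theta : AddMonoidAlgebra ℂ (Fin 2 → ℤ) →+* Q.functionField :=
  laurentEval ((toK (chart f 0) (genericPoint_mem_chart H 0)).comp (cst (str f) _))
    (fun i => rat (f i) 0 1) fun i =>
      rat_ne_zero (genericPoint_mem_preimage H i 0) (genericPoint_mem_preimage H i 1)

lemma theta_single_zero (c : ℂ) (v : Fin 2 → Fin 2) : theta H (AddMonoidAlgebra.single 0 c) =
    toK (chart f v) (genericPoint_mem_chart H v) (cst (str f) _ c) := by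
  have h := generic_mem_inf (genericPoint_mem_chart H 0) (genericPoint_mem_chart H v)
  rw [theta, laurentEval_single]
  simp only [RingHom.comp_apply, Pi.zero_apply, zpow_zero, Finset.prod_const_one, mul_one]
  rw [← toK_resO inf_le_left h, ← toK_resO inf_le_right h, resO_cst, resO_cst]

lemma theta_expo (i l : Fin 2) :
    theta H (AddMonoidAlgebra.single (expo i l) 1) = rat (f i) 0 l := by
  rw [theta, laurentEval_single, map_one, one_mul, Finset.prod_eq_single i]
  · fin_cases l
    · simp [expo, PP.expo, rat_self (genericPoint_mem_preimage H i 0)]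
    · simp only [expo, if_true]
      have : PP.expo (n := 1) 1 0 = 1 := rfl
      simp [this]
  · intro j _ hj
    simp [expo, hj]
  · simp

lemma theta_expo_sub (i k l : Fin 2) :
    theta H (AddMonoidAlgebra.single (expo i l - expo i k) 1) = rat (f i) k l := by
  apply mul_left_cancel₀ (rat_ne_zero (genericPoint_mem_preimage H i 0)
    (genericPoint_mem_preimage H i k))
  rw [rat_mul_rat (genericPoint_mem_preimage H i 0) (genericPoint_mem_preimage H i k),
    ← theta_expo H i k, ← theta_expo H i l,
    ← map_mul, AddMonoidAlgebra.single_mul_single, one_mul, add_sub_cancel]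

lemma toK_coord (v : Fin 2 → Fin 2) (i l : Fin 2) :
    toK (chart f v) (genericPoint_mem_chart H v) (coord f v i l) = rat (f i) (v i) l :=
  toK_appLE_coord (f i) _ _ _ _

lemma theta_injective : Function.Injective (theta H) := by
  refine laurentEval_injective _ _ _ ?_
  have h : MvPolynomial.eval₂Hom ((toK (chart f 0) (genericPoint_mem_chart H 0)).comp
      (cst (str f) _)) (fun i => rat (f i) 0 1) =
      (toK (chart f 0) (genericPoint_mem_chart H 0)).comp (chartEval f 0) := by
    refine MvPolynomial.ringHom_ext (fun c => ?_) fun i => ?_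
    · simp [chartEval]
    · simp [chartEval, toK_coord H]
  rw [h]
  exact (toK_injective _ _).comp (chartEval_bijective H 0).injective

omit H [AlgebraicGeometry.IsIntegral Q] in
lemma eq_sum_rho (v : Fin 2 → Fin 2) (a : Fin 2 → ℤ) :
    a = ∑ i, rho (i, (v i).succAbove 0) a • (expo i ((v i).succAbove 0) - expo i (v i)) := by
  ext j
  have h := congrFun (PP.eq_sum_rho (v j) (fun _ : Fin 1 => a j)) 0
  rw [Finset.sum_apply, Finset.sum_eq_single j]
  · simp only [Finset.univ_unique, Finset.sum_singleton] at h
    refine h.trans ?_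
    simp only [Pi.smul_apply, Pi.sub_apply, expo, if_true]
    rfl
  · intro i _ hi
    simp [expo, hi.symm]
  · simp

omit H [AlgebraicGeometry.IsIntegral Q] in
lemma basicOpen_coord (v : Fin 2 → Fin 2) (i l : Fin 2) :
    Q.basicOpen (coord f v i l) = chart f v ⊓ f i ⁻¹ᵁ PP.chart l := by
  rw [coord, Scheme.basicOpen_appLE, ← PP.chart_inf_chart, Scheme.Hom.preimage_inf, ← inf_assoc,
    inf_eq_left.mpr (chart_le f v i)]

/-- The toric atlas of the product of two projective lines. -/
def atlas : ToricAtlas Q (Fin 2 → Fin 2) (Fin 2 × Fin 2) (Fin 2 → ℤ) where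
  chart := chart f
  isAffineOpen := isAffineOpen_chart H
  mem_chart := genericPoint_mem_chart H
  θ := theta H
  θ_injective := theta_injective H
  rho := rho
  rays v := {r | r.2 ≠ v r.1}
  range_chart v x := by
    refine exists_iff_suppIn (theta H) (chartEval f v) (chartEval_bijective H v).surjective _
      (fun i => expo i ((v i).succAbove 0) - expo i (v i)) (fun i => ?_) (fun c => ?_) _ ?_ ?_ ?_ x
    · simp [chartEval, theta_expo_sub, toK_coord H]
    · simp [chartEval, theta_single_zero H c v]
    · simp
    · intro a ha i r hr
      have := ha r hr
      rw [map_add, map_sub, rho_expo, rho_expo]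
      by_cases h : r.1 = i
      · subst h
        have hr' : r.2 ≠ v r.1 := hr
        simp only [hr', if_false, if_true]
        split_ifs <;> omega
      · simpa [h] using this
    · intro a ha
      refine ⟨fun i => (rho (i, (v i).succAbove 0) a).toNat, (eq_sum_rho v a).trans ?_⟩
      refine Finset.sum_congr rfl fun i _ => ?_
      rw [← natCast_zsmul, Int.toNat_of_nonneg (ha _ (Fin.succAbove_ne (v i) 0))]
  exists_inf_eq_basicOpen v w := by
    -- The intersection with chart w is cut out by the product of the functions x_{w i} / x_{v i},
    -- one for each factor.
    have key (r : Fin 2 × Fin 2) : rho r (∑ i, (expo i (w i) - expo i (v i))) =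
        (if r.2 = w r.1 then 1 else 0) - if r.2 = v r.1 then 1 else 0 := by
      rw [map_sum, Finset.sum_eq_single r.1]
      · simp [rho_expo]
      · intro i _ hi
        simp [rho_expo, hi.symm]
      · simp
    refine ⟨∑ i, (expo i (w i) - expo i (v i)), coord f v 0 (w 0) * coord f v 1 (w 1), ?_, ?_, ?_,
      ?_⟩
    · rw [map_mul, toK_coord H, toK_coord H, ← theta_expo_sub H, ← theta_expo_sub H, ← map_mul,
        AddMonoidAlgebra.single_mul_single, one_mul, Fin.sum_univ_two]
    · rw [Scheme.basicOpen_mul, basicOpen_coord, basicOpen_coord, ← inf_inf_distrib_left]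
      rfl
    · intro r hv hw
      have hv' : r.2 ≠ v r.1 := hv
      have hw' : r.2 ≠ w r.1 := hw
      rw [key, if_neg hv', if_neg hw', sub_zero]
    · intro r hv hw
      have hv' : r.2 ≠ v r.1 := hv
      have hw' : r.2 = w r.1 := not_not.mp hw
      rw [key, if_pos hw', if_neg hv']
      norm_num

end BiP1

/-! ### Morphisms to projective space in toric coordinates -/

/-- Units of the Laurent ring are monomials up to a constant. -/
lemma exists_eq_single_of_mul_eq_one {ι : Type} [AddCommGroup ι] [TwoUniqueSums ι]
    {F G : AddMonoidAlgebra ℂ ι} (h : F * G = 1) :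
    ∃ (m : ι) (c : ℂ), c ≠ 0 ∧ F = AddMonoidAlgebra.single m c := by
  classical
  have hF : F ≠ 0 := fun h0 => by simp [h0] at h
  have hG : G ≠ 0 := fun h0 => by simp [h0] at h
  have hFs : F.coeff.support.Nonempty :=
    Finsupp.support_nonempty_iff.mpr fun h => hF (AddMonoidAlgebra.coeff_injective h)
  have hGs : G.coeff.support.Nonempty :=
    Finsupp.support_nonempty_iff.mpr fun h => hG (AddMonoidAlgebra.coeff_injective h)
  have hcard : F.coeff.support.card ≤ 1 := by
    by_contra hlt
    have h1 : 1 < F.coeff.support.card * G.coeff.support.card := by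
      have := hGs.card_pos
      nlinarith
    -- Were F not a monomial, two different pairs of exponents would have unique sums. Both sums
    -- contribute nonzero coefficients to 1, so both are 0, contradicting uniqueness.
    obtain ⟨p, hp, q, hq, hne, hup, huq⟩ := TwoUniqueSums.uniqueAdd_of_one_lt_card h1
    rw [Finset.mem_product] at hp hq
    have key (p : ι × ι) (hp : p.1 ∈ F.coeff.support ∧ p.2 ∈ G.coeff.support)
        (hu : UniqueAdd F.coeff.support G.coeff.support p.1 p.2) : p.1 + p.2 = 0 := by
      have h2 := AddMonoidAlgebra.coeff_mul_add_of_uniqueAdd hu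
      by_contra h0
      rw [h, AddMonoidAlgebra.one_def, AddMonoidAlgebra.coeff_single,
        Finsupp.single_eq_of_ne h0] at h2
      exact mul_ne_zero (Finsupp.mem_support_iff.mp hp.1) (Finsupp.mem_support_iff.mp hp.2) h2.symm
    have := hup hq.1 hq.2 ((key q hq huq).trans (key p hp hup).symm)
    exact hne (Prod.ext this.1.symm this.2.symm)
  obtain ⟨m, hm⟩ := Finset.card_eq_one.mp (le_antisymm hcard hFs.card_pos)
  obtain ⟨hm0, hm1⟩ := Finsupp.support_eq_singleton.mp hm
  exact ⟨m, _, hm0, AddMonoidAlgebra.coeff_injective hm1⟩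

section Coordinates

variable {X : Scheme.{0}} [IsIntegral X] {n : ℕ}

/-- On an affine open set with factorial ring of functions, rational functions have coprime
homogeneous coordinates. -/
lemma exists_coprime_coordinates {V : X.Opens} (hV : IsAffineOpen V) (hη : genericPoint X ∈ V)
    [UniqueFactorizationMonoid Γ(X, V)] {x : Fin (n + 1) → X.functionField}
    {k : Fin (n + 1)} (hk : x k ≠ 0) :
    ∃ (κ : X.functionField) (q : Fin (n + 1) → Γ(X, V)), κ ≠ 0 ∧
      (∀ l, toK V hη (q l) = x l * κ) ∧ ∀ a b, (∀ l, a ∣ b * q l) → a ∣ b := by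
  classical
  have : Nonempty V := ⟨⟨_, hη⟩⟩
  have := functionField_isFractionRing_of_isAffineOpen X V hV
  let := UniqueFactorizationMonoid.strongNormalizationMonoid (α := Γ(X, V))
  let := UniqueFactorizationMonoid.toNormalizedGCDMonoid Γ(X, V)
  have halg (a : Γ(X, V)) : algebraMap Γ(X, V) X.functionField a = toK V hη a := rfl
  obtain ⟨⟨b, hb⟩, hbx⟩ := IsLocalization.exist_integer_multiples_of_finite
    (nonZeroDivisors Γ(X, V)) x
  choose p hp using hbx
  simp only [Algebra.smul_def, halg] at hp
  have hb0 : toK V hη b ≠ 0 := fun h0 =>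
    nonZeroDivisors.ne_zero hb (toK_injective V hη (h0.trans (map_zero _).symm))
  obtain ⟨q, hq, hq1⟩ := Finset.extract_gcd p (Finset.univ_nonempty (α := Fin (n + 1)))
  have hdvd (a b : Γ(X, V)) (h : ∀ l, a ∣ b * q l) : a ∣ b := by
    have h1 := Finset.dvd_gcd (s := Finset.univ) fun l _ => h l
    have h2 := (Finset.gcd_mul_left' (s := Finset.univ) (f := q) b).dvd
    rw [hq1, mul_one] at h2
    exact h1.trans h2
  have hg0 : toK V hη (Finset.univ.gcd p) ≠ 0 := fun h0 => by
    have h1 := hp k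
    rw [hq k (Finset.mem_univ _), map_mul, h0, zero_mul] at h1
    exact mul_ne_zero hb0 hk h1.symm
  refine ⟨toK V hη b * (toK V hη (Finset.univ.gcd p))⁻¹, q,
    mul_ne_zero hb0 (inv_ne_zero hg0), fun l => ?_, hdvd⟩
  rw [← mul_assoc, mul_comm (x l), ← hp, hq l (Finset.mem_univ _), map_mul, mul_comm,
    inv_mul_cancel_left₀ hg0]

/-- Coprime coordinates may still have common zeros in codimension two; being the coordinates of a
morphism defined everywhere rules this out. Near a point of chart k the ratios x_l / x_k are
regular, so q k divides fᴺ q l for all l, and coprimality makes q k divide a power of f. -/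
lemma span_coordinates_eq_top {g : X ⟶ PP n} {i₀ : Fin (n + 1)}
    (h₀ : genericPoint X ∈ g ⁻¹ᵁ PP.chart i₀) {V : X.Opens} (hV : IsAffineOpen V)
    (hη : genericPoint X ∈ V) {κ : X.functionField} {q : Fin (n + 1) → Γ(X, V)}
    (hq : ∀ l, toK V hη (q l) = rat g i₀ l * κ) (hdvd : ∀ a b, (∀ l, a ∣ b * q l) → a ∣ b) :
    Ideal.span (Set.range q) = ⊤ := by
  rw [← hV.self_le_iSup_basicOpen_iff]
  intro x hx
  obtain ⟨k, hk⟩ := Opens.mem_iSup.mp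
    ((iSup_preimage_chart g).ge (Opens.mem_top x) : x ∈ ⨆ k, g ⁻¹ᵁ PP.chart k)
  obtain ⟨f, hf, hxf⟩ := hV.exists_basicOpen_le ⟨x, hk⟩ hx
  have hηf := genericPoint_mem_of_mem hxf
  have hfV := X.basicOpen_le f
  have hηk := hf hηf
  have key (l) : ∃ N : ℕ, q k ∣ f ^ N * q l := by
    obtain ⟨N, c, hc⟩ := exists_pow_mul_eq_resO hV f hfV rfl
      ((g.appLE (PP.chart k) _ hf).hom (PP.coord k l))
    refine ⟨N, c, toK_injective V hη ?_⟩
    have := congrArg (toK _ hηf) hc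
    rw [map_mul, map_pow, toK_resO, toK_resO, toK_appLE_coord] at this
    rw [map_mul, map_mul, ← this, map_pow, hq, hq, ← rat_mul_rat h₀ hηk l]
    ring
  choose N hN using key
  have h1 : q k ∣ f ^ (∑ l, N l + 1) := hdvd _ _ fun l =>
    (hN l).trans (mul_dvd_mul_right (pow_dvd_pow _
      ((Finset.single_le_sum (fun _ _ => Nat.zero_le _) (Finset.mem_univ l)).trans
        (Nat.le_succ _))) _)
  obtain ⟨c, hc⟩ := h1
  refine Opens.mem_iSup.mpr ⟨⟨q k, k, rfl⟩, ?_⟩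
  have h2 : x ∈ X.basicOpen (q k * c) := by
    rw [← hc, Scheme.basicOpen_pow _ _ (Nat.succ_pos _)]
    exact hxf
  rw [Scheme.basicOpen_mul] at h2
  exact h2.1

/-- In a toric atlas with factorial rings of functions, a morphism to projective space is given by
homogeneous coordinates that differ by monomials from chart to chart. -/
lemma ToricAtlas.exists_monomial_coordinates {J R ι : Type} [AddCommGroup ι] [TwoUniqueSums ι]
    [Finite R] (A : ToricAtlas X J R ι) (hA : ∀ j, UniqueFactorizationMonoid Γ(X, A.chart j))
    (j₀ : J) {g : X ⟶ PP n} {i₀ : Fin (n + 1)} (h₀ : genericPoint X ∈ g ⁻¹ᵁ PP.chart i₀) :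
    ∃ (κ : X.functionField) (μ : J → ι), κ ≠ 0 ∧
      (∀ j, ∃ q : Fin (n + 1) → Γ(X, A.chart j), Ideal.span (Set.range q) = ⊤ ∧
        ∀ l, toK _ (A.mem_chart j) (q l) = rat g i₀ l * (κ * A.mon (μ j))) ∧
      ∀ i j, ∀ r ∈ A.rays i, r ∈ A.rays j → A.rho r (μ i) = A.rho r (μ j) := by
  classical
  have hne : rat g i₀ i₀ ≠ 0 := by rw [rat_self h₀]; exact one_ne_zero
  have h1 (j) := exists_coprime_coordinates (A.isAffineOpen j) (A.mem_chart j) hne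
  choose κ q hκ hq hdvd using h1
  have hspan (j) := span_coordinates_eq_top h₀ (A.isAffineOpen j) (A.mem_chart j) (hq j) (hdvd j)
  -- From 1 = ∑ c_l q_{i,l} one gets κ_j / κ_i = ∑ c_l q_{j,l}, which is regular on the
  -- intersection. Exchanging i and j gives the inverse, so the ratio is a unit.
  have hfrac (i j) : ∃ f, SuppIn f {a | ∀ r ∈ A.common {i, j}, 0 ≤ A.rho r a} ∧
      A.θ f = κ j / κ i := by
    rw [← A.range_inf (Finset.insert_nonempty _ _)]
    have h1 : (1 : Γ(X, A.chart i)) ∈ Ideal.span (Set.range (q i)) := by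
      rw [hspan i]
      trivial
    obtain ⟨c, hc⟩ := Ideal.mem_span_range_iff_exists_fun.mp h1
    have hi : ({i, j} : Finset J).inf A.chart ≤ A.chart i := Finset.inf_le (by simp)
    have hj : ({i, j} : Finset J).inf A.chart ≤ A.chart j := Finset.inf_le (by simp)
    refine ⟨∑ l, resO hi (c l) * resO hj (q j l), ?_⟩
    have h2 := congrArg (toK _ (A.mem_chart i)) hc
    rw [map_sum, map_one] at h2
    rw [map_sum, eq_div_iff (hκ i), Finset.sum_mul, ← mul_one (κ j), ← h2, Finset.mul_sum]
    refine Finset.sum_congr rfl fun l _ => ?_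
    rw [map_mul, map_mul, toK_resO, toK_resO, hq, hq]
    ring
  have hmon (i j) : ∃ (m : ι) (c : ℂ), c ≠ 0 ∧
      A.θ (AddMonoidAlgebra.single m c) = κ j / κ i ∧ ∀ r ∈ A.common {i, j}, 0 ≤ A.rho r m := by
    obtain ⟨F, hF, hF'⟩ := hfrac i j
    obtain ⟨G, hG, hG'⟩ := hfrac j i
    have h : F * G = 1 := by
      apply A.θ_injective
      rw [map_mul, hF', hG', map_one, div_mul_div_cancel₀ (hκ i), div_self (hκ j)]
    obtain ⟨m, c, hc, rfl⟩ := exists_eq_single_of_mul_eq_one h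
    refine ⟨m, c, hc, hF', hF m ?_⟩
    rw [AddMonoidAlgebra.coeff_single, Finsupp.single_eq_same]
    exact hc
  choose m c hc hm hr using hmon
  have hmm (i j k) : m i k = m i j + m j k := by
    have h : AddMonoidAlgebra.single (m i k) (c i k) =
        AddMonoidAlgebra.single (m i j + m j k) (c i j * c j k) := by
      apply A.θ_injective
      rw [← AddMonoidAlgebra.single_mul_single, map_mul, hm, hm, hm, mul_comm,
        div_mul_div_cancel₀ (hκ j)]
    have h' := congrArg (fun f => f.coeff) h
    simp only [AddMonoidAlgebra.coeff_single] at h'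
    rcases Finsupp.single_eq_single_iff _ _ _ _ |>.mp h' with h | h
    · exact h.1
    · exact absurd h.1 (hc i k)
  refine ⟨κ j₀, m j₀, hκ j₀, fun j => ?_, fun i j r hi hj => ?_⟩
  -- The constants c are absorbed into the coordinates, so that the scaling factors differ by pure
  -- monomials.
  · obtain ⟨b, hb⟩ := (A.range_chart j (A.θ (AddMonoidAlgebra.single 0 (c j₀ j)⁻¹))).mpr
      ⟨_, suppIn_single (by simp), rfl⟩
    obtain ⟨b', hb'⟩ := (A.range_chart j (A.θ (AddMonoidAlgebra.single 0 (c j₀ j)))).mpr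
      ⟨_, suppIn_single (by simp), rfl⟩
    have hbb : b * b' = 1 := by
      apply toK_injective _ (A.mem_chart j)
      rw [map_mul, hb, hb', ← map_mul, AddMonoidAlgebra.single_mul_single,
        inv_mul_cancel₀ (hc _ _), map_one, zero_add]
      exact map_one A.θ
    refine ⟨fun l => b * q j l, ?_, fun l => ?_⟩
    · rw [eq_top_iff, ← hspan j, Ideal.span_le]
      rintro _ ⟨l, rfl⟩
      have : q j l = b' * (b * q j l) := by rw [← mul_assoc, mul_comm b', hbb, one_mul]
      rw [this]
      exact Ideal.mul_mem_left _ _ (Ideal.subset_span ⟨l, rfl⟩)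
    · rw [map_mul, hb, hq]
      have h2 : κ j = κ j₀ * (A.θ (AddMonoidAlgebra.single 0 (c j₀ j)) * A.mon (m j₀ j)) := by
        rw [mon, ← map_mul, AddMonoidAlgebra.single_mul_single, zero_add, mul_one, hm,
          mul_div_cancel₀ _ (hκ j₀)]
      have h3 : A.θ (AddMonoidAlgebra.single 0 (c j₀ j)⁻¹) *
          A.θ (AddMonoidAlgebra.single 0 (c j₀ j)) = 1 := by
        rw [← map_mul, AddMonoidAlgebra.single_mul_single, inv_mul_cancel₀ (hc _ _), zero_add]
        exact map_one A.θ
      rw [h2]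
      linear_combination (rat g i₀ l * κ j₀ * A.mon (m j₀ j)) * h3
  · have hcom : r ∈ A.common {i, j} := by
      intro k hk
      rcases Finset.mem_insert.mp hk with rfl | hk
      · exact hi
      · rw [Finset.mem_singleton.mp hk]; exact hj
    have h1 := hr i j r hcom
    have h2 := hr j i r (Finset.pair_comm i j ▸ hcom)
    have h3 := congrArg (A.rho r) (hmm j₀ i j)
    have h4 := congrArg (A.rho r) (hmm j₀ j i)
    rw [map_add] at h3 h4
    omega

end Coordinates

/-! ### Rational functions that are homogeneous for a grading -/

section Homogeneous

variable {ι K : Type} [AddCommGroup ι] [Field K] (θ : AddMonoidAlgebra ℂ ι →+* K) (ψ : ι →+ ℤ)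

/-- Quotients of Laurent polynomials that are homogeneous of degree zero for the grading `ψ`. -/
def IsHomQuot (u : K) : Prop := ∃ (W W' : AddMonoidAlgebra ℂ ι) (m : ℤ), SuppIn W {a | ψ a = m} ∧
  SuppIn W' {a | ψ a = m} ∧ θ W' ≠ 0 ∧ u * θ W' = θ W

variable {θ ψ}

lemma SuppIn.mul_hom {f g : AddMonoidAlgebra ℂ ι} {m m' : ℤ} (hf : SuppIn f {a | ψ a = m})
    (hg : SuppIn g {a | ψ a = m'}) : SuppIn (f * g) {a | ψ a = m + m'} :=
  hf.mul hg fun a ha b hb => by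
    simp only [Set.mem_ofPred_eq] at ha hb ⊢
    rw [map_add, ha, hb]

lemma IsHomQuot.const (c : ℂ) : IsHomQuot θ ψ (θ (AddMonoidAlgebra.single 0 c)) := by
  refine ⟨AddMonoidAlgebra.single 0 c, 1, 0, suppIn_single (map_zero ψ), ?_, ?_, ?_⟩
  · rw [AddMonoidAlgebra.one_def]
    exact suppIn_single (map_zero ψ)
  · rw [map_one]; exact one_ne_zero
  · rw [map_one, mul_one]

lemma IsHomQuot.add {u v : K} (hu : IsHomQuot θ ψ u) (hv : IsHomQuot θ ψ v) :
    IsHomQuot θ ψ (u + v) := by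
  obtain ⟨W₁, W₁', m₁, h₁, h₁', hne₁, he₁⟩ := hu
  obtain ⟨W₂, W₂', m₂, h₂, h₂', hne₂, he₂⟩ := hv
  refine ⟨W₁ * W₂' + W₁' * W₂, W₁' * W₂', m₁ + m₂, (h₁.mul_hom h₂').add (h₁'.mul_hom h₂),
    h₁'.mul_hom h₂', ?_, ?_⟩
  · rw [map_mul]; exact mul_ne_zero hne₁ hne₂
  · rw [map_add, map_mul, map_mul, map_mul, ← he₁, ← he₂]; ring

lemma IsHomQuot.mul {u v : K} (hu : IsHomQuot θ ψ u) (hv : IsHomQuot θ ψ v) :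
    IsHomQuot θ ψ (u * v) := by
  obtain ⟨W₁, W₁', m₁, h₁, h₁', hne₁, he₁⟩ := hu
  obtain ⟨W₂, W₂', m₂, h₂, h₂', hne₂, he₂⟩ := hv
  refine ⟨W₁ * W₂, W₁' * W₂', m₁ + m₂, h₁.mul_hom h₂, h₁'.mul_hom h₂', ?_, ?_⟩
  · rw [map_mul]; exact mul_ne_zero hne₁ hne₂
  · rw [map_mul, map_mul, ← he₁, ← he₂]; ring

/-- A monomial of nonzero degree is not a quotient of homogeneous quotients. -/
lemma IsHomQuot.degree_eq_zero (hθ : Function.Injective θ) {u v : K} (hu : IsHomQuot θ ψ u)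
    (hv : IsHomQuot θ ψ v) (hu0 : u ≠ 0) {a : ι}
    (h : θ (AddMonoidAlgebra.single a 1) * v = u) : ψ a = 0 := by
  obtain ⟨W₁, W₁', m₁, h₁, h₁', hne₁, he₁⟩ := hu
  obtain ⟨W₂, W₂', m₂, h₂, h₂', hne₂, he₂⟩ := hv
  have e : AddMonoidAlgebra.single a 1 * W₂ * W₁' = W₁ * W₂' := by
    apply hθ
    rw [map_mul, map_mul, map_mul, ← he₁, ← he₂, ← h]
    ring
  have hne : W₁ * W₂' ≠ 0 := fun h0 => by
    have := congrArg θ h0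
    rw [map_mul, ← he₁, map_zero] at this
    exact mul_ne_zero (mul_ne_zero hu0 hne₁) hne₂ this
  obtain ⟨b, hb⟩ : ∃ b, (W₁ * W₂').coeff b ≠ 0 := by
    by_contra! h0
    exact hne (AddMonoidAlgebra.coeff_injective (Finsupp.ext h0))
  have hb1 : ψ b = m₁ + m₂ := h₁.mul_hom h₂' b hb
  have hs : SuppIn (AddMonoidAlgebra.single a (1 : ℂ)) {b | ψ b = ψ a} := suppIn_single rfl
  have hb2 : ψ b = ψ a + m₂ + m₁ := (hs.mul_hom h₂).mul_hom h₁' b (e ▸ hb)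
  omega

end Homogeneous

/-! ### Positivity of the bidegree of a closed immersion -/

namespace BiP1

variable {Q : Scheme.{0}} [AlgebraicGeometry.IsIntegral Q] {f : Fin 2 → (Q ⟶ PP 1)}
  (H : IsPullback (f 0) (f 1) (PP.toSpec 1) (PP.toSpec 1))

omit [AlgebraicGeometry.IsIntegral Q] in
include H in
lemma uniqueFactorizationMonoid (v : Fin 2 → Fin 2) :
    UniqueFactorizationMonoid Γ(Q, chart f v) :=
  (RingEquiv.ofBijective _ (chartEval_bijective H v)).toMulEquiv.uniqueFactorizationMonoid
    inferInstance

omit [AlgebraicGeometry.IsIntegral Q] in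
lemma rho_zero_add_rho_one (j : Fin 2) (a : Fin 2 → ℤ) : rho (j, 0) a + rho (j, 1) a = 0 := by
  have := PP.sum_rho (n := 1) fun _ => a j
  rwa [Fin.sum_univ_two] at this

/-- If all coordinates of `i` are homogeneous quotients, then `i` is not a closed immersion. -/
lemma not_isHomQuot {n : ℕ} (i : Q ⟶ PP n) [IsClosedImmersion i]
    (hstr : str f = i ≫ PP.toSpec n) {k : Fin (n + 1)} (hk : genericPoint Q ∈ i ⁻¹ᵁ PP.chart k)
    (j : Fin 2) : ¬ ∀ l, IsHomQuot (theta H) (rho (j, 1)) (rat i k l) := by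
  intro hl
  have key (s : Γ(Q, i ⁻¹ᵁ PP.chart k)) : IsHomQuot (theta H) (rho (j, 1)) (toK _ hk s) := by
    -- For a closed immersion the functions on the preimage of the chart are polynomials in the
    -- coordinates of `i`, and homogeneous quotients form a ring; `hstr` matches the constants.
    obtain ⟨s', rfl⟩ := i.app_surjective _ (PP.isAffineOpen_chart k) s
    obtain ⟨p, rfl⟩ := (PP.chartEval_bijective k).surjective s'
    have happ (a : Γ(PP n, PP.chart k)) : (i.app (PP.chart k)).hom a =
        (i.appLE (PP.chart k) _ le_rfl).hom a := by
      rw [Scheme.Hom.app_eq_appLE]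
    induction p using MvPolynomial.induction_on with
    | C c =>
      have h1 : toK _ hk ((i.app (PP.chart k)).hom (PP.chartEval k (MvPolynomial.C c))) =
          theta H (AddMonoidAlgebra.single 0 c) := by
        rw [happ, PP.chartEval, MvPolynomial.eval₂Hom_C, appLE_cst, ← hstr,
          theta_single_zero H c 0,
          ← toK_resO inf_le_left (generic_mem_inf hk (genericPoint_mem_chart H 0)),
          ← toK_resO inf_le_right (generic_mem_inf hk (genericPoint_mem_chart H 0)),
          resO_cst, resO_cst]
      exact h1 ▸ IsHomQuot.const c
    | add p q hp hq =>
      have h1 := hp.add hq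
      rwa [← map_add, ← map_add, ← map_add] at h1
    | mul_X p m hp =>
      have h1 : toK _ hk ((i.app (PP.chart k)).hom (PP.chartEval k (MvPolynomial.X m))) =
          rat i k (k.succAbove m) := by
        rw [happ, PP.chartEval, MvPolynomial.eval₂Hom_X', toK_appLE_coord]
      have h2 := hp.mul (h1.symm ▸ hl (k.succAbove m))
      rwa [← map_mul, ← map_mul, ← map_mul] at h2
  have : Nonempty (i ⁻¹ᵁ PP.chart k) := ⟨⟨_, hk⟩⟩
  have := functionField_isFractionRing_of_isAffineOpen Q (i ⁻¹ᵁ PP.chart k)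
    ((PP.isAffineOpen_chart k).preimage i)
  -- The function field consists of fractions of such functions. It contains the affine coordinate
  -- of the j-th factor, a monomial of degree 1, which is impossible for a quotient of degree 0.
  obtain ⟨⟨x, y, hy⟩, hxy⟩ := IsLocalization.surj (nonZeroDivisors Γ(Q, i ⁻¹ᵁ PP.chart k))
    (theta H (AddMonoidAlgebra.single (expo j 1) 1))
  have hxy' : theta H (AddMonoidAlgebra.single (expo j 1) 1) * toK _ hk y = toK _ hk x := hxy
  have hy0 : toK _ hk y ≠ 0 := fun h0 =>
    nonZeroDivisors.ne_zero hy (toK_injective _ hk (h0.trans (map_zero _).symm))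
  have hne : toK _ hk x ≠ 0 := by
    rw [← hxy']
    refine mul_ne_zero (fun h0 => ?_) hy0
    have := theta_injective H (h0.trans (map_zero _).symm)
    have h1 := congrArg (fun f => f.coeff (expo j 1)) this
    simp only [AddMonoidAlgebra.coeff_single, Finsupp.single_eq_same] at h1
    exact one_ne_zero h1
  have := (key x).degree_eq_zero (theta_injective H) (key y) hne hxy'
  rw [rho_expo] at this
  simp at this

/-- A closed immersion into projective space is given by homogeneous coordinates of positive
bidegree. -/
lemma exists_coordinates {n : ℕ} (i : Q ⟶ PP n) [IsClosedImmersion i]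
    (hstr : str f = i ≫ PP.toSpec n) {k : Fin (n + 1)} (hk : genericPoint Q ∈ i ⁻¹ᵁ PP.chart k) :
    ∃ (κ : Q.functionField) (μ : (Fin 2 → Fin 2) → (Fin 2 → ℤ)) (d : Fin 2 × Fin 2 → ℤ),
      κ ≠ 0 ∧ (∀ v, ∃ q : Fin (n + 1) → Γ(Q, chart f v), Ideal.span (Set.range q) = ⊤ ∧
        ∀ l, toK _ (genericPoint_mem_chart H v) (q l) = rat i k l * (κ * (atlas H).mon (μ v))) ∧
      (∀ v, ∀ r : Fin 2 × Fin 2, r.2 ≠ v r.1 → rho r (μ v) = d r) ∧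
      ∀ j, 0 < d (j, 0) + d (j, 1) := by
  obtain ⟨κ, μ, hκ, hq, hμ⟩ := (atlas H).exists_monomial_coordinates
    (uniqueFactorizationMonoid H) 0 hk
  -- In `Fin 2`, r.2 + 1 is the other index, so the chart with this constant index has `r` among its
  -- half spaces; by `hμ` the value is the same for every such chart.
  refine ⟨κ, μ, fun r => rho r (μ fun _ => r.2 + 1), hκ, hq, fun v r hr => ?_, fun j => ?_⟩
  · exact hμ _ _ r hr (show r.2 ≠ r.2 + 1 by omega)
  -- The rescaled coordinates are global sections: by injectivity of `theta` a single Laurent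
  -- polynomial works for all charts, and every half space occurs in some chart.
  have hw (l) : ∃ w : AddMonoidAlgebra ℂ (Fin 2 → ℤ),
      SuppIn w {a | ∀ r, -rho r (μ fun _ => r.2 + 1) ≤ rho r a} ∧
        theta H w = rat i k l * κ := by
    have h1 (v) : ∃ w : AddMonoidAlgebra ℂ (Fin 2 → ℤ),
        SuppIn w {a | ∀ r ∈ (atlas H).rays v, - rho r (μ v) ≤ rho r a} ∧
        theta H w = rat i k l * κ := by
      obtain ⟨q, -, hq⟩ := hq v
      obtain ⟨w, hw, hw'⟩ := ((atlas H).range_chart v _).mp ⟨q l, rfl⟩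
      refine ⟨AddMonoidAlgebra.single (-μ v) 1 * w, hw.single_mul _ _ fun a ha r hr => ?_, ?_⟩
      · rw [map_add, map_neg]
        have := ha r hr
        change 0 ≤ rho r a at this
        omega
      · have h2 := hw'.trans (hq l)
        have h3 : (atlas H).mon (-μ v) * (atlas H).mon (μ v) = 1 := by
          rw [← ToricAtlas.mon_add, neg_add_cancel, ToricAtlas.mon_zero]
        rw [map_mul]
        refine (congrArg ((atlas H).mon (-μ v) * ·) h2).trans ?_
        linear_combination rat i k l * κ * h3
    choose w hw hw' using h1
    refine ⟨w 0, fun a ha r => ?_, hw' 0⟩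
    have h2 : w 0 = w fun _ => r.2 + 1 := theta_injective H ((hw' _).trans (hw' _).symm)
    rw [h2] at ha
    exact hw _ a ha r (show r.2 ≠ r.2 + 1 by omega)
  choose w hw hw' using hw
  have hk1 : theta H (w k) = κ := by rw [hw', rat_self hk, one_mul]
  have hsum (l a) (ha : (w l).coeff a ≠ 0) :
      -rho (j, 0) (μ fun _ => (0 : Fin 2) + 1) ≤ rho (j, 0) a ∧
      -rho (j, 1) (μ fun _ => (1 : Fin 2) + 1) ≤ rho (j, 1) a :=
    ⟨hw l a ha (j, 0), hw l a ha (j, 1)⟩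
  by_contra! hle
  refine not_isHomQuot H i hstr hk j fun l => ?_
  -- The two pairings of an exponent along factor j sum to 0 and have lower bounds summing to at
  -- least 0, so both bounds are attained and the coordinates are homogeneous of a common degree.
  have hsupp (l) : SuppIn (w l) {a | rho (j, 1) a = -rho (j, 1) (μ fun _ => (1 : Fin 2) + 1)} := by
    intro a ha
    have h1 := hsum l a ha
    have h2 := rho_zero_add_rho_one j a
    simp only [Set.mem_ofPred_eq] at hle ⊢
    omega
  exact ⟨w l, w k, _, hsupp l, hsupp k, hk1 ▸ hκ, by rw [hw' l, hk1]⟩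

end BiP1

/-! ### Sections of ideal sheaves -/

section IdealSheaf

variable {X Y : Scheme.{0}} (f : X ⟶ Y)

/-- The comorphism of `f`, as a morphism of modules. -/
def comorphism : structureModule Y ⟶ (Scheme.Modules.pushforward f).obj (structureModule X) :=
  SheafOfModules.unitToPushforwardObjUnit f.toRingCatSheafHom

/-- The inclusion of the ideal sheaf. -/
def idealInclusion : idealSheaf f ⟶ structureModule Y := Limits.kernel.ι (comorphism f)

instance : Mono (idealInclusion f) :=
  inferInstanceAs (Mono (Limits.kernel.ι (C := Y.Modules) (comorphism f)))

/-- A section of the ideal sheaf as a function. -/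
def idealFun (U : Y.Opens) : Γ(idealSheaf f, U) →+ Γ(Y, U) := ((idealInclusion f).app U).hom

lemma idealFun_smul {U : Y.Opens} (a : Γ(Y, U)) (m : Γ(idealSheaf f, U)) :
    idealFun f U (a • m) = a * idealFun f U m :=
  (idealInclusion f).app_smul a m

lemma idealFun_res {U V : Y.Opens} (h : V ≤ U) (m : Γ(idealSheaf f, U)) :
    idealFun f V (res (idealSheaf f) h m) = resO h (idealFun f U m) :=
  ConcreteCategory.congr_hom ((idealInclusion f).mapPresheaf.naturality (homOfLE h).op) m

/-- Sections over an open set. -/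
def sectionsFunctor (U : Y.Opens) : Y.Modules ⥤ Ab.{0} :=
  Scheme.Modules.toPresheaf Y ⋙ (evaluation (Opens Y)ᵒᵖ Ab.{0}).obj (op U)

instance (U : Y.Opens) : Limits.PreservesLimits (sectionsFunctor U) := by
  have : Limits.PreservesLimits ((evaluation (Opens Y)ᵒᵖ Ab.{0}).obj (op U)) :=
    ⟨fun {J} _ => Limits.evaluation_preservesLimitsOfShape (J := J) (op U)⟩
  exact Limits.comp_preservesLimits _ _

instance (U : Y.Opens) : (sectionsFunctor U).PreservesZeroMorphisms where
  map_zero _ _ := rfl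

lemma idealFun_injective (U : Y.Opens) : Function.Injective (idealFun f U) := by
  have h : Mono ((sectionsFunctor U).map (idealInclusion f)) := inferInstance
  exact (AddCommGrpCat.mono_iff_injective _).mp h

/-- The ideal sheaf is a kernel in the category of modules, and taking sections preserves limits, so
it is a kernel on sections as well. -/
lemma exists_idealFun_eq {U : Y.Opens} (a : Γ(Y, U)) :
    (∃ s, idealFun f U s = a) ↔ (f.app U).hom a = 0 := by
  have hw : idealInclusion f ≫ comorphism f = 0 := Limits.kernel.condition _
  have hex : (ShortComplex.mk (idealInclusion f) (comorphism f) hw).Exact :=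
    ShortComplex.exact_kernel _
  have h := hex.map_of_mono_of_preservesKernel (sectionsFunctor U) inferInstance inferInstance
  rw [ShortComplex.ab_exact_iff] at h
  constructor
  · rintro ⟨s, rfl⟩
    have := congrArg (fun g => (sectionsFunctor U).map g) hw
    rw [Functor.map_comp] at this
    exact ConcreteCategory.congr_hom this s
  · intro ha
    exact h a ha

/-- An ideal sheaf consists of rational functions. -/
def Rat.idealSheaf [IsIntegral Y] : Rat (CastelnuovoMumford.idealSheaf f) where
  val V h := (toK V h).toAddMonoidHom.comp (idealFun f V)
  inj V h := (toK_injective V h).comp (idealFun_injective f V)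
  smul V h a m := by
    refine (congrArg (toK V h) (idealFun_smul f a m)).trans (map_mul _ _ _)
  val_res {V W} h hW m := (congrArg (toK W hW) (idealFun_res f h m)).trans (toK_resO h hW _)

lemma Rat.idealSheaf_val [IsIntegral Y] {V : Y.Opens} (h : genericPoint Y ∈ V)
    (s : Γ(CastelnuovoMumford.idealSheaf f, V)) :
    (Rat.idealSheaf f).val V h s = toK V h (idealFun f V s) := rfl

/-- If the ideal is generated by `a` on an affine open set, then so is the ideal sheaf. -/
lemma Rat.idealSheaf_gen [IsIntegral Y] [QuasiCompact f] {U : Y.Opens} (hU : IsAffineOpen U)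
    (hη : genericPoint Y ∈ U) (a : Γ(Y, U)) (ha : a ≠ 0)
    (h : f.ker.ideal ⟨U, hU⟩ = Ideal.span {a}) :
    (Rat.idealSheaf f).Gen U (toK U hη a) := by
  have hne : toK U hη a ≠ 0 := fun h0 => ha (toK_injective U hη (h0.trans (map_zero _).symm))
  have hker {V : Y.Opens} (hVU : V ≤ U) : (f.app V).hom (resO hVU a) = 0 := by
    have h0 : a ∈ f.ker.ideal ⟨U, hU⟩ := h ▸ Ideal.mem_span_singleton_self a
    rw [Scheme.Hom.ker_apply, RingHom.mem_ker] at h0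
    have h1 := ConcreteCategory.congr_hom (f.naturality (homOfLE hVU).op) a
    refine Eq.trans h1 ?_
    exact (congrArg _ h0).trans
      (map_zero (X.presheaf.map ((Opens.map f.base).map (homOfLE hVU)).op).hom)
  have hbasic {V : Y.Opens} (hVU : V ≤ U) (hV : ∃ g : Γ(Y, U), V = Y.basicOpen g)
      (b : Γ(Y, V)) (hb : (f.app V).hom b = 0) : ∃ c, b = c * resO hVU a := by
    obtain ⟨g, hg⟩ := hV
    obtain rfl := hg
    have h1 := f.ker.map_ideal_basicOpen ⟨U, hU⟩ g
    have h2 : b ∈ f.ker.ideal ⟨_, hU.basicOpen g⟩ := by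
      rw [Scheme.Hom.ker_apply, RingHom.mem_ker]
      exact hb
    have h3 : b ∈ Ideal.map (resO hVU) (f.ker.ideal ⟨U, hU⟩) := h1 ▸ h2
    rw [h, Ideal.map_span, Set.image_singleton, Ideal.mem_span_singleton'] at h3
    obtain ⟨c, hc⟩ := h3
    exact ⟨c, hc.symm⟩
  refine ⟨hne, fun V hV hηV x => ?_⟩
  constructor
  · rintro ⟨s, rfl⟩
    have hs := (exists_idealFun_eq f _).mp ⟨s, rfl⟩
    -- `V` need not be affine, so the quotient by `a` is shown to be regular on basic open sets of
    -- `U`, where the ideal is the localized one.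
    obtain ⟨J, W, hW, hWV⟩ : ∃ (J : Type) (W : J → Y.Opens), (∀ j, W j ≤ V ∧
        ∃ g : Γ(Y, U), W j = Y.basicOpen g) ∧ V ≤ iSup W := by
      have h1 (y : V) := hU.exists_basicOpen_le y (hV y.2)
      choose g hg hy using h1
      exact ⟨V, fun y => Y.basicOpen (g y), fun y => ⟨hg y, g y, rfl⟩,
        fun y hy' => Opens.mem_iSup.mpr ⟨⟨y, hy'⟩, hy ⟨y, hy'⟩⟩⟩
    obtain ⟨c, hc⟩ := exists_toK_of_cover W (fun j => (hW j).1) hWV hηV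
      ((Rat.idealSheaf f).val V hηV s / toK U hη a) fun j hj => by
        obtain ⟨c, hc⟩ := hbasic ((hW j).1.trans hV) (hW j).2
          (idealFun f _ (res _ (hW j).1 s)) ((exists_idealFun_eq f _).mp ⟨_, rfl⟩)
        refine ⟨c, ?_⟩
        rw [eq_div_iff hne, ← (Rat.idealSheaf f).val_res (hW j).1 hj, Rat.idealSheaf_val, hc,
          map_mul, toK_resO]
    exact ⟨c, by rw [hc, div_mul_cancel₀ _ hne]⟩
  · rintro ⟨c, rfl⟩
    obtain ⟨s, hs⟩ := (exists_idealFun_eq f (c * resO hV a)).mpr (by rw [map_mul, hker hV, mul_zero])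
    exact ⟨s, by rw [Rat.idealSheaf_val, hs, map_mul, toK_resO]⟩

/-- The ideal sheaf of the zero scheme of a section of a line bundle. -/
lemma Rat.idealSheaf_gen_of_isZeroScheme [IsIntegral Y] [QuasiCompact f] {L : Y.Modules}
    (χ : Rat L) (s : Γ(L, ⊤)) (hs : s ≠ 0) (hI : IsZeroScheme L s f.ker) {U : Y.Opens}
    (hU : IsAffineOpen U) (hη : genericPoint Y ∈ U) {lam : Y.functionField} (h : χ.Gen U lam) :
    (Rat.idealSheaf f).Gen U (χ.val ⊤ trivial s * lam⁻¹) := by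
  obtain ⟨e, he, hframe⟩ := h.exists_isFrame hη
  obtain ⟨a, ha⟩ := (hframe U le_rfl).2 (res L le_top s)
  have ha' : res L le_top s = a • e := by rw [← ha, res_self]
  have h1 := congrArg (χ.val U hη) ha'
  rw [χ.val_res, χ.smul, he] at h1
  have h2 : toK U hη a = χ.val ⊤ trivial s * lam⁻¹ := by rw [h1, mul_inv_cancel_right₀ h.1]
  rw [← h2]
  refine Rat.idealSheaf_gen f hU hη a ?_ (hI ⟨U, hU⟩ e hframe a ha')
  rintro rfl
  rw [map_zero, zero_mul] at h1
  exact hs (χ.inj ⊤ trivial (h1.trans (map_zero _).symm))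

end IdealSheaf

/-! ### The exact sequence of ideal sheaves of a chain of closed immersions -/

section IdealLift

variable {X Y : Scheme.{0}} (f : X ⟶ Y)

/-- The section of the ideal sheaf given by a function that vanishes on the subscheme. -/
def idealLift {U : Y.Opens} (a : Γ(Y, U)) (h : (f.app U).hom a = 0) : Γ(idealSheaf f, U) :=
  ((exists_idealFun_eq f a).mpr h).choose

lemma idealFun_idealLift {U : Y.Opens} (a : Γ(Y, U)) (h : (f.app U).hom a = 0) :
    idealFun f U (idealLift f a h) = a :=
  ((exists_idealFun_eq f a).mpr h).choose_spec

lemma app_idealFun {U : Y.Opens} (s : Γ(idealSheaf f, U)) : (f.app U).hom (idealFun f U s) = 0 :=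
  (exists_idealFun_eq f _).mp ⟨s, rfl⟩

lemma app_resO {U V : Y.Opens} (h : V ≤ U) (a : Γ(Y, U)) :
    (f.app V).hom (resO h a) = resO (f.preimage_mono h) ((f.app U).hom a) :=
  ConcreteCategory.congr_hom (f.naturality (homOfLE h).op) a

end IdealLift

section Chain

variable {D Q X : Scheme.{0}} (j : D ⟶ Q) (i : Q ⟶ X)

lemma app_appLE_eq_zero {V : X.Opens} {W : Q.Opens} (h : W ≤ i ⁻¹ᵁ V) {a : Γ(X, V)}
    (ha : ((j ≫ i).app V).hom a = 0) : (j.app W).hom ((i.appLE V W h).hom a) = 0 := by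
  have h1 : (j.app (i ⁻¹ᵁ V)).hom ((i.app V).hom a) = 0 :=
    (ConcreteCategory.congr_hom (Scheme.Hom.comp_app j i V) a).symm.trans ha
  refine (app_resO j h ((i.app V).hom a)).trans ?_
  rw [h1, map_zero]

lemma app_comp_idealFun {V : X.Opens} (s : Γ(idealSheaf i, V)) :
    ((j ≫ i).app V).hom (idealFun i V s) = 0 := by
  refine (ConcreteCategory.congr_hom (Scheme.Hom.comp_app j i V) _).trans ?_
  exact (congrArg (j.app _).hom (app_idealFun i s)).trans (map_zero _)

/-- The inclusion of the ideal sheaf of the larger closed subscheme. -/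
def idealMap (V : X.Opens) : Γ(idealSheaf i, V) →+ Γ(idealSheaf (j ≫ i), V) :=
  AddMonoidHom.mk' (fun s => idealLift (j ≫ i) (idealFun i V s) (app_comp_idealFun j i s)) fun s t => by
    apply idealFun_injective (j ≫ i)
    simp only [map_add, idealFun_idealLift]

lemma idealFun_idealMap {V : X.Opens} (s : Γ(idealSheaf i, V)) :
    idealFun (j ≫ i) V (idealMap j i V s) = idealFun i V s :=
  idealFun_idealLift _ _ (app_comp_idealFun j i s)

/-- Restriction of functions to the larger closed subscheme. -/
def idealRestrict (V : X.Opens) (W : Q.Opens) (h : W ≤ i ⁻¹ᵁ V) :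
    Γ(idealSheaf (j ≫ i), V) →+ Γ(idealSheaf j, W) :=
  AddMonoidHom.mk' (fun s => idealLift j ((i.appLE V W h).hom (idealFun (j ≫ i) V s))
      (app_appLE_eq_zero j i h (app_idealFun _ s))) fun s t => by
    apply idealFun_injective j
    simp only [map_add, idealFun_idealLift]

lemma idealFun_idealRestrict {V : X.Opens} {W : Q.Opens} (h : W ≤ i ⁻¹ᵁ V)
    (s : Γ(idealSheaf (j ≫ i), V)) : idealFun j W (idealRestrict j i V W h s) =
      (i.appLE V W h).hom (idealFun (j ≫ i) V s) :=
  idealFun_idealLift _ _ (app_appLE_eq_zero j i h (app_idealFun _ s))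

variable {ι : Type} (U : ι → X.Opens) (g : ∀ a b, Γ(X, U a ⊓ U b)ˣ)

/-- The twist of `idealMap`. -/
def twistIdealMap (V : X.Opens) :
    twistSections (idealSheaf i) U g V →+ twistSections (idealSheaf (j ≫ i)) U g V :=
  AddMonoidHom.mk' (fun m => ⟨fun a => idealMap j i _ (m.1 a), fun a b => by
      apply idealFun_injective (j ≫ i)
      have h := congrArg (idealFun i _) (m.2 a b)
      rw [idealFun_res, idealFun_smul, idealFun_res] at h
      rw [idealFun_res, idealFun_smul, idealFun_res, idealFun_idealMap, idealFun_idealMap, h]⟩)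
    fun m m' => Subtype.ext (funext fun a => map_add (idealMap j i _) _ _)

/-- `twistIdealMap` as a morphism of sheaves. -/
def twistIdealMapHom : shf (twistBy (idealSheaf i) U g) ⟶ shf (twistBy (idealSheaf (j ≫ i)) U g) :=
  ⟨{ app V := AddCommGrpCat.ofHom (twistIdealMap j i U g V.unop)
     naturality V W h := by
      refine AddCommGrpCat.hom_ext (AddMonoidHom.ext fun m => ?_)
      change twistSections (idealSheaf i) U g V.unop at m
      refine Subtype.ext (funext fun a => ?_)
      change idealMap j i _ (res _ _ (m.1 a)) = res _ _ (idealMap j i _ (m.1 a))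
      apply idealFun_injective (j ≫ i)
      rw [idealFun_res, idealFun_idealMap, idealFun_idealMap, idealFun_res] }⟩

lemma preimage_inf_le (V W : X.Opens) : i ⁻¹ᵁ V ⊓ i ⁻¹ᵁ W ≤ i ⁻¹ᵁ (V ⊓ W) := le_rfl

variable {U} {g' : ∀ a b, Γ(Q, i ⁻¹ᵁ U a ⊓ i ⁻¹ᵁ U b)ˣ}
  (hg : ∀ a b, (i.appLE (U a ⊓ U b) _ (preimage_inf_le i _ _)).hom (g a b : Γ(X, U a ⊓ U b)) =
    (g' a b : Γ(Q, i ⁻¹ᵁ U a ⊓ i ⁻¹ᵁ U b)))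

/-- The twist of `idealRestrict`. -/
def twistIdealRestrict (V : X.Opens) :
    twistSections (idealSheaf (j ≫ i)) U g V →+
      twistSections (idealSheaf j) (fun a => i ⁻¹ᵁ U a) g' (i ⁻¹ᵁ V) :=
  AddMonoidHom.mk' (fun m => ⟨fun a => idealRestrict j i (V ⊓ U a) (i ⁻¹ᵁ V ⊓ i ⁻¹ᵁ U a)
      (preimage_inf_le i _ _) (m.1 a), fun a b => by
      apply idealFun_injective j
      have hle : i ⁻¹ᵁ V ⊓ (i ⁻¹ᵁ U a ⊓ i ⁻¹ᵁ U b) ≤ i ⁻¹ᵁ (V ⊓ (U a ⊓ U b)) := le_rfl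
      have h := congrArg (fun s => (i.appLE _ _ hle).hom (idealFun (j ≫ i) _ s)) (m.2 a b)
      simp only [idealFun_res, idealFun_smul, map_mul, appLE_resO] at h
      rw [idealFun_res, idealFun_smul, idealFun_res, idealFun_idealRestrict,
        idealFun_idealRestrict, ← hg, resO_appLE, resO_appLE, resO_appLE]
      exact h⟩)
    fun m m' => Subtype.ext (funext fun a => map_add (idealRestrict j i _ _ _) _ _)

/-- `twistIdealRestrict` as a morphism of sheaves. -/
def twistIdealRestrictHom : shf (twistBy (idealSheaf (j ≫ i)) U g) ⟶
    (TopCat.Sheaf.pushforward Ab.{0} i.base).obj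
      (shf (twistBy (idealSheaf j) (fun a => i ⁻¹ᵁ U a) g')) :=
  ⟨{ app V := AddCommGrpCat.ofHom (twistIdealRestrict j i g hg V.unop)
     naturality V W h := by
      refine AddCommGrpCat.hom_ext (AddMonoidHom.ext fun m => ?_)
      change twistSections (idealSheaf (j ≫ i)) U g V.unop at m
      refine Subtype.ext (funext fun a => ?_)
      have hWV : W.unop ≤ V.unop := leOfHom h.unop
      have hle : i ⁻¹ᵁ W.unop ⊓ i ⁻¹ᵁ U a ≤ i ⁻¹ᵁ V.unop ⊓ i ⁻¹ᵁ U a :=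
        inf_le_inf_right _ (i.preimage_mono hWV)
      change idealRestrict j i _ (i ⁻¹ᵁ W.unop ⊓ i ⁻¹ᵁ U a) (preimage_inf_le i _ _)
          (res _ (inf_le_inf_right _ hWV) (m.1 a)) =
        res _ hle (idealRestrict j i _ (i ⁻¹ᵁ V.unop ⊓ i ⁻¹ᵁ U a) (preimage_inf_le i _ _) (m.1 a))
      apply idealFun_injective j
      rw [idealFun_res, idealFun_idealRestrict, idealFun_idealRestrict, idealFun_res, appLE_resO,
        resO_appLE] }⟩

lemma twistIdealMapHom_comp :
    twistIdealMapHom j i U g ≫ twistIdealRestrictHom j i g hg = 0 := by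
  refine CategoryTheory.Sheaf.hom_ext (NatTrans.ext (funext fun V => ?_))
  refine AddCommGrpCat.hom_ext (AddMonoidHom.ext fun m => ?_)
  change twistSections (idealSheaf i) U g V.unop at m
  refine Subtype.ext (funext fun a => ?_)
  change idealRestrict j i (V.unop ⊓ U a) (i ⁻¹ᵁ V.unop ⊓ i ⁻¹ᵁ U a) (preimage_inf_le i _ _)
    (idealMap j i _ (m.1 a)) = 0
  apply idealFun_injective j
  rw [idealFun_idealRestrict, idealFun_idealMap, map_zero]
  refine Eq.trans ?_ (app_idealFun i (m.1 a))
  rw [Scheme.Hom.app_eq_appLE]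
  rfl

variable [IsClosedImmersion i]

/-- The twisted exact sequence of ideal sheaves of a chain of closed subschemes. -/
lemma twistIdeal_shortExact (hU : ⨆ a, U a = ⊤)
    (hc : ∀ a b c (W : X.Opens) (h : W ≤ U a ⊓ U b) (h' : W ≤ U b ⊓ U c) (h'' : W ≤ U a ⊓ U c),
      resO h (g a b : Γ(X, U a ⊓ U b)) * resO h' (g b c : Γ(X, U b ⊓ U c)) =
        resO h'' (g a c : Γ(X, U a ⊓ U c))) :
    (ShortComplex.mk (C := TopCat.Sheaf Ab.{0} X) _ _ (twistIdealMapHom_comp j i g hg)).ShortExact := by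
  refine shortExact_of_sections _ _ _ (fun V m m' h => ?_) (fun V m hm => ?_)
    fun V m x hx => ?_
  · change twistSections (idealSheaf i) U g V at m m'
    have h0 : twistIdealMap j i U g V m = twistIdealMap j i U g V m' := h
    refine Subtype.ext (funext fun a => ?_)
    have h1 : idealMap j i _ (m.1 a) = idealMap j i _ (m'.1 a) :=
      congrFun (congrArg Subtype.val h0) a
    apply idealFun_injective i
    rw [← idealFun_idealMap j i, h1, idealFun_idealMap]
  · change twistSections (idealSheaf (j ≫ i)) U g V at m
    have h0 : twistIdealRestrict j i g hg V m = 0 := hm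
    have hm' (a) : (i.app (V ⊓ U a)).hom (idealFun (j ≫ i) _ (m.1 a)) = 0 := by
      have h1 : idealRestrict j i (V ⊓ U a) (i ⁻¹ᵁ V ⊓ i ⁻¹ᵁ U a) (preimage_inf_le i _ _)
          (m.1 a) = 0 := congrFun (congrArg Subtype.val h0) a
      have h2 := (idealFun_idealRestrict j i _ _).symm.trans
        ((congrArg (idealFun j _) h1).trans (map_zero _))
      rw [Scheme.Hom.app_eq_appLE]
      exact h2
    let t : twistSections (idealSheaf i) U g V :=
      ⟨fun a => idealLift i _ (hm' a), fun a b => by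
        apply idealFun_injective i
        have h := congrArg (idealFun (j ≫ i) _) (m.2 a b)
        rw [idealFun_res, idealFun_smul, idealFun_res] at h
        rw [idealFun_res, idealFun_smul, idealFun_res, idealFun_idealLift, idealFun_idealLift, h]⟩
    refine ⟨t, Subtype.ext (funext fun a => ?_)⟩
    apply idealFun_injective (j ≫ i)
    exact (idealFun_idealMap j i _).trans (idealFun_idealLift _ _ (hm' a))
  · change twistSections (idealSheaf j) (fun a => i ⁻¹ᵁ U a) g' (i ⁻¹ᵁ V) at m
    obtain ⟨a, ha⟩ := Opens.mem_iSup.mp (hU.ge (Opens.mem_top x))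
    obtain ⟨W, hW, hxW, hWV⟩ := (Opens.isBasis_iff_nbhd.mp X.isBasis_affineOpens)
      (show x ∈ V ⊓ U a from ⟨hx, ha⟩)
    have hWU : W ≤ U a := hWV.trans inf_le_right
    have hWV' : W ≤ V := hWV.trans inf_le_left
    have hWi : i ⁻¹ᵁ W ≤ i ⁻¹ᵁ V ⊓ i ⁻¹ᵁ U a := i.preimage_mono hWV
    -- On an affine set inside `U a`, the component of `m` at `a` extends to the ambient scheme
    -- because `i` is a closed immersion. The other components of the lift are forced by the
    -- transition functions.
    obtain ⟨c, hc'⟩ := i.app_surjective W hW (resO hWi (idealFun j _ (m.1 a)))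
    have hc0 : ((j ≫ i).app W).hom c = 0 := by
      refine (ConcreteCategory.congr_hom (Scheme.Hom.comp_app j i W) c).trans ?_
      refine (congrArg (j.app _).hom hc').trans ((app_resO j hWi _).trans ?_)
      exact (congrArg (resO _) (app_idealFun j (m.1 a))).trans (map_zero _)
    have hle (b) : W ⊓ U b ≤ U b ⊓ U a := le_inf inf_le_right (inf_le_left.trans hWU)
    have hkill (b) : ((j ≫ i).app (W ⊓ U b)).hom
        (resO (hle b) (g b a : Γ(X, U b ⊓ U a)) * resO inf_le_left c) = 0 := by
      rw [map_mul, app_resO (j ≫ i) inf_le_left c, hc0, map_zero, mul_zero]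
    let t : twistSections (idealSheaf (j ≫ i)) U g W :=
      ⟨fun b => idealLift (j ≫ i) _ (hkill b), fun b b' => by
        apply idealFun_injective (j ≫ i)
        rw [idealFun_res, idealFun_smul, idealFun_res, idealFun_idealLift, idealFun_idealLift]
        simp only [map_mul, resO_resO]
        rw [← mul_assoc, hc]⟩
    refine ⟨W, hWV', t, Subtype.ext (funext fun b => ?_), hxW⟩
    have hb : i ⁻¹ᵁ W ⊓ i ⁻¹ᵁ U b ≤ i ⁻¹ᵁ V ⊓ i ⁻¹ᵁ U b :=
      inf_le_inf_right _ (i.preimage_mono hWV')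
    change idealRestrict j i (W ⊓ U b) (i ⁻¹ᵁ W ⊓ i ⁻¹ᵁ U b) (preimage_inf_le i _ _)
      (idealLift (j ≫ i) _ (hkill b)) = res _ hb (m.1 b)
    apply idealFun_injective j
    rw [idealFun_idealRestrict, idealFun_idealLift, idealFun_res, map_mul, appLE_resO, appLE_resO]
    have hb1 : i ⁻¹ᵁ W ⊓ i ⁻¹ᵁ U b ≤ i ⁻¹ᵁ V ⊓ (i ⁻¹ᵁ U b ⊓ i ⁻¹ᵁ U a) :=
      le_inf (inf_le_left.trans (i.preimage_mono hWV'))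
        (le_inf inf_le_right (inf_le_left.trans (i.preimage_mono hWU)))
    have h := congrArg (fun s => resO hb1 (idealFun j _ s)) (m.2 b a)
    simp only [idealFun_res, idealFun_smul, map_mul, resO_resO, ← hg, resO_appLE] at h
    refine Eq.trans ?_ h.symm
    refine congrArg _ ?_
    have h1 := congrArg (resO (inf_le_left : i ⁻¹ᵁ W ⊓ i ⁻¹ᵁ U b ≤ i ⁻¹ᵁ W)) hc'
    rw [resO_resO] at h1
    exact h1

end Chain

/-! ### Monomial frames of twisted ideal sheaves -/

lemma ToricAtlas.mon_zsmul {X : Scheme.{0}} [IsIntegral X] {J R ι : Type} [AddCommGroup ι]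
    (A : ToricAtlas X J R ι) (k : ℤ) (m : ι) : A.mon (k • m) = A.mon m ^ k := by
  cases k with
  | ofNat k => simp [mon_nsmul]
  | negSucc k => rw [Int.negSucc_eq, neg_smul, mon_neg, zpow_neg, ← Nat.cast_succ, natCast_zsmul,
      mon_nsmul, zpow_natCast]

/-- Twisting multiplies a generator by a power of the coordinate that does not vanish. -/
lemma Rat.Gen.twist_of_le {X : Scheme.{0}} [IsIntegral X] {n : ℕ} {g : X ⟶ PP n} {M : X.Modules}
    {χ : Rat M} {V : X.Opens} {κ : X.functionField} (h : χ.Gen V κ) (k : ℤ) {i₀ c : Fin (n + 1)}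
    (h₀ : genericPoint X ∈ g ⁻¹ᵁ PP.chart i₀) (hV : genericPoint X ∈ V)
    (hc : V ≤ g ⁻¹ᵁ PP.chart c) : (χ.twist g k i₀ h₀).Gen V (rat g i₀ c ^ k * κ) := by
  have h1 : rat g i₀ c * rat g c i₀ = 1 := by rw [rat_mul_rat h₀ (hc hV), rat_self h₀]
  have h2 : rat g i₀ c = (rat g c i₀)⁻¹ := eq_inv_of_mul_eq_one_left h1
  have := h.twist k h₀ hV (fun l => (g.appLE (PP.chart c) V hc).hom (PP.coord c l))
    (Ideal.eq_top_of_isUnit_mem _ (Ideal.subset_span ⟨c, rfl⟩) (by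
      simp only [PP.coord_self, map_one, isUnit_one])) (rat_ne_zero (hc hV) h₀) fun l => by
        rw [toK_appLE_coord, ← rat_mul_rat (hc hV) h₀, mul_comm]
  rwa [h2, inv_zpow, ← zpow_neg]

namespace PP

variable {n : ℕ}

lemma rat_id (c l : Fin (n + 1)) :
    rat (𝟙 (PP n)) c l = toK (chart c) (genericPoint_mem_chart c) (coord c l) := by
  rw [← toK_appLE_coord (𝟙 (PP n)) (genericPoint_mem_chart c) c l le_rfl]
  exact congrArg (toK (chart c) _) (resO_self le_rfl _)

lemma mon_expo (c : Fin (n + 1)) : (atlas n).mon (expo c) = rat (𝟙 (PP n)) 0 c := by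
  rw [rat_id]
  exact theta_expo c

lemma gen_twist {M : (PP n).Modules} {χ : Rat M} {c : Fin (n + 1)} {κ : (PP n).functionField}
    (h : χ.Gen (chart c) κ) (k : ℤ) : (χ.twist (𝟙 (PP n)) k 0 (genericPoint_mem_chart 0)).Gen
      (chart c) ((atlas n).mon (k • expo c) * κ) := by
  rw [ToricAtlas.mon_zsmul, mon_expo]
  exact h.twist_of_le k _ (genericPoint_mem_chart c) le_rfl

/-- The twists of the ideal sheaf of a hypersurface of degree `e`. -/
lemma exists_monFrames {Q : Scheme.{0}} {i : Q ⟶ PP n} [QuasiCompact i] {e : ℤ}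
    {s : Γ(lineBundle n e, ⊤)} (hs : s ≠ 0) (hI : IsZeroScheme (lineBundle n e) s i.ker) (k : ℤ) :
    ∃ (χ : Rat (twist (𝟙 (PP n)) k (idealSheaf i))) (B : (atlas n).MonFrames χ),
      B.d = fun r => if r = 0 then e - k else 0 := by
  let χL : Rat (lineBundle n e) :=
    (Rat.structureModule (PP n)).twist (𝟙 _) e 0 (genericPoint_mem_chart 0)
  let x := χL.val ⊤ trivial s
  have hx : x ≠ 0 := fun h => hs (χL.inj ⊤ trivial (h.trans (map_zero _).symm))
  -- Dividing by the value of `s` leaves the pure monomials (x_c/x_0)^(k - e) as generators. On the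
  -- half spaces r ≠ c, the exponent of x_c/x_0 pairs to -1 with r = 0 and to 0 otherwise, whence
  -- `d`.
  refine ⟨((Rat.idealSheaf i).twist (𝟙 _) k 0 (genericPoint_mem_chart 0)).scale x⁻¹
    (inv_ne_zero hx), ⟨fun c => (k - e) • expo c, fun r => if r = 0 then e - k else 0, fun c r hr => ?_, fun c => ?_⟩, rfl⟩
  · rw [map_zsmul]
    have hr' : r ≠ c := hr
    refine (congrArg ((k - e) • ·) (rho_expo r c)).trans ?_
    rw [if_neg hr', smul_eq_mul]
    split_ifs <;> ring
  · have h1 := Rat.idealSheaf_gen_of_isZeroScheme i χL s hs hI (isAffineOpen_chart c)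
      (genericPoint_mem_chart c) (gen_twist (Rat.structureModule_gen _) e)
    have h2 := (gen_twist h1 k).scale x⁻¹ (inv_ne_zero hx)
    have h3 : x⁻¹ * ((atlas n).mon (k • expo c) * (x * ((atlas n).mon (e • expo c) * 1)⁻¹)) =
        (atlas n).mon ((k - e) • expo c) := by
      rw [sub_smul, sub_eq_add_neg, ToricAtlas.mon_add, ToricAtlas.mon_neg]
      field_simp
    rw [← h3]
    exact h2

end PP

namespace BiP1

variable {Q : Scheme.{0}} [AlgebraicGeometry.IsIntegral Q] {f : Fin 2 → (Q ⟶ PP 1)}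
  (H : IsPullback (f 0) (f 1) (PP.toSpec 1) (PP.toSpec 1))

lemma gen_twist {M : Q.Modules} {χ : Rat M} {v : Fin 2 → Fin 2} {κ : Q.functionField}
    (h : χ.Gen (chart f v) κ) (i : Fin 2) (k : ℤ) :
    (χ.twist (f i) k 0 (genericPoint_mem_preimage H i 0)).Gen
      (chart f v) ((atlas H).mon (k • expo i (v i)) * κ) := by
  rw [ToricAtlas.mon_zsmul]
  have h1 : (atlas H).mon (expo i (v i)) = rat (f i) 0 (v i) := theta_expo H i (v i)
  rw [h1]
  exact h.twist_of_le k _ (genericPoint_mem_chart H v) (chart_le f v i)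

/-- The line bundle of bidegree `e`. -/
def bundle (f : Fin 2 → (Q ⟶ PP 1)) (e : Fin 2 → ℤ) : Q.Modules :=
  twist (f 0) (e 0) (twist (f 1) (e 1) (structureModule Q))

/-- The twists by multiples of a very ample line bundle of the ideal sheaf of a curve of bidegree
`e`. -/
lemma exists_monFrames {n : ℕ} (i : Q ⟶ PP n) [IsClosedImmersion i]
    (hstr : str f = i ≫ PP.toSpec n) {D : Scheme.{0}} {j : D ⟶ Q} [QuasiCompact j] {e : Fin 2 → ℤ}
    {s : Γ(bundle f e, ⊤)} (hs : s ≠ 0) (hI : IsZeroScheme (bundle f e) s j.ker) :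
    ∃ a : Fin 2 → ℤ, (∀ c, 0 < a c) ∧ ∀ k : ℤ, ∃ (χ : Rat (twist i k (idealSheaf j)))
      (B : (atlas H).MonFrames χ), ∀ c, B.d (c, 0) + B.d (c, 1) = e c - k * a c := by
  obtain ⟨i₀, h₀⟩ := exists_genericPoint_mem_chart i
  obtain ⟨κ, μ, d, hκ, hq, hμ, hd⟩ := exists_coordinates H i hstr h₀
  refine ⟨fun c => d (c, 0) + d (c, 1), hd, fun k => ?_⟩
  let χL : Rat (bundle f e) :=
    ((Rat.structureModule Q).twist (f 1) (e 1) 0 (genericPoint_mem_preimage H 1 0)).twist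
      (f 0) (e 0) 0 (genericPoint_mem_preimage H 0 0)
  let x := χL.val ⊤ trivial s
  have hx : x ≠ 0 := fun h => hs (χL.inj ⊤ trivial (h.trans (map_zero _).symm))
  have hκx : κ ^ k * x⁻¹ ≠ 0 := mul_ne_zero (zpow_ne_zero _ hκ) (inv_ne_zero hx)
  -- Rescaling by κᵏ/x removes the two factors of the generators that are not monomials. The sum of
  -- `d` over one factor is minus the degree of the line bundle along it.
  refine ⟨((Rat.idealSheaf j).twist i k i₀ h₀).scale (κ ^ k * x⁻¹) hκx,
    ⟨fun v => -(k • μ v + ∑ c, e c • expo c (v c)),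
      fun r => -(k * d r) + if r.2 = 0 then e r.1 else 0, fun v r hr => ?_, fun v => ?_⟩,
      fun c => ?_⟩
  · have hr' : r.2 ≠ v r.1 := hr
    change rho r _ = _
    rw [map_neg, map_add, map_zsmul, hμ v r hr', map_sum, Finset.sum_eq_single r.1]
    · rw [map_zsmul, rho_expo, if_pos rfl, if_neg hr', smul_eq_mul, smul_eq_mul]
      split_ifs <;> ring
    · intro c _ hc
      rw [map_zsmul, rho_expo, if_neg hc.symm, smul_zero]
    · simp
  · have h1 := Rat.idealSheaf_gen_of_isZeroScheme j χL s hs hI (isAffineOpen_chart H v)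
      (genericPoint_mem_chart H v)
      (gen_twist H (gen_twist H (Rat.structureModule_gen _) 1 (e 1)) 0 (e 0))
    obtain ⟨q, hq1, hq2⟩ := hq v
    have h2 := (h1.twist k h₀ (genericPoint_mem_chart H v) q hq1
      (mul_ne_zero hκ ((atlas H).mon_ne_zero _)) hq2).scale (κ ^ k * x⁻¹) hκx
    refine Eq.subst (motive := fun y => Rat.Gen _ _ y) ?_ h2
    have hm := (atlas H).mon_ne_zero
    change κ ^ k * x⁻¹ * ((κ * (atlas H).mon (μ v)) ^ (-k) * (x *
      ((atlas H).mon (e 0 • expo 0 (v 0)) * ((atlas H).mon (e 1 • expo 1 (v 1)) * 1))⁻¹)) = _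
    rw [Fin.sum_univ_two, ToricAtlas.mon_neg, ToricAtlas.mon_add, ToricAtlas.mon_add,
      (atlas H).mon_zsmul k, mul_zpow, zpow_neg, zpow_neg]
    have h3 := hm (e 0 • expo 0 (v 0))
    have h4 := hm (e 1 • expo 1 (v 1))
    have h5 := zpow_ne_zero k (hm (μ v))
    have h6 := zpow_ne_zero k hκ
    generalize (atlas H).mon (μ v) ^ k = y5 at *
    generalize κ ^ k = y6 at *
    field_simp
  · simp only [if_true, one_ne_zero, if_false]
    ring

end BiP1

/-! ### Vanishing theorems -/

namespace PP

variable {n : ℕ} {M : (PP n).Modules} {χ : Rat M}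

/-- Vanishing of the higher cohomology of line bundles of degree greater than `-(n + 1)`. -/
lemma van_of_sum_lt (B : (atlas n).MonFrames χ) (h : ∑ r, B.d r < n + 1) (p : ℕ) :
    Van p (shf M) ⊤ := by
  refine B.van (fun c => {c}) (fun c => Finset.singleton_nonempty c) ?_ (fun a => ?_) p
  · simp only [Finset.inf_singleton]
    exact iSup_chart.symm
  · obtain ⟨c, hc⟩ : ∃ c, B.d c ≤ rho c a := by
      by_contra! hlt
      have h1 := Finset.sum_le_sum fun c (_ : c ∈ Finset.univ) =>
        Int.add_one_le_iff.mpr (hlt c)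
      rw [Finset.sum_add_distrib, sum_rho] at h1
      simp at h1
      omega
    refine ⟨c, fun c' r _ hlt c'' hc'' => ?_⟩
    rw [Finset.mem_singleton.mp hc'']
    rintro rfl
    exact absurd hc (not_le.mpr hlt)

/-- Vanishing of cohomology above the dimension. -/
lemma van_of_le (B : (atlas n).MonFrames χ) {p : ℕ} (h : n ≤ p) : Van p (shf M) ⊤ := by
  have h1 : (Finset.univ.sup chart : (PP n).Opens) ⊓ ⊤ = ⊤ := by
    rw [inf_top_eq, Finset.sup_univ_eq_iSup, iSup_chart]
  rw [← h1]
  refine van_finset_sup _ _ _ (fun t ht m => ?_) p (by simpa using h)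
  rw [inf_top_eq]
  exact B.van_inf ht m

end PP

namespace BiP1

variable {Q : Scheme.{0}} [AlgebraicGeometry.IsIntegral Q] {f : Fin 2 → (Q ⟶ PP 1)}
  {H : IsPullback (f 0) (f 1) (PP.toSpec 1) (PP.toSpec 1)} {M : Q.Modules} {χ : Rat M}

/-- On one line two violated half spaces would force the bounds to sum to at least 2. -/
lemma exists_le_rho {d : Fin 2 × Fin 2 → ℤ} (c : Fin 2) (h : d (c, 0) + d (c, 1) ≤ 1)
    (a : Fin 2 → ℤ) : ∃ l, d (c, l) ≤ rho (c, l) a := by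
  by_contra! hlt
  have h1 := rho_zero_add_rho_one c a
  have h2 := hlt 0
  have h3 := hlt 1
  omega

/-- Vanishing of the higher cohomology of line bundles of bidegree at least `(-1, -1)`. -/
lemma van_of_le_one (B : (atlas H).MonFrames χ) (h : ∀ c, B.d (c, 0) + B.d (c, 1) ≤ 1) (p : ℕ) :
    Van p (shf M) ⊤ := by
  refine B.van (fun v => {v}) (fun v => Finset.singleton_nonempty v) ?_ (fun a => ?_) p
  · simp only [Finset.inf_singleton]
    exact iSup_chart.symm
  · choose v hv using fun c => exists_le_rho c (h c) a
    refine ⟨v, fun v' r _ hlt v'' hv'' => ?_⟩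
    rw [Finset.mem_singleton.mp hv'']
    intro hr
    have h1 := hv r.1
    rw [← hr] at h1
    exact absurd h1 (not_le.mpr hlt)

/-- The charts with first index `α` and second index in `T`. -/
def column (T : Finset (Fin 2)) (α : Fin 2) : Finset (Fin 2 → Fin 2) := T.image fun β => ![α, β]

omit [AlgebraicGeometry.IsIntegral Q] in
lemma mem_inf_column {T : Finset (Fin 2)} (hT : T.Nonempty) (α : Fin 2) (x : Q) :
    x ∈ (column T α).inf (chart f) ↔ x ∈ f 0 ⁻¹ᵁ PP.chart α ∧ ∀ β ∈ T, x ∈ f 1 ⁻¹ᵁ PP.chart β := by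
  rw [mem_finset_inf]
  simp only [column, Finset.mem_image, forall_exists_index, and_imp, forall_apply_eq_imp_iff₂]
  constructor
  · intro h
    obtain ⟨β, hβ⟩ := hT
    exact ⟨(h β hβ).1, fun β hβ => (h β hβ).2⟩
  · exact fun h β hβ => ⟨h.1, h.2 β hβ⟩

/-- The union of the intersections of the charts in a column. -/
def columnOpen (f : Fin 2 → (Q ⟶ PP 1)) (T : Finset (Fin 2)) : Q.Opens :=
  ⨆ α, (column T α).inf (chart f)

-- The column is the product of ℙ¹ with an affine piece of the second line, written as a union of
-- two intersections of charts.
omit [AlgebraicGeometry.IsIntegral Q] in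
lemma mem_columnOpen {T : Finset (Fin 2)} (hT : T.Nonempty) (x : Q) :
    x ∈ columnOpen f T ↔ ∀ β ∈ T, x ∈ f 1 ⁻¹ᵁ PP.chart β := by
  rw [columnOpen, Opens.mem_iSup]
  simp only [mem_inf_column hT]
  constructor
  · rintro ⟨α, h⟩
    exact h.2
  · intro h
    obtain ⟨α, hα⟩ := Opens.mem_iSup.mp
      ((iSup_preimage_chart (f 0)).ge (Opens.mem_top x) : x ∈ ⨆ k, f 0 ⁻¹ᵁ PP.chart k)
    exact ⟨α, hα, h⟩

/-- Half spaces of the second factor are shared by both members of the cover, so only the first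
factor matters for the cone. For p ≥ 1 a cover by two acyclic sets is enough. -/
lemma van_columnOpen (B : (atlas H).MonFrames χ) {T : Finset (Fin 2)} (hT : T.Nonempty) {p : ℕ}
    (h : B.d (0, 0) + B.d (0, 1) ≤ 1 ∨ 1 ≤ p) : Van p (shf M) (columnOpen f T) := by
  have hne (α) : (column T α).Nonempty := hT.image _
  rcases h with h | h
  · refine B.van (column T) hne rfl (fun a => ?_) p
    obtain ⟨α, hα⟩ := exists_le_rho 0 h a
    refine ⟨α, fun α' r hr hlt v hv => ?_⟩
    obtain ⟨β, hβ, rfl⟩ := Finset.mem_image.mp hv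
    have h1 : r.2 ≠ ![α', β] r.1 := hr _ (Finset.mem_image_of_mem _ hβ)
    change r.2 ≠ ![α, β] r.1
    obtain ⟨c, l⟩ := r
    fin_cases c
    · change l ≠ α
      rintro rfl
      exact absurd hα (not_le.mpr hlt)
    · exact h1
  · have h1 : (Finset.univ.sup fun α => (column T α).inf (chart f)) ⊓ ⊤ = columnOpen f T := by
      rw [inf_top_eq, Finset.sup_univ_eq_iSup, columnOpen]
    rw [← h1]
    refine van_finset_sup _ _ _ (fun t ht m => ?_) p (by simpa using h)
    rw [inf_top_eq, ← Finset.inf_biUnion]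
    refine B.van_inf ?_ m
    obtain ⟨α, hα⟩ := ht
    obtain ⟨v, hv⟩ := hne α
    exact ⟨v, Finset.mem_biUnion.mpr ⟨α, hα, hv⟩⟩

/-- Vanishing of the second cohomology of line bundles of first degree at least `-1`, and of
cohomology above the dimension. -/
lemma van_succ (B : (atlas H).MonFrames χ) {p : ℕ}
    (h : B.d (0, 0) + B.d (0, 1) ≤ 1 ∨ 1 ≤ p) : Van (p + 1) (shf M) ⊤ := by
  have h1 : columnOpen f {0} ⊔ columnOpen f {1} = ⊤ := by
    rw [eq_top_iff]
    intro x _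
    obtain ⟨β, hβ⟩ := Opens.mem_iSup.mp
      ((iSup_preimage_chart (f 1)).ge (Opens.mem_top x) : x ∈ ⨆ k, f 1 ⁻¹ᵁ PP.chart k)
    fin_cases β
    · exact Or.inl ((mem_columnOpen (Finset.singleton_nonempty _) x).mpr (by simpa using hβ))
    · exact Or.inr ((mem_columnOpen (Finset.singleton_nonempty _) x).mpr (by simpa using hβ))
  have h2 : columnOpen f {0} ⊓ columnOpen f {1} = columnOpen f {0, 1} := by
    ext x
    change x ∈ columnOpen f {0} ∧ x ∈ columnOpen f {1} ↔ x ∈ columnOpen f {0, 1}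
    rw [mem_columnOpen (Finset.singleton_nonempty _), mem_columnOpen (Finset.singleton_nonempty _),
      mem_columnOpen (Finset.insert_nonempty _ _)]
    simp
  rw [← h1]
  -- The two columns vanish in degree p + 1 simply because they are covered by two acyclic sets; the
  -- hypothesis matters only for their intersection, one degree lower.
  refine van_succ_sup (van_columnOpen B (Finset.singleton_nonempty _) ?_)
    (van_columnOpen B (Finset.singleton_nonempty _) ?_) ?_
  · omega
  · omega
  · rw [h2]
    exact van_columnOpen B (Finset.insert_nonempty _ _) h

end BiP1

/-! ### Regularity -/

lemma PP.coordUnit_cocycle {n : ℕ} {X : Scheme.{0}} (g : X ⟶ PP n) (a b c : Fin (n + 1))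
    {W : X.Opens} (h : W ≤ g ⁻¹ᵁ (PP.chart a ⊓ PP.chart b)) (h' : W ≤ g ⁻¹ᵁ (PP.chart b ⊓ PP.chart c))
    (h'' : W ≤ g ⁻¹ᵁ (PP.chart a ⊓ PP.chart c)) :
    Units.map (g.appLE _ W h).hom.toMonoidHom (PP.coordUnit a b) *
      Units.map (g.appLE _ W h').hom.toMonoidHom (PP.coordUnit b c) =
    Units.map (g.appLE _ W h'').hom.toMonoidHom (PP.coordUnit a c) := by
  refine Units.ext ?_
  have e := congrArg (g.appLE _ W h).hom (PP.coord_cocycle a b c)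
  rw [map_mul, appLE_resO, appLE_resO, appLE_resO] at e
  change (g.appLE _ W h).hom (resO inf_le_left (PP.coord a b)) *
    (g.appLE _ W h').hom (resO inf_le_left (PP.coord b c)) =
    (g.appLE _ W h'').hom (resO inf_le_left (PP.coord a c))
  rw [appLE_resO, appLE_resO, appLE_resO]
  exact e

/-- The pullback of the transition function from the `a`-th to the `b`-th chart. -/
def coordUnitOn {n : ℕ} {X : Scheme.{0}} (g : X ⟶ PP n) (a b : Fin (n + 1)) (W : X.Opens)
    (h : W ≤ g ⁻¹ᵁ (PP.chart a ⊓ PP.chart b)) : Γ(X, W)ˣ :=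
  Units.map (g.appLE (PP.chart a ⊓ PP.chart b) W h).hom.toMonoidHom (PP.coordUnit a b)

lemma resO_coordUnitOn_zpow {n : ℕ} {X : Scheme.{0}} (g : X ⟶ PP n) (a b : Fin (n + 1))
    {W W' : X.Opens} (h : W ≤ g ⁻¹ᵁ (PP.chart a ⊓ PP.chart b)) (h' : W' ≤ W) (k : ℤ) :
    resO h' ((coordUnitOn g a b W h ^ k : Γ(X, W)ˣ) : Γ(X, W)) =
      ((coordUnitOn g a b W' (h'.trans h) ^ k : Γ(X, W')ˣ) : Γ(X, W')) := by
  have h1 : Units.map (resO h').toMonoidHom (coordUnitOn g a b W h) =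
      coordUnitOn g a b W' (h'.trans h) := Units.ext (resO_appLE g h h' _)
  rw [← h1]
  exact congrArg Units.val (map_zpow (Units.map (resO h').toMonoidHom) _ k)

lemma appLE_coordUnitOn_zpow {n : ℕ} {Q X : Scheme.{0}} (i : Q ⟶ X) (g : X ⟶ PP n)
    (a b : Fin (n + 1)) {W : X.Opens} {W' : Q.Opens} (h : W ≤ g ⁻¹ᵁ (PP.chart a ⊓ PP.chart b))
    (h' : W' ≤ i ⁻¹ᵁ W) (h'' : W' ≤ (i ≫ g) ⁻¹ᵁ (PP.chart a ⊓ PP.chart b)) (k : ℤ) :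
    (i.appLE W W' h').hom ((coordUnitOn g a b W h ^ k : Γ(X, W)ˣ) : Γ(X, W)) =
      ((coordUnitOn (i ≫ g) a b W' h'' ^ k : Γ(Q, W')ˣ) : Γ(Q, W')) := by
  have h1 : Units.map (i.appLE W W' h').hom.toMonoidHom (coordUnitOn g a b W h) =
      coordUnitOn (i ≫ g) a b W' h'' :=
    Units.ext (ConcreteCategory.congr_hom (Scheme.Hom.appLE_comp_appLE i g _ W W' h h')
      (PP.coordUnit a b : Γ(PP n, PP.chart a ⊓ PP.chart b)))
  rw [← h1]
  exact congrArg Units.val (map_zpow (Units.map (i.appLE W W' h').hom.toMonoidHom) _ k)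

/-- Cohomology of the twisted ideal sheaf of a subscheme of a closed subscheme. -/
lemma subsingleton_H_idealSheaf_comp {n : ℕ} {D Q X : Scheme.{0}} (j : D ⟶ Q) (i : Q ⟶ X)
    [IsClosedImmersion i] (g : X ⟶ PP n) (k : ℤ) (p : ℕ)
    (h : Van p (shf (twist g k (idealSheaf i))) ⊤)
    (h' : Van p (shf (twist (i ≫ g) k (idealSheaf j))) ⊤) :
    Subsingleton (H (twist g k (idealSheaf (j ≫ i))) (p + 1)) := by
  have hS := twistIdeal_shortExact j i (U := fun a => g ⁻¹ᵁ PP.chart a)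
    (fun a b => coordUnitOn g a b (g ⁻¹ᵁ PP.chart a ⊓ g ⁻¹ᵁ PP.chart b) le_rfl ^ k)
    (g' := fun a b => coordUnitOn (i ≫ g) a b
      (i ⁻¹ᵁ (g ⁻¹ᵁ PP.chart a) ⊓ i ⁻¹ᵁ (g ⁻¹ᵁ PP.chart b)) le_rfl ^ k)
    (fun a b => appLE_coordUnitOn_zpow i g a b _ _ _ k)
    (iSup_preimage_chart g) fun a b c W h h' h'' => by
      refine (congrArg₂ (· * ·) (resO_coordUnitOn_zpow g a b _ h k)
        (resO_coordUnitOn_zpow g b c _ h' k)).trans (Eq.trans ?_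
        (resO_coordUnitOn_zpow g a c _ h'' k).symm)
      have := congrArg (fun x : Γ(X, W)ˣ => ((x ^ k : Γ(X, W)ˣ) : Γ(X, W)))
        (PP.coordUnit_cocycle g a b c h h' h'')
      simp only [mul_zpow, Units.val_mul] at this
      exact this
  exact subsingleton_of_shortExact hS (subsingleton_of_van _ h)
    (subsingleton_pushforward _ i.isClosedEmbedding _ h')

namespace BiP1

/-- A curve of bidegree `(2, 3)` on a smooth quadric is `3`-regular. -/
theorem isRegularSubscheme {Q D : Scheme.{0}} (f : Fin 2 → (Q ⟶ PP 1))
    (H : IsPullback (f 0) (f 1) (PP.toSpec 1) (PP.toSpec 1)) (i : Q ⟶ PP 3)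
    (hstr : str f = i ≫ PP.toSpec 3) (hi : MemLinearSystem (lineBundle 3 2) i) (j : D ⟶ Q)
    (hj : MemLinearSystem (twist (f 0) 2 (twist (f 1) 3 (structureModule Q))) j) :
    IsRegularSubscheme 3 (j ≫ i) := by
  obtain ⟨_, s, hs, hsi⟩ := hi
  obtain ⟨_, t, ht, htj⟩ := hj
  have := isIntegral H
  -- Twists on ℙ³ are taken along the identity, so their restrictions to `Q` are twists along `i ≫
  -- 𝟙`.
  have : IsClosedImmersion (i ≫ 𝟙 (PP 3)) := by rwa [Category.comp_id]
  obtain ⟨a, ha, hB⟩ := exists_monFrames H (i ≫ 𝟙 (PP 3)) (by rw [hstr, Category.comp_id])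
    (e := ![2, 3]) ht htj
  intro p hp
  obtain ⟨p, rfl⟩ : ∃ q, p = q + 1 := ⟨p - 1, by omega⟩
  refine subsingleton_H_idealSheaf_comp j i _ _ p ?_ ?_
  -- After the shift from p to p + 1 the twist is k = 2 - p, so I_Q(k) has degree -p. The sum of `d`
  -- is p, which is below 4 in all cases not covered by dimension.
  · obtain ⟨χ, B, hd⟩ := PP.exists_monFrames hs hsi (3 - ((p + 1 : ℕ) : ℤ))
    by_cases hp3 : 3 ≤ p
    · exact PP.van_of_le B hp3
    · refine PP.van_of_sum_lt B ?_ p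
      rw [hd, Finset.sum_ite_eq']
      simp
      omega
  -- The sums of `d` are 2 - k a₀ and 3 - k a₁ with k = 2 - p. For k = 2 both are at most 1, for k =
  -- 1 the first is, and from p = 2 on dimension suffices.
  · obtain ⟨χ, B, hd⟩ := hB (3 - ((p + 1 : ℕ) : ℤ))
    have h0 := hd 0
    have h1 := hd 1
    have ha0 := ha 0
    have ha1 := ha 1
    simp only [Matrix.cons_val_zero, Matrix.cons_val_one] at h0 h1
    rcases p with _ | p
    · refine van_of_le_one B (fun c => ?_) 0
      fin_cases c <;> simp at h0 h1 ⊢ <;> omega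
    · refine van_succ B ?_
      by_cases hp1 : 1 ≤ p
      · exact Or.inr hp1
      · left
        obtain rfl : p = 0 := by omega
        simp at h0
        omega

end BiP1

end CastelnuovoMumford

end

/-- Transport along φ makes `Q` the fibre product of two projective lines; `hφ` makes its two
ℂ-structures agree, so that constants pulled back along `i` are constants for the toric charts. -/
theorem proposition4p1 {Q D : Scheme.{0}}
    (i : Q ⟶ CastelnuovoMumford.PP 3) (hQ : CastelnuovoMumford.IsSmoothQuadric i)
    (φ : Q ≅ CastelnuovoMumford.P1xP1)
    (hφ : φ.hom ≫ CastelnuovoMumford.P1xP1.fst ≫ CastelnuovoMumford.PP.toSpec 1 =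
      i ≫ CastelnuovoMumford.PP.toSpec 3)
    (j : D ⟶ Q)
    (hD : CastelnuovoMumford.MemLinearSystem (CastelnuovoMumford.biLineBundle φ.hom 2 3) j) :
    CastelnuovoMumford.IsRegularSubscheme 3 (j ≫ i) := by
  refine CastelnuovoMumford.BiP1.isRegularSubscheme
    ![φ.hom ≫ CastelnuovoMumford.P1xP1.fst, φ.hom ≫ CastelnuovoMumford.P1xP1.snd] ?_ i ?_ hQ.1 j hD
  · refine IsPullback.of_iso_pullback ⟨?_⟩ φ rfl rfl
    change (φ.hom ≫ CastelnuovoMumford.P1xP1.fst) ≫ _ = (φ.hom ≫ CastelnuovoMumford.P1xP1.snd) ≫ _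
    rw [Category.assoc, Category.assoc, Limits.pullback.condition]
  · exact (Category.assoc _ _ _).trans hφ
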